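/- Let $n\ge 2$, $1\le k\le n$, $k'=n+1-k$, $I=\{0,1,\dots,n\}$, and let $A=(a_{ij})_{i,j\in I}$ be the Cartan matrix of type $A_n^{(1)}$: $a_{ii}=2$, $a_{ij}=-1$ if $i\equiv j\pm1 \pmod{n+1}$, and $a_{ij}=0$ otherwise. **The varieties.** Let $W(\varpi_k)$ be the complex vector space with basis the tableaux $(i_1<\dots<i_k)$, $1\le i_j\le n+1$, viewed as $k$-element subsets $s$ of $\mathbb Z/(n+1)$. For $i\in I$, $f_i$ sends $s$ to $(s\setminus\{i\})\cup\{i+1\}$ if $i\in s\not\ni i+1$ and to $0$ otherwise; $\alpha_i^\vee(c)$ multiplies $s$ by $c$ if $i\in s\not\ni i+1$, by $c^{-1}$ if $i\notin s\ni i+1$, and by $1$ otherwise. Put $Y_i(c)=(1+c^{-1}f_i)\,\alpha_i^\vee(c)$, $u_1=(1,\dots,k)$, $u_2=(1,\dots,k-1,n+1)$. For $x=(x^{(l)}_m)_{1\le l\le k<l+m\le n+1}$ and $y=(y^{(l)}_m)_{1\le l\le k\le l+m\le n}$ in $(\mathbb C^\times)^{kk'}$ let $$v_1(x)=Y_{k'}(x^{(k)}_{k'})\cdots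 Y_1(x^{(k)}_1)\cdots Y_n(x^{(1)}_n)\cdots Y_k(x^{(1)}_k)\,u_1,$$ $$v_2(y)=Y_{k'-1}(y^{(k)}_{k'-1})\cdots Y_0(y^{(k)}_0)\cdots Y_{n-1}(y^{(1)}_{n-1})\cdots Y_{k-1}(y^{(1)}_{k-1})\,u_2,$$ and let $\mathcal V_1,\mathcal V_2\subset W(\varpi_k)$ be the images of $v_1,v_2$. **The finite structures.** For a product $Y_{i_1}(c_1)\cdots Y_{i_N}(c_N)$ and $i\in I$ put $M_m=c_1^{a_{i_1,i}}\cdots c_{m-1}^{a_{i_{m-1},i}}c_m$ and $$\gamma_i=\prod_{m=1}^N c_m^{a_{i_m,i}},\qquad \varepsilon_i=\sum_{i_m=i}\frac1{M_m},\qquad e_i^c:\ c_j\longmapsto c_j\,\frac{\sum_{m\le j,\,i_m=i}\frac{c}{M_m}+\sum_{m>j,\,i_m=i}\frac1{M_m}}{\sum_{m<j,\,i_m=i}\frac{c}{M_m}+\sum_{m\ge j,\,i_m=i}\frac1{M_m}}.$$ Through $v_1$ this defines rational $e_i,\gamma_i,\varepsilon_i$ on $\mathcal V_1$ for $i=1,\dots,n$,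 and through $v_2$ rational $\overline e_i,\overline\gamma_i,\overline\varepsilon_i$ on $\mathcal V_2$ for $i=0,\dots,n-1$. **The map $\overline\sigma$.** For $(l,m)$ with $1\le l\le k<l+m\le n+1$ let $X^{(l)}_m(x)$ be the sum of the weights of all paths from $(l,m)$ to $(1,n)$ with steps $(i,j)\to(i,j+1)$, of weight $x^{(i)}_j/x^{(i)}_{j+1}$, and $(i,j)\to(i-1,j+1)$, of weight $1$, through points $(i,j)$ with $1\le i\le k<i+j\le n+1$; the weight of a path is the product of the weights of its steps. Put $X^{(l)}_m=1/x^{(1)}_n$ if $l+m=k$, and $x^{(k+1)}_m=1$ and $X^{(k+1)}_m=1$. Define $\overline\sigma:\mathcal V_1\dashrightarrow\mathcal V_2$ by $\overline\sigma(v_1(x))=v_2(\Sigma(x))$, where $$\Sigma(x)^{(l)}_m=x^{(l+1)}_m\,\frac{X^{(l)}_m(x)}{X^{(l+1)}_m(x)}\qquad(1\le l\le k\le l+m\le n).$$ **Geometric crystals.** An $A_n^{(1)}$-geometric crystal is an irreducible variety $X$ with rational functions $\gamma_i,\varepsilon_i$ and rational $\mathbb C^\times$-actions $e_i:\mathbb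 C^\times\times X\dashrightarrow X$, $(c,x)\mapsto e_i^c(x)$ $(i\in I)$, such that, as identities of rational functions and maps: (i) for generic $x\in X$, $e_i$ is defined at $(1,x)$ and $e_i^1(x)=x$; (ii) $\gamma_j(e_i^c(x))=c^{a_{ij}}\gamma_j(x)$; (iii) $e_i^{c_1}e_j^{c_2}=e_j^{c_2}e_i^{c_1}$ if $a_{ij}=a_{ji}=0$, and $e_i^{c_1}e_j^{c_1c_2}e_i^{c_2}=e_j^{c_2}e_i^{c_1c_2}e_j^{c_1}$ if $a_{ij}=a_{ji}=-1$; (iv) $\varepsilon_i(e_i^c(x))=c^{-1}\varepsilon_i(x)$, and $\varepsilon_i(e_j^c(x))=\varepsilon_i(x)$ if $a_{ij}=a_{ji}=0$. A birational isomorphism $\theta:T\to X$ from an algebraic torus is a positive structure on it if all $\gamma_i\circ\theta$ and $\varepsilon_i\circ\theta$, and the composites of all $(c,t)\mapsto\theta^{-1}(e_i^c(\theta(t)))$, $\mathbb C^\times\times T\dashrightarrow T$, with all characters of $T$, are positive, i.e. quotients of (nonempty) linear combinations of characters with positive real coefficients. **Theorem.** The map $\overline\sigma$ is a birational isomorphism.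 Equipped with the $0$-structure $$\gamma_0:=\overline\gamma_0\circ\overline\sigma,\qquad \varepsilon_0:=\overline\varepsilon_0\circ\overline\sigma,\qquad e_0^c:=\overline\sigma^{-1}\circ\overline e_0^c\circ\overline\sigma,$$ $(\mathcal V_1,\{e_i\}_{i\in I},\{\gamma_i\}_{i\in I},\{\varepsilon_i\}_{i\in I})$ is an $A_n^{(1)}$-geometric crystal, and $v_1:(\mathbb C^\times)^{kk'}\to\mathcal V_1$ is a positive structure on it. -/

import Mathlib

namespace GeomCrystal

noncomputable section

/-! ## Rational functions and rational maps

Varieties are (irreducible) subsets `X` of a finite dimensional complex vector space `V`, with the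
Zariski topology. A rational function or map on `X` is represented by a total function on `V` that
is given by quotients of polynomials on a nonempty Zariski-open subset of `X`; its values elsewhere
carry no information. Two representatives are the same rational map if they agree generically, and
every notion below is about generic points only. -/

section Rational

variable {V V' : Type} [AddCommGroup V] [Module ℂ V] [AddCommGroup V'] [Module ℂ V']

/-- The algebra of polynomial functions on the vector space `V`. -/
def polyFun (V : Type) [AddCommGroup V] [Module ℂ V] : Subalgebra ℂ (V → ℂ) :=
  Algebra.adjoin ℂ (Set.range fun φ : Module.Dual ℂ V => (φ : V → ℂ))

/-- `Q` holds on a nonempty (basic) Zariski-open subset of `X`. -/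
def Generically (X : Set V) (Q : V → Prop) : Prop :=
  ∃ q ∈ polyFun V, (∃ x ∈ X, q x ≠ 0) ∧ ∀ x ∈ X, q x ≠ 0 → Q x

/-- `X` is nonempty and irreducible in the Zariski topology. -/
def IsIrreducibleSet (X : Set V) : Prop :=
  X.Nonempty ∧ ∀ p ∈ polyFun V, ∀ q ∈ polyFun V, (∀ x ∈ X, p x * q x = 0) →
    (∀ x ∈ X, p x = 0) ∨ (∀ x ∈ X, q x = 0)

/-- `f` represents a rational function on `X`. -/
def IsRatFun (X : Set V) (f : V → ℂ) : Prop :=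
  ∃ p ∈ polyFun V, ∃ q ∈ polyFun V, (∃ x ∈ X, q x ≠ 0) ∧ ∀ x ∈ X, q x ≠ 0 → f x = p x / q x

/-- `f` represents a rational map from `X` to `Y`. -/
def IsRatMap (X : Set V) (Y : Set V') (f : V → V') : Prop :=
  (∀ φ : Module.Dual ℂ V', IsRatFun X fun x => φ (f x)) ∧ Generically X fun x => f x ∈ Y

/-- The rational map `X ⇢ Y` represented by `f` is defined at `x`, with value `y ∈ Y`: near `x`,
every linear coordinate of `f` is generically equal to a quotient of polynomials whose denominator
does not vanish at `x`. -/
def IsDefinedAt (X : Set V) (Y : Set V') (f : V → V') (x : V) (y : V') : Prop :=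
  x ∈ X ∧ y ∈ Y ∧ ∀ φ : Module.Dual ℂ V', ∃ p ∈ polyFun V, ∃ q ∈ polyFun V,
    q x ≠ 0 ∧ (Generically X fun z => φ (f z) = p z / q z) ∧ φ y = p x / q x

/-- `f : X ⇢ Y` is a birational isomorphism with inverse `g : Y ⇢ X`. -/
def IsBirationalPair (X : Set V) (Y : Set V') (f : V → V') (g : V' → V) : Prop :=
  IsRatMap X Y f ∧ IsRatMap Y X g ∧
    (Generically X fun x => g (f x) = x) ∧ (Generically Y fun y => f (g y) = y)

/-- `ℂˣ × X`. -/
def gmProd (X : Set V) : Set (ℂ × V) := {z | z.1 ≠ 0 ∧ z.2 ∈ X}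

end Rational

/-! ## Positivity -/

section Positive

variable {P P' : Type} [Fintype P] [Fintype P']

/-- The algebraic torus `(ℂˣ)^P`. -/
def torus (P : Type) : Set (P → ℂ) := {t | ∀ p, t p ≠ 0}

/-- The character `t ↦ ∏ t_p ^ (m p)` of the torus. -/
def torusChar (m : P → ℤ) (t : P → ℂ) : ℂ := ∏ p, t p ^ m p

/-- `g` is a (nonempty) linear combination of characters with positive coefficients. -/
def IsPosComb (g : (P → ℂ) → ℂ) : Prop :=
  ∃ (s : Finset (P → ℤ)) (a : (P → ℤ) → ℝ), s.Nonempty ∧ (∀ m ∈ s, 0 < a m) ∧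
    ∀ t ∈ torus P, g t = ∑ m ∈ s, (a m : ℂ) * torusChar m t

/-- Positive rational functions on a torus. -/
def IsPosFun (f : (P → ℂ) → ℂ) : Prop :=
  ∃ g h : (P → ℂ) → ℂ, IsPosComb g ∧ IsPosComb h ∧
    Generically (torus P) fun t => f t = g t / h t

/-- Positive rational morphisms between two tori. -/
def IsPosMap (f : (P → ℂ) → (P' → ℂ)) : Prop :=
  IsRatMap (torus P) (torus P') f ∧ ∀ m : P' → ℤ, IsPosFun fun t => torusChar m (f t)

end Positive

/-! ## Geometric crystals -/

/-- The data `{e_i}, {γ_i}, {ε_i}` of a geometric crystal, with `e i c x = e_i^c(x)`. -/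
structure CrystalData (I V : Type) where
  e : I → ℂ → V → V
  gamma : I → V → ℂ
  eps : I → V → ℂ

/-- `(X, {e_i}, {γ_i}, {ε_i})` is a geometric crystal for the Cartan matrix `a`. -/
structure IsGeometricCrystal {I V : Type} [AddCommGroup V] [Module ℂ V]
    (a : I → I → ℤ) (X : Set V) (D : CrystalData I V) : Prop where
  irreducible : IsIrreducibleSet X
  gamma_rational : ∀ i, IsRatFun X (D.gamma i)
  eps_rational : ∀ i, IsRatFun X (D.eps i)
  e_rational : ∀ i, IsRatMap (gmProd X) X fun z => D.e i z.1 z.2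
  /-- `e_i` is a rational action of `ℂˣ`. -/
  e_mul : ∀ i, Generically (gmProd (gmProd X)) fun z =>
    D.e i z.1 (D.e i z.2.1 z.2.2) = D.e i (z.1 * z.2.1) z.2.2
  /-- `(1, x)` is in the domain of definition of `e_i`, and `e_i^1(x) = x`, for generic `x`. -/
  e_one : ∀ i, Generically X fun x =>
    IsDefinedAt (gmProd X) X (fun z : ℂ × V => D.e i z.1 z.2) (1, x) x
  gamma_e : ∀ i j, Generically (gmProd X) fun z =>
    D.gamma j (D.e i z.1 z.2) = z.1 ^ a i j * D.gamma j z.2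
  e_comm : ∀ i j, a i j = 0 → a j i = 0 → Generically (gmProd (gmProd X)) fun z =>
    D.e i z.1 (D.e j z.2.1 z.2.2) = D.e j z.2.1 (D.e i z.1 z.2.2)
  e_braid : ∀ i j, a i j = -1 → a j i = -1 → Generically (gmProd (gmProd X)) fun z =>
    D.e i z.1 (D.e j (z.1 * z.2.1) (D.e i z.2.1 z.2.2)) =
      D.e j z.2.1 (D.e i (z.1 * z.2.1) (D.e j z.1 z.2.2))
  e_braid_two : ∀ i j, a i j = -2 → a j i = -1 → Generically (gmProd (gmProd X)) fun z =>
    D.e i z.1 (D.e j (z.1 ^ 2 * z.2.1) (D.e i (z.1 * z.2.1) (D.e j z.2.1 z.2.2))) =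
      D.e j z.2.1 (D.e i (z.1 * z.2.1) (D.e j (z.1 ^ 2 * z.2.1) (D.e i z.1 z.2.2)))
  e_braid_three : ∀ i j, a i j = -3 → a j i = -1 → Generically (gmProd (gmProd X)) fun z =>
    D.e i z.1 (D.e j (z.1 ^ 3 * z.2.1) (D.e i (z.1 ^ 2 * z.2.1)
        (D.e j (z.1 ^ 3 * z.2.1 ^ 2) (D.e i (z.1 * z.2.1) (D.e j z.2.1 z.2.2))))) =
      D.e j z.2.1 (D.e i (z.1 * z.2.1) (D.e j (z.1 ^ 3 * z.2.1 ^ 2)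
        (D.e i (z.1 ^ 2 * z.2.1) (D.e j (z.1 ^ 3 * z.2.1) (D.e i z.1 z.2.2)))))
  eps_e : ∀ i, Generically (gmProd X) fun z =>
    D.eps i (D.e i z.1 z.2) = z.1⁻¹ * D.eps i z.2
  eps_e_of_comm : ∀ i j, a i j = 0 → a j i = 0 → Generically (gmProd X) fun z =>
    D.eps i (D.e j z.1 z.2) = D.eps i z.2

/-- The birational isomorphism `θ` from the torus `(ℂˣ)^P` to `X` is a positive structure.
A point of `ℂˣ × (ℂˣ)^P` is a function on `Option P`, with `none` for the factor `ℂˣ`. -/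
def IsPositiveStructure {I V P : Type} [AddCommGroup V] [Module ℂ V] [Fintype P]
    (X : Set V) (D : CrystalData I V) (θ : (P → ℂ) → V) : Prop :=
  ∃ ψ : V → (P → ℂ), IsBirationalPair (torus P) X θ ψ ∧
    (∀ i, IsPosFun fun t => D.gamma i (θ t)) ∧
    (∀ i, IsPosFun fun t => D.eps i (θ t)) ∧
    (∀ i, IsPosMap fun z : Option P → ℂ => ψ (D.e i (z none) (θ fun p => z (some p))))

/-! ## The affine Cartan matrix and the fundamental representation

The index set `{0, …, n}` of simple roots is `Fin (n + 1)`, whose addition is modulo `n + 1`. The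
entries `1, …, n, n + 1` of the tableaux are also taken modulo `n + 1`, so that `n + 1` becomes
`0 : Fin (n + 1)`; a one-column tableau is the `k`-element set of its entries. -/

/-- The Cartan matrix of type `A_n^{(1)}` (for `n ≥ 2`). -/
def cartan (n : ℕ) (i j : Fin (n + 1)) : ℤ :=
  if i = j then 2 else if i = j + 1 ∨ j = i + 1 then -1 else 0

/-- One-column tableaux `(i_1, …, i_k)`. -/
abbrev Tab (n k : ℕ) : Type := {s : Finset (Fin (n + 1)) // s.card = k}

/-- The representation `W(ϖ_k)`; the tableau `s` is the basis vector `Pi.single s 1`. -/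
abbrev FundRep (n k : ℕ) : Type := Tab n k → ℂ

/-- Replace the entry `i` by `i + 1`. -/
def raise {n k : ℕ} (i : Fin (n + 1)) (s : Tab n k) (h : i ∈ s.1 ∧ i + 1 ∉ s.1) : Tab n k :=
  ⟨insert (i + 1) (s.1.erase i), by
    have h1 : i + 1 ∉ s.1.erase i := fun h' => h.2 (Finset.mem_of_mem_erase h')
    rw [Finset.card_insert_of_notMem h1, Finset.card_erase_of_mem h.1, s.2]
    have : 0 < s.1.card := Finset.card_pos.2 ⟨i, h.1⟩
    have := s.2
    omega⟩

/-- The Chevalley generator `f_i`. -/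
def chevF (n k : ℕ) (i : Fin (n + 1)) : Module.End ℂ (FundRep n k) :=
  (Pi.basisFun ℂ (Tab n k)).constr ℂ fun s =>
    if h : i ∈ s.1 ∧ i + 1 ∉ s.1 then Pi.single (raise i s h) 1 else 0

theorem chevF_single {n k : ℕ} (i : Fin (n + 1)) (s : Tab n k) :
    chevF n k i (Pi.single s 1) =
      if h : i ∈ s.1 ∧ i + 1 ∉ s.1 then Pi.single (raise i s h) 1 else 0 := by
  have := (Pi.basisFun ℂ (Tab n k)).constr_basis ℂ (fun s =>
    if h : i ∈ s.1 ∧ i + 1 ∉ s.1 then (Pi.single (raise i s h) 1 : FundRep n k) else 0) s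
  rw [Pi.basisFun_apply] at this
  exact this

/-- `f_i ^ 2 = 0`, so that `exp (t f_i) = 1 + t f_i`. -/
theorem chevF_mul_self (n k : ℕ) (i : Fin (n + 1)) : chevF n k i * chevF n k i = 0 := by
  refine (Pi.basisFun ℂ (Tab n k)).ext fun s => ?_
  rw [Pi.basisFun_apply, Module.End.mul_apply, chevF_single]
  split_ifs with h
  · rw [chevF_single, dif_neg]
    · rfl
    · rintro ⟨-, h2⟩
      exact h2 (Finset.mem_insert_self _ _)
  · simp

/-- `α_i^∨(c) = c ^ {h_i}`, acting diagonally. -/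
def coroot (n k : ℕ) (i : Fin (n + 1)) (c : ℂ) : Module.End ℂ (FundRep n k) :=
  (Pi.basisFun ℂ (Tab n k)).constr ℂ fun s =>
    if i ∈ s.1 ∧ i + 1 ∉ s.1 then Pi.single s c
    else if i ∉ s.1 ∧ i + 1 ∈ s.1 then Pi.single s c⁻¹
    else Pi.single s 1

/-- `Y_i(c) = y_i(1/c) α_i^∨(c)` with `y_i(t) = exp (t f_i) = 1 + t f_i`. -/
def opY (n k : ℕ) (i : Fin (n + 1)) (c : ℂ) : Module.End ℂ (FundRep n k) :=
  (1 + c⁻¹ • chevF n k i) * coroot n k i c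

/-- The basis vector of the tableau with entry set `s` (zero unless `s` has `k` elements). -/
def tabVec (n k : ℕ) (s : Finset (Fin (n + 1))) : FundRep n k :=
  fun t => if t.1 = s then 1 else 0

/-- The `𝔤_0`-highest weight vector `u_1 = (1, 2, …, k)`. -/
def u1 (n k : ℕ) : FundRep n k := tabVec n k ((Finset.Icc 1 k).image (Fin.ofNat (n + 1)))

/-- The `𝔤_n`-highest weight vector `u_2 = (1, 2, …, k - 1, n + 1)`. -/
def u2 (n k : ℕ) : FundRep n k :=
  tabVec n k (insert 0 ((Finset.Icc 1 (k - 1)).image (Fin.ofNat (n + 1))))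

/-! ## The coordinates and the words -/

/-- The positions `(l, m)` of the variables `x^{(l)}_m`: `1 ≤ l ≤ k < l + m ≤ n + 1`. -/
def lat1 (n k : ℕ) : Finset (ℕ × ℕ) :=
  (Finset.Icc 1 k ×ˢ Finset.range (n + 1)).filter fun p => k < p.1 + p.2 ∧ p.1 + p.2 ≤ n + 1

/-- The positions `(l, m)` of the variables `y^{(l)}_m`: `1 ≤ l ≤ k ≤ l + m ≤ n`. -/
def lat2 (n k : ℕ) : Finset (ℕ × ℕ) :=
  (Finset.Icc 1 k ×ˢ Finset.range (n + 1)).filter fun p => k ≤ p.1 + p.2 ∧ p.1 + p.2 ≤ n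

/-- The variable `x^{(l)}_m`, understood to be `1` outside the lattice. -/
def at' {L : Finset (ℕ × ℕ)} (x : L → ℂ) (p : ℕ × ℕ) : ℂ :=
  if h : p ∈ L then x ⟨p, h⟩ else 1

/-- The positions in the order in which `Y_{w_1}(x)` runs through them:
`(k, k'), …, (k, 1), …, (1, n), …, (1, k)`. -/
def word1 (n k : ℕ) : List (ℕ × ℕ) :=
  (List.Ico 1 (k + 1)).reverse.flatMap fun l =>
    (List.Ico (k + 1 - l) (n + 2 - l)).reverse.map fun m => (l, m)

/-- The positions in the order in which `Y_{w_2}(y)` runs through them: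
`(k, k' - 1), …, (k, 0), …, (1, n - 1), …, (1, k - 1)`. -/
def word2 (n k : ℕ) : List (ℕ × ℕ) :=
  (List.Ico 1 (k + 1)).reverse.flatMap fun l =>
    (List.Ico (k - l) (n + 1 - l)).reverse.map fun m => (l, m)

/-- The position `q` precedes `p` in these words. -/
def Before (q p : ℕ × ℕ) : Prop := p.1 < q.1 ∨ (p.1 = q.1 ∧ p.2 < q.2)

instance : DecidableRel Before := fun q p =>
  inferInstanceAs (Decidable (p.1 < q.1 ∨ (p.1 = q.1 ∧ p.2 < q.2)))

theorem mem_word1 {n k : ℕ} {p : ℕ × ℕ} : p ∈ word1 n k ↔ p ∈ lat1 n k := by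
  obtain ⟨l, m⟩ := p
  simp [word1, lat1]
  omega

theorem mem_word2 {n k : ℕ} {p : ℕ × ℕ} : p ∈ word2 n k ↔ p ∈ lat2 n k := by
  obtain ⟨l, m⟩ := p
  simp [word2, lat2]
  omega

theorem pairwise_flatMap_before (s : List ℕ) (hs : s.Pairwise (· < ·)) (f g : ℕ → ℕ) :
    (s.reverse.flatMap fun l =>
      (List.Ico (f l) (g l)).reverse.map fun m => (l, m)).Pairwise Before := by
  rw [List.pairwise_flatMap]
  constructor
  · intro l _
    rw [List.pairwise_map, List.pairwise_reverse]
    exact (List.Ico.pairwise_lt _ _).imp fun h => Or.inr ⟨rfl, h⟩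
  · rw [List.pairwise_reverse]
    refine hs.imp fun {l l'} h p hp q hq => ?_
    simp only [List.mem_map] at hp hq
    obtain ⟨_, _, rfl⟩ := hp
    obtain ⟨_, _, rfl⟩ := hq
    exact Or.inl h

theorem pairwise_word1 (n k : ℕ) : (word1 n k).Pairwise Before :=
  pairwise_flatMap_before _ (List.Ico.pairwise_lt _ _) _ _

theorem pairwise_word2 (n k : ℕ) : (word2 n k).Pairwise Before :=
  pairwise_flatMap_before _ (List.Ico.pairwise_lt _ _) _ _

/-- The letter of the word at the position `(l, m)` is `m`. -/
def letter (n : ℕ) (p : ℕ × ℕ) : Fin (n + 1) := Fin.ofNat (n + 1) p.2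

/-- `v_1(x) = Y_{w_1}(x) u_1`. -/
def v1 (n k : ℕ) (x : lat1 n k → ℂ) : FundRep n k :=
  ((word1 n k).map fun p => opY n k (letter n p) (at' x p)).prod (u1 n k)

/-- `v_2(y) = Y_{w_2}(y) u_2`. -/
def v2 (n k : ℕ) (y : lat2 n k → ℂ) : FundRep n k :=
  ((word2 n k).map fun p => opY n k (letter n p) (at' y p)).prod (u2 n k)

/-- The variety `𝒱_1`. -/
def V1 (n k : ℕ) : Set (FundRep n k) := v1 n k '' torus (lat1 n k)

/-- The variety `𝒱_2`. -/
def V2 (n k : ℕ) : Set (FundRep n k) := v2 n k '' torus (lat2 n k)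

/-- The coordinates of a point of `𝒱_1`: a point `x` of the torus with `v_1(x) = v`. -/
def coord1 (n k : ℕ) : FundRep n k → (lat1 n k → ℂ) :=
  Function.invFunOn (v1 n k) (torus (lat1 n k))

/-- The coordinates of a point of `𝒱_2`: a point `y` of the torus with `v_2(y) = v`. -/
def coord2 (n k : ℕ) : FundRep n k → (lat2 n k → ℂ) :=
  Function.invFunOn (v2 n k) (torus (lat2 n k))

/-! ## The geometric crystal structure on `Y_{i_1}(c_1) ⋯ Y_{i_N}(c_N)`

The word is given by its set `L` of positions, ordered by `Before`, with letters `letter n`. -/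

section WordCrystal

variable {L : Finset (ℕ × ℕ)}

/-- `c_1^{a_{i_1, i}} ⋯ c_{m-1}^{a_{i_{m-1}, i}} c_m`. -/
def wordMono (n : ℕ) (i : Fin (n + 1)) (c : L → ℂ) (m : L) : ℂ :=
  (∏ q : L with Before q.1 m.1, c q ^ cartan n (letter n q.1) i) * c m

/-- `γ_i = c_1^{a_{i_1, i}} ⋯ c_N^{a_{i_N, i}}`. -/
def wordGamma (n : ℕ) (i : Fin (n + 1)) (c : L → ℂ) : ℂ :=
  ∏ q : L, c q ^ cartan n (letter n q.1) i

/-- `ε_i = ∑_{i_m = i} 1 / (c_1^{a_{i_1, i}} ⋯ c_{m-1}^{a_{i_{m-1}, i}} c_m)`. -/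
def wordEps (n : ℕ) (i : Fin (n + 1)) (c : L → ℂ) : ℂ :=
  ∑ m : L with letter n m.1 = i, 1 / wordMono n i c m

/-- The coordinates `𝒞_j` of `e_i^t`. -/
def wordE (n : ℕ) (i : Fin (n + 1)) (t : ℂ) (c : L → ℂ) : L → ℂ := fun j =>
  c j *
    (((∑ m : L with letter n m.1 = i ∧ ¬ Before j.1 m.1, t / wordMono n i c m) +
        ∑ m : L with letter n m.1 = i ∧ Before j.1 m.1, 1 / wordMono n i c m) /
      ((∑ m : L with letter n m.1 = i ∧ Before m.1 j.1, t / wordMono n i c m) +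
        ∑ m : L with letter n m.1 = i ∧ ¬ Before m.1 j.1, 1 / wordMono n i c m))

end WordCrystal

/-- The geometric crystal structure of `𝒱_1` (for `i ∈ {1, …, n}`). -/
def crystal1 (n k : ℕ) : CrystalData (Fin (n + 1)) (FundRep n k) where
  e i c v := v1 n k (wordE n i c (coord1 n k v))
  gamma i v := wordGamma n i (coord1 n k v)
  eps i v := wordEps n i (coord1 n k v)

/-- The geometric crystal structure of `𝒱_2` (for `i ∈ {0, …, n - 1}`). -/
def crystal2 (n k : ℕ) : CrystalData (Fin (n + 1)) (FundRep n k) where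
  e i c v := v2 n k (wordE n i c (coord2 n k v))
  gamma i v := wordGamma n i (coord2 n k v)
  eps i v := wordEps n i (coord2 n k v)

/-! ## Lattice paths and the map `σ̄` -/

/-- A step of a shortest path: to the right, from `(i, j)` to `(i, j + 1)`, or down, from `(i, j)`
to `(i - 1, j + 1)`. -/
def PathStep (p q : ℕ × ℕ) : Prop := q.2 = p.2 + 1 ∧ (q.1 = p.1 ∨ q.1 + 1 = p.1)

/-- The shortest paths from `p` to `(1, n)` on the lattice, as lists of lattice points. -/
def paths (n k : ℕ) (p : ℕ × ℕ) : Set (List (ℕ × ℕ)) :=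
  {s | s.head? = some p ∧ s.getLast? = some (1, n) ∧ s.IsChain PathStep ∧ ∀ q ∈ s, q ∈ lat1 n k}

/-- The weight of a path: the product of `x^{(i)}_j / x^{(i)}_{j+1}` over its horizontal strips. -/
def pathWeight {L : Finset (ℕ × ℕ)} (x : L → ℂ) : List (ℕ × ℕ) → ℂ
  | p :: q :: s => (if q.1 = p.1 then at' x p / at' x q else 1) * pathWeight x (q :: s)
  | _ => 1

/-- `X^{(l)}_m`, the sum of the weights of all shortest paths from `(l, m)` to `(1, n)`, with the
conventions `X^{(l)}_m = 1 / x^{(1)}_n` if `l + m = k`, and `X^{(l)}_m = 1` if `(l, m)` is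
otherwise outside the lattice. -/
def pathSum (n k : ℕ) (x : lat1 n k → ℂ) (p : ℕ × ℕ) : ℂ :=
  if p.1 + p.2 = k then 1 / at' x (1, n)
  else if p ∈ lat1 n k then ∑ᶠ s ∈ paths n k p, pathWeight x s
  else 1

/-- `Σ(x)^{(l)}_m = x^{(l+1)}_m X^{(l)}_m / X^{(l+1)}_m`. -/
def mapSigma (n k : ℕ) (x : lat1 n k → ℂ) : lat2 n k → ℂ := fun p =>
  at' x (p.1.1 + 1, p.1.2) * (pathSum n k x p.1 / pathSum n k x (p.1.1 + 1, p.1.2))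

/-- `σ̄ : 𝒱_1 ⇢ 𝒱_2`, `σ̄(v_1(x)) = v_2(Σ(x))`. -/
def sigmaBar (n k : ℕ) (v : FundRep n k) : FundRep n k := v2 n k (mapSigma n k (coord1 n k v))

/-- The data on `𝒱_1` consisting of its own `e_i, γ_i, ε_i` for `i ≠ 0` and of the `0`-structure
`γ̄_0 ∘ σ̄`, `ε̄_0 ∘ σ̄`, `σ̄⁻¹ ∘ ē_0^c ∘ σ̄`, where `τ` is a rational inverse of `σ̄`. -/
def affineCrystal (n k : ℕ) (τ : FundRep n k → FundRep n k) :
    CrystalData (Fin (n + 1)) (FundRep n k) where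
  e i c v := if i = 0 then τ ((crystal2 n k).e 0 c (sigmaBar n k v)) else (crystal1 n k).e i c v
  gamma i v :=
    if i = 0 then (crystal2 n k).gamma 0 (sigmaBar n k v) else (crystal1 n k).gamma i v
  eps i v := if i = 0 then (crystal2 n k).eps 0 (sigmaBar n k v) else (crystal1 n k).eps i v

end

end GeomCrystal

open GeomCrystal

namespace GeomCrystal

open scoped ComplexOrder

/-! ### Polynomial functions, generic points and Zariski density of the positive points -/

section Rational

variable {V V' : Type} [AddCommGroup V] [Module ℂ V] [AddCommGroup V'] [Module ℂ V']
variable {P P' : Type}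

/-! Up to a scalar, `sigmaBar` is the identity. In tableau coordinates taken without signs, the
vectors `v1 x` and `v2 y` satisfy the three-term Plücker relations, and these are invariant under
cyclic rotation of `ℤ/(n+1)` (`IsPlucker.succ`), so it does not matter that the two words start at
different base points.

For each base point there is a cluster of coordinates, indexed by sets of the form "interval plus
tail". On the vector of the corresponding word they are monomials in the variables
(`pc_wordVec_clusterSet`), so the variables are quotients of them; all other coordinates follow from
the cluster by exchange relations solved without subtraction (`cluster_induction`). Hence a Plücker
vector with positive coordinates is, up to a scalar, the vector of either word at exactly one
positive point (`IsWord.vec_clusterVars`). The path sums defining `mapSigma` are, up to monomials,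
the cluster coordinates of `v1 x` for the other base point: their recursion over the first step is
the exchange relation between the two clusters (`pathTotal_eq`, `mapSigma_eq`). On positive points
`v2 (mapSigma x)` is therefore `v1 x` divided by `x^{(1)}_n`.

The finite crystal structures depend on the vector alone. Write `D_i` for the coordinate at the
cyclic interval of length `k` ending at `i`, and `A_i` for the one with `i` replaced by `i + 1`.
Then `ε_i = A_i / D_i`, `γ_i = ∏ D_j ^ a_{ji}`, and `e_i^c` applies `exp (a e_i)` with `a = (c - 1)
D_i / A_i` (`IsWordList.vec_wordE`). These formulas are cyclically symmetric and compatible with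
scaling, so the transported `0`-structure is the same formula with `i = 0` (`vec_hatE`). The axioms
become short computations; the braid relation (`actC_braid`) needs one three-term relation and the
vanishing of `e_i²` and `e_i e_j e_i`.

All maps in sight are subtraction-free in the torus coordinates. Positivity is then automatic, and
every generic identity has to be checked only at positive real points (`IsSF.eventually_eq`), where
nothing vanishes. -/

theorem dual_mem_polyFun (φ : Module.Dual ℂ V) : (fun v => φ v) ∈ polyFun V :=
  Algebra.subset_adjoin ⟨φ, rfl⟩

theorem const_mem_polyFun (c : ℂ) : (fun _ => c) ∈ polyFun V :=
  (polyFun V).algebraMap_mem c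

theorem coord_mem_polyFun (p : P) : (fun t : P → ℂ => t p) ∈ polyFun (P → ℂ) :=
  dual_mem_polyFun (V := P → ℂ) (LinearMap.proj p)

theorem polyFun_induction {C : (V → ℂ) → Prop} (hdual : ∀ φ : Module.Dual ℂ V, C fun v => φ v)
    (hconst : ∀ c : ℂ, C fun _ => c) (hadd : ∀ f g, C f → C g → C (f + g))
    (hmul : ∀ f g, C f → C g → C (f * g)) {f : V → ℂ} (hf : f ∈ polyFun V) : C f := by
  induction hf using Algebra.adjoin_induction with
  | mem x hx => obtain ⟨φ, rfl⟩ := hx; exact hdual φ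
  | algebraMap r => exact hconst r
  | add x y _ _ hx hy => exact hadd x y hx hy
  | mul x y _ _ hx hy => exact hmul x y hx hy

theorem polyFun_comp_linear {f : V' → ℂ} (hf : f ∈ polyFun V') (L : V →ₗ[ℂ] V') :
    (fun v => f (L v)) ∈ polyFun V := by
  refine polyFun_induction (C := fun f => (fun v => f (L v)) ∈ polyFun V) ?_ ?_ ?_ ?_ hf
  · intro φ; exact dual_mem_polyFun (φ.comp L)
  · intro c; exact const_mem_polyFun c
  · intro f g hf hg; exact (polyFun V).add_mem hf hg
  · intro f g hf hg; exact (polyFun V).mul_mem hf hg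

theorem polyFun_comp_poly [Fintype P] {f : (P → ℂ) → ℂ} (hf : f ∈ polyFun (P → ℂ))
    {g : P → V → ℂ} (hg : ∀ p, g p ∈ polyFun V) :
    (fun v => f fun p => g p v) ∈ polyFun V := by
  classical
  refine polyFun_induction (C := fun f => (fun v => f fun p => g p v) ∈ polyFun V) ?_ ?_ ?_ ?_ hf
  · intro φ
    have : (fun v => φ fun p => g p v) = ∑ p, fun v => φ (Pi.single p 1) * g p v := by
      funext v
      rw [LinearMap.pi_apply_eq_sum_univ φ, Finset.sum_apply]
      refine Finset.sum_congr rfl fun p _ => ?_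
      rw [smul_eq_mul, mul_comm]
      congr 2
      funext q
      simp [Pi.single_apply, eq_comm]
    rw [this]
    exact (polyFun V).sum_mem fun p _ => (polyFun V).mul_mem (const_mem_polyFun _) (hg p)
  · intro c; exact const_mem_polyFun c
  · intro f g hf hg; exact (polyFun V).add_mem hf hg
  · intro f g hf hg; exact (polyFun V).mul_mem hf hg

theorem exists_mvPolynomial [Fintype P] {f : (P → ℂ) → ℂ} (hf : f ∈ polyFun (P → ℂ)) :
    ∃ Q : MvPolynomial P ℂ, ∀ t, f t = MvPolynomial.eval t Q := by
  classical
  refine polyFun_induction (C := fun f => ∃ Q : MvPolynomial P ℂ, ∀ t, f t = MvPolynomial.eval t Q)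
    ?_ ?_ ?_ ?_ hf
  · intro φ
    refine ⟨∑ p, MvPolynomial.C (φ (Pi.single p 1)) * MvPolynomial.X p, fun t => ?_⟩
    beta_reduce
    rw [LinearMap.pi_apply_eq_sum_univ φ, map_sum]
    refine Finset.sum_congr rfl fun p _ => ?_
    rw [smul_eq_mul, mul_comm]
    simp only [map_mul, MvPolynomial.eval_C, MvPolynomial.eval_X]
    congr 2
    funext q
    simp [Pi.single_apply, eq_comm]
  · intro c; exact ⟨MvPolynomial.C c, fun t => by simp⟩
  · rintro f g ⟨Q, hQ⟩ ⟨R, hR⟩; exact ⟨Q + R, fun t => by simp [hQ, hR]⟩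
  · rintro f g ⟨Q, hQ⟩ ⟨R, hR⟩; exact ⟨Q * R, fun t => by simp [hQ, hR]⟩

/-- The positive real points of a torus. -/
def posPoints (P : Type) : Set (P → ℂ) := {t | ∀ p, 0 < t p}

theorem posPoints_subset_torus : posPoints P ⊆ torus P := fun _ ht p => (ht p).ne'

theorem infinite_pos : {z : ℂ | 0 < z}.Infinite := by
  refine Set.infinite_of_injective_forall_mem (f := fun n : ℕ => ((n + 1 : ℕ) : ℂ)) ?_ ?_
  · intro a b h
    simpa using h
  · intro n
    show (0 : ℂ) < ((n + 1 : ℕ) : ℂ)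
    exact Nat.cast_pos.2 n.succ_pos

/-- The positive reals are infinite, so the positive orthant is Zariski dense. This is what reduces
generic identities to identities at positive points. -/
theorem polyFun_eq_zero_of_posPoints [Fintype P] {f : (P → ℂ) → ℂ} (hf : f ∈ polyFun (P → ℂ))
    (h : ∀ t ∈ posPoints P, f t = 0) (t : P → ℂ) : f t = 0 := by
  obtain ⟨Q, hQ⟩ := exists_mvPolynomial hf
  have : Q = 0 := by
    refine MvPolynomial.funext_set (fun _ => {z : ℂ | 0 < z}) (fun _ => infinite_pos) fun x hx => ?_
    rw [← hQ, h x fun p => hx p trivial, map_zero]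
  rw [hQ, this, map_zero]

theorem polyFun_mul_eq_zero [Fintype P] {f g : (P → ℂ) → ℂ} (hf : f ∈ polyFun (P → ℂ))
    (hg : g ∈ polyFun (P → ℂ)) (h : ∀ t ∈ posPoints P, f t * g t = 0) :
    (∀ t, f t = 0) ∨ ∀ t, g t = 0 := by
  obtain ⟨Q, hQ⟩ := exists_mvPolynomial hf
  obtain ⟨R, hR⟩ := exists_mvPolynomial hg
  have : Q * R = 0 := MvPolynomial.funext fun t => by
    have := polyFun_eq_zero_of_posPoints ((polyFun (P → ℂ)).mul_mem hf hg) h t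
    rw [Pi.mul_apply, hQ, hR] at this
    rw [map_mul, this, map_zero]
  rcases mul_eq_zero.1 this with h | h
  · exact .inl fun t => by rw [hQ, h, map_zero]
  · exact .inr fun t => by rw [hR, h, map_zero]

theorem polyFun_mul_ne_zero [Fintype P] {f g : (P → ℂ) → ℂ} (hf : f ∈ polyFun (P → ℂ))
    (hg : g ∈ polyFun (P → ℂ)) (hf0 : ∃ t, f t ≠ 0) (hg0 : ∃ t, g t ≠ 0) :
    ∃ t ∈ posPoints P, f t * g t ≠ 0 := by
  by_contra! h
  rcases polyFun_mul_eq_zero hf hg h with h | h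
  · obtain ⟨t, ht⟩ := hf0; exact ht (h t)
  · obtain ⟨t, ht⟩ := hg0; exact ht (h t)

theorem isIrreducibleSet_torus [Fintype P] : IsIrreducibleSet (torus P) := by
  refine ⟨⟨1, fun _ => one_ne_zero (α := ℂ)⟩, fun p hp q hq h => ?_⟩
  rcases polyFun_mul_eq_zero hp hq fun t ht => h t (posPoints_subset_torus ht) with h | h
  · exact .inl fun t _ => h t
  · exact .inr fun t _ => h t

theorem Generically.mono {X : Set V} {Q R : V → Prop} (h : Generically X Q)
    (h' : ∀ x ∈ X, Q x → R x) : Generically X R := by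
  obtain ⟨q, hq, h0, h1⟩ := h
  exact ⟨q, hq, h0, fun x hx hqx => h' x hx (h1 x hx hqx)⟩

theorem Generically.of_forall {X : Set V} {Q : V → Prop} (hX : X.Nonempty) (h : ∀ x ∈ X, Q x) :
    Generically X Q := by
  obtain ⟨x, hx⟩ := hX
  exact ⟨fun _ => 1, const_mem_polyFun 1, ⟨x, hx, one_ne_zero⟩, fun x hx _ => h x hx⟩

theorem Generically.and {X : Set V} (hX : IsIrreducibleSet X) {Q R : V → Prop}
    (hQ : Generically X Q) (hR : Generically X R) : Generically X fun x => Q x ∧ R x := by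
  obtain ⟨q, hq, ⟨x, hx, hx0⟩, hqQ⟩ := hQ
  obtain ⟨r, hr, ⟨y, hy, hy0⟩, hrR⟩ := hR
  refine ⟨q * r, (polyFun V).mul_mem hq hr, ?_, fun x hx h => ?_⟩
  · by_contra! h
    rcases hX.2 q hq r hr h with h | h
    · exact hx0 (h x hx)
    · exact hy0 (h y hy)
  · exact ⟨hqQ x hx (left_ne_zero_of_mul h), hrR x hx (right_ne_zero_of_mul h)⟩

end Rational

/-! ### Subtraction-free functions -/

section SubtractionFree

variable {P P' : Type}

/-- Polynomials with positive coefficients. -/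
inductive PosPoly : ((P → ℂ) → ℂ) → Prop
  | const (a : ℝ) (ha : 0 < a) : PosPoly fun _ => (a : ℂ)
  | var (p : P) : PosPoly fun t => t p
  | add {f g : (P → ℂ) → ℂ} : PosPoly f → PosPoly g → PosPoly fun t => f t + g t
  | mul {f g : (P → ℂ) → ℂ} : PosPoly f → PosPoly g → PosPoly fun t => f t * g t

theorem PosPoly.one : PosPoly fun _ : P → ℂ => (1 : ℂ) := by
  simpa using PosPoly.const (P := P) 1 one_pos

theorem PosPoly.pos {f : (P → ℂ) → ℂ} (hf : PosPoly f) {t : P → ℂ} (ht : t ∈ posPoints P) :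
    0 < f t := by
  induction hf with
  | const a ha => simpa using ha
  | var p => exact ht p
  | add _ _ h h' => exact add_pos h h'
  | mul _ _ h h' => exact mul_pos h h'

theorem PosPoly.mem_polyFun {f : (P → ℂ) → ℂ} (hf : PosPoly f) : f ∈ polyFun (P → ℂ) := by
  induction hf with
  | const a ha => exact const_mem_polyFun _
  | var p => exact coord_mem_polyFun p
  | add _ _ h h' => exact (polyFun _).add_mem h h'
  | mul _ _ h h' => exact (polyFun _).mul_mem h h'

theorem one_mem_posPoints : (1 : P → ℂ) ∈ posPoints P := fun _ => one_pos

theorem PosPoly.generically {f : (P → ℂ) → ℂ} (hf : PosPoly f) {Q : (P → ℂ) → Prop}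
    (h : ∀ t ∈ torus P, f t ≠ 0 → Q t) : Generically (torus P) Q :=
  ⟨f, hf.mem_polyFun, ⟨1, posPoints_subset_torus one_mem_posPoints, (hf.pos one_mem_posPoints).ne'⟩,
    h⟩

theorem PosPoly.prod {ι : Type*} (s : Finset ι) {f : ι → (P → ℂ) → ℂ}
    (hf : ∀ i ∈ s, PosPoly (f i)) : PosPoly fun t => ∏ i ∈ s, f i t := by
  classical
  induction s using Finset.induction_on with
  | empty => simpa using PosPoly.one
  | insert a s ha ih =>
    simp only [Finset.prod_insert ha]
    exact (hf a (by simp)).mul (ih fun i hi => hf i (by simp [hi]))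

/-- `f` is generically a quotient of polynomials with positive coefficients. -/
def IsSF (f : (P → ℂ) → ℂ) : Prop :=
  ∃ p q : (P → ℂ) → ℂ, PosPoly p ∧ PosPoly q ∧ ∀ t ∈ torus P, q t ≠ 0 → f t = p t / q t

theorem PosPoly.isSF {f : (P → ℂ) → ℂ} (hf : PosPoly f) : IsSF f :=
  ⟨f, _, hf, PosPoly.one, fun t _ _ => by simp⟩

theorem IsSF.var (p : P) : IsSF fun t : P → ℂ => t p := (PosPoly.var p).isSF

theorem IsSF.one : IsSF fun _ : P → ℂ => (1 : ℂ) := PosPoly.one.isSF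

theorem IsSF.add {f g : (P → ℂ) → ℂ} (hf : IsSF f) (hg : IsSF g) : IsSF fun t => f t + g t := by
  obtain ⟨p, q, hp, hq, h⟩ := hf
  obtain ⟨p', q', hp', hq', h'⟩ := hg
  refine ⟨_, _, (hp.mul hq').add (hp'.mul hq), hq.mul hq', fun t ht h0 => ?_⟩
  have h1 := left_ne_zero_of_mul h0
  have h2 := right_ne_zero_of_mul h0
  beta_reduce
  rw [h t ht h1, h' t ht h2]
  field_simp

theorem IsSF.mul {f g : (P → ℂ) → ℂ} (hf : IsSF f) (hg : IsSF g) : IsSF fun t => f t * g t := by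
  obtain ⟨p, q, hp, hq, h⟩ := hf
  obtain ⟨p', q', hp', hq', h'⟩ := hg
  refine ⟨_, _, hp.mul hp', hq.mul hq', fun t ht h0 => ?_⟩
  have h1 := left_ne_zero_of_mul h0
  have h2 := right_ne_zero_of_mul h0
  beta_reduce
  rw [h t ht h1, h' t ht h2]
  field_simp

theorem IsSF.inv {f : (P → ℂ) → ℂ} (hf : IsSF f) : IsSF fun t => (f t)⁻¹ := by
  obtain ⟨p, q, hp, hq, h⟩ := hf
  -- The common factor `q` removes the zeros of `q` from the locus where equality is claimed, since
  -- nothing is known of `f` there.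
  refine ⟨_, _, hq.mul hq, hp.mul hq, fun t ht h0 => ?_⟩
  have h1 := left_ne_zero_of_mul h0
  have h2 := right_ne_zero_of_mul h0
  beta_reduce
  rw [h t ht h2]
  field_simp

theorem IsSF.div {f g : (P → ℂ) → ℂ} (hf : IsSF f) (hg : IsSF g) : IsSF fun t => f t / g t := by
  simpa only [div_eq_mul_inv] using hf.mul hg.inv

theorem IsSF.sum {ι : Type*} {s : Finset ι} (hs : s.Nonempty) {f : ι → (P → ℂ) → ℂ}
    (hf : ∀ i ∈ s, IsSF (f i)) : IsSF fun t => ∑ i ∈ s, f i t := by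
  classical
  induction hs using Finset.Nonempty.cons_induction with
  | singleton a => simpa using hf a (by simp)
  | cons a s ha _ ih =>
    simp only [Finset.sum_cons]
    exact (hf a (by simp)).add (ih fun i hi => hf i (by simp [hi]))

theorem IsSF.prod {ι : Type*} (s : Finset ι) {f : ι → (P → ℂ) → ℂ}
    (hf : ∀ i ∈ s, IsSF (f i)) : IsSF fun t => ∏ i ∈ s, f i t := by
  classical
  induction s using Finset.induction_on with
  | empty => simpa using IsSF.one
  | insert a s ha ih =>
    simp only [Finset.prod_insert ha]
    exact (hf a (by simp)).mul (ih fun i hi => hf i (by simp [hi]))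

theorem IsSF.zpow {f : (P → ℂ) → ℂ} (hf : IsSF f) (m : ℤ) : IsSF fun t => f t ^ m := by
  have key : ∀ m : ℕ, IsSF fun t => f t ^ m := fun m => by
    simpa using IsSF.prod (Finset.range m) (f := fun _ => f) fun _ _ => hf
  cases m with
  | ofNat m => simpa using key m
  | negSucc m => simpa only [zpow_negSucc] using (key (m + 1)).inv

theorem IsSF.pos {f : (P → ℂ) → ℂ} (hf : IsSF f) {t : P → ℂ} (ht : t ∈ posPoints P) : 0 < f t := by
  obtain ⟨p, q, hp, hq, h⟩ := hf
  rw [h t (posPoints_subset_torus ht) (hq.pos ht).ne']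
  exact div_pos (hp.pos ht) (hq.pos ht)

theorem IsSF.comp_posPoly {f : (P' → ℂ) → ℂ} (hf : PosPoly f) {g : P' → (P → ℂ) → ℂ}
    (hg : ∀ p, IsSF (g p)) : IsSF fun t => f fun p => g p t := by
  induction hf with
  | const a ha => exact (PosPoly.const a ha).isSF
  | var p => exact hg p
  | add _ _ h h' => exact h.add h'
  | mul _ _ h h' => exact h.mul h'

theorem IsSF.eventually_ne {f : (P → ℂ) → ℂ} (hf : IsSF f) :
    ∃ r : (P → ℂ) → ℂ, PosPoly r ∧ ∀ t ∈ torus P, r t ≠ 0 → f t ≠ 0 := by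
  obtain ⟨p, q, hp, hq, h⟩ := hf
  refine ⟨_, hp.mul hq, fun t ht h0 => ?_⟩
  have h1 := left_ne_zero_of_mul h0
  have h2 := right_ne_zero_of_mul h0
  rw [h t ht h2]
  exact div_ne_zero h1 h2

theorem IsSF.eventually_mem_torus [Fintype P'] {g : P' → (P → ℂ) → ℂ} (hg : ∀ p, IsSF (g p)) :
    ∃ r : (P → ℂ) → ℂ, PosPoly r ∧
      ∀ t ∈ torus P, r t ≠ 0 → (fun p => g p t) ∈ torus P' := by
  choose r hr h using fun p => (hg p).eventually_ne
  exact ⟨_, PosPoly.prod Finset.univ fun p _ => hr p, fun t ht h0 p =>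
    h p t ht fun h1 => h0 (Finset.prod_eq_zero (Finset.mem_univ p) h1)⟩

theorem IsSF.comp [Fintype P'] {f : (P' → ℂ) → ℂ} (hf : IsSF f) {g : P' → (P → ℂ) → ℂ}
    (hg : ∀ p, IsSF (g p)) : IsSF fun t => f fun p => g p t := by
  obtain ⟨p, q, hp, hq, h⟩ := hf
  obtain ⟨a, b, ha, hb, hab⟩ := (IsSF.comp_posPoly hp hg).div (IsSF.comp_posPoly hq hg)
  obtain ⟨r, hr, hr'⟩ := IsSF.eventually_mem_torus hg
  obtain ⟨s, hs, hs'⟩ := (IsSF.comp_posPoly hq hg).eventually_ne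
  -- The factor `r * s` cancels; it only keeps the inner point in the torus and off the zeros of the
  -- outer denominator.
  refine ⟨_, _, ha.mul (hr.mul hs), hb.mul (hr.mul hs), fun t ht h0 => ?_⟩
  have h1 := left_ne_zero_of_mul h0
  have h2 := left_ne_zero_of_mul (right_ne_zero_of_mul h0)
  have h3 := right_ne_zero_of_mul (right_ne_zero_of_mul h0)
  beta_reduce at hab ⊢
  rw [h _ (hr' t ht h2) (hs' t ht h3), hab t ht h1, mul_div_mul_right _ _ (mul_ne_zero h2 h3)]

/-- Subtraction-free functions which agree at all positive points agree generically. -/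
theorem IsSF.eventually_eq [Fintype P] {f g : (P → ℂ) → ℂ} (hf : IsSF f) (hg : IsSF g)
    (h : ∀ t ∈ posPoints P, f t = g t) :
    ∃ r : (P → ℂ) → ℂ, PosPoly r ∧ ∀ t ∈ torus P, r t ≠ 0 → f t = g t := by
  obtain ⟨p, q, hp, hq, hf⟩ := hf
  obtain ⟨p', q', hp', hq', hg⟩ := hg
  have key : ∀ t, (p * q' - p' * q) t = 0 := by
    refine polyFun_eq_zero_of_posPoints ((polyFun _).sub_mem
      ((polyFun _).mul_mem hp.mem_polyFun hq'.mem_polyFun)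
      ((polyFun _).mul_mem hp'.mem_polyFun hq.mem_polyFun)) fun t ht => ?_
    have := h t ht
    have h1 := (hq.pos ht).ne'
    have h2 := (hq'.pos ht).ne'
    rw [hf t (posPoints_subset_torus ht) h1, hg t (posPoints_subset_torus ht) h2,
      div_eq_div_iff h1 h2] at this
    simp [this]
  refine ⟨_, hq.mul hq', fun t ht h0 => ?_⟩
  have h1 := left_ne_zero_of_mul h0
  have h2 := right_ne_zero_of_mul h0
  rw [hf t ht h1, hg t ht h2, div_eq_div_iff h1 h2]
  exact sub_eq_zero.1 (key t)

/-- A map between tori with subtraction-free coordinates. -/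
def IsSFMap (g : (P → ℂ) → (P' → ℂ)) : Prop := ∀ p, IsSF fun t => g t p

theorem IsSFMap.comp {P'' : Type} [Fintype P'] {g : (P' → ℂ) → (P'' → ℂ)}
    {f : (P → ℂ) → (P' → ℂ)} (hg : IsSFMap g) (hf : IsSFMap f) : IsSFMap fun t => g (f t) :=
  fun p => (hg p).comp hf

theorem IsSFMap.id : IsSFMap fun t : P → ℂ => t := fun p => IsSF.var p

theorem IsSFMap.pos {g : (P → ℂ) → (P' → ℂ)} (hg : IsSFMap g) {t : P → ℂ}
    (ht : t ∈ posPoints P) : g t ∈ posPoints P' := fun p => (hg p).pos ht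

theorem IsSFMap.eventually_eq [Fintype P] [Fintype P'] {f g : (P → ℂ) → (P' → ℂ)}
    (hf : IsSFMap f) (hg : IsSFMap g) (h : ∀ t ∈ posPoints P, f t = g t) :
    ∃ r : (P → ℂ) → ℂ, PosPoly r ∧ ∀ t ∈ torus P, r t ≠ 0 → f t = g t := by
  choose r hr h using fun p => (hf p).eventually_eq (hg p) fun t ht => congrFun (h t ht) p
  exact ⟨_, PosPoly.prod Finset.univ fun p _ => hr p, fun t ht h0 => funext fun p =>
    h p t ht fun h1 => h0 (Finset.prod_eq_zero (Finset.mem_univ p) h1)⟩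

theorem IsSFMap.generically_mem_torus [Fintype P'] {g : (P → ℂ) → (P' → ℂ)} (hg : IsSFMap g) :
    Generically (torus P) fun t => g t ∈ torus P' := by
  obtain ⟨r, hr, h⟩ := IsSF.eventually_mem_torus hg
  exact hr.generically h

theorem IsSFMap.generically_eq [Fintype P] [Fintype P'] {f g : (P → ℂ) → (P' → ℂ)}
    (hf : IsSFMap f) (hg : IsSFMap g) (h : ∀ t ∈ posPoints P, f t = g t) :
    Generically (torus P) fun t => f t = g t := by
  obtain ⟨r, hr, h⟩ := hf.eventually_eq hg h
  exact hr.generically h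

theorem IsSF.generically_eq [Fintype P] {f g : (P → ℂ) → ℂ}
    (hf : IsSF f) (hg : IsSF g) (h : ∀ t ∈ posPoints P, f t = g t) :
    Generically (torus P) fun t => f t = g t := by
  obtain ⟨r, hr, h⟩ := hf.eventually_eq hg h
  exact hr.generically h

/-- The composite of a polynomial with a subtraction-free map. -/
theorem IsSFMap.polyFun_comp [Fintype P'] {g : (P → ℂ) → (P' → ℂ)} (hg : IsSFMap g)
    {f : (P' → ℂ) → ℂ} (hf : f ∈ polyFun (P' → ℂ)) :
    ∃ p ∈ polyFun (P → ℂ), ∃ r, PosPoly r ∧ ∀ t ∈ torus P, r t ≠ 0 → f (g t) = p t / r t := by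
  classical
  have hadd : ∀ f f' : (P → ℂ) → ℂ,
      (∃ p ∈ polyFun (P → ℂ), ∃ r, PosPoly r ∧ ∀ t ∈ torus P, r t ≠ 0 → f t = p t / r t) →
      (∃ p ∈ polyFun (P → ℂ), ∃ r, PosPoly r ∧ ∀ t ∈ torus P, r t ≠ 0 → f' t = p t / r t) →
      (∃ p ∈ polyFun (P → ℂ), ∃ r, PosPoly r ∧
        ∀ t ∈ torus P, r t ≠ 0 → f t + f' t = p t / r t) := by
    rintro f f' ⟨p, hp, r, hr, h⟩ ⟨p', hp', r', hr', h'⟩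
    refine ⟨p * r' + p' * r, (polyFun _).add_mem ((polyFun _).mul_mem hp hr'.mem_polyFun)
      ((polyFun _).mul_mem hp' hr.mem_polyFun), _, hr.mul hr', fun t ht h0 => ?_⟩
    have h1 := left_ne_zero_of_mul h0
    have h2 := right_ne_zero_of_mul h0
    rw [h t ht h1, h' t ht h2]
    simp only [Pi.add_apply, Pi.mul_apply]
    field_simp
  refine polyFun_induction (C := fun f => ∃ p ∈ polyFun (P → ℂ), ∃ r, PosPoly r ∧
    ∀ t ∈ torus P, r t ≠ 0 → f (g t) = p t / r t) ?_ ?_ ?_ ?_ hf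
  · intro φ
    have key : ∀ s : Finset P', ∃ p ∈ polyFun (P → ℂ), ∃ r, PosPoly r ∧
        ∀ t ∈ torus P, r t ≠ 0 → ∑ i ∈ s, g t i * φ (Pi.single i 1) = p t / r t := by
      intro s
      induction s using Finset.induction_on with
      | empty => exact ⟨fun _ => 0, const_mem_polyFun 0, _, PosPoly.one, by simp⟩
      | insert a s ha ih =>
        simp only [Finset.sum_insert ha]
        refine hadd _ _ ?_ ih
        obtain ⟨p, q, hp, hq, h⟩ := hg a
        refine ⟨p * fun _ => φ (Pi.single a 1), (polyFun _).mul_mem hp.mem_polyFun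
          (const_mem_polyFun _), q, hq, fun t ht h0 => ?_⟩
        beta_reduce at h
        rw [h t ht h0, Pi.mul_apply]
        ring
    obtain ⟨p, hp, r, hr, h⟩ := key Finset.univ
    refine ⟨p, hp, r, hr, fun t ht h0 => ?_⟩
    beta_reduce
    rw [← h t ht h0, LinearMap.pi_apply_eq_sum_univ φ]
    refine Finset.sum_congr rfl fun i _ => ?_
    rw [smul_eq_mul]
    congr 2
    funext q
    simp [Pi.single_apply, eq_comm]
  · intro c
    exact ⟨fun _ => c, const_mem_polyFun c, _, PosPoly.one, by simp⟩
  · intro f f' h h'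
    exact hadd _ _ h h'
  · rintro f f' ⟨p, hp, r, hr, h⟩ ⟨p', hp', r', hr', h'⟩
    refine ⟨p * p', (polyFun _).mul_mem hp hp', _, hr.mul hr', fun t ht h0 => ?_⟩
    have h1 := left_ne_zero_of_mul h0
    have h2 := right_ne_zero_of_mul h0
    rw [Pi.mul_apply, h t ht h1, h' t ht h2, Pi.mul_apply, div_mul_div_comm]

/-- Pullback of a generic property along a subtraction-free map which is onto on positive points. -/
theorem Generically.comp_isSFMap [Fintype P] [Fintype P'] {Q : (P' → ℂ) → Prop}
    (hQ : Generically (torus P') Q) {g : (P → ℂ) → (P' → ℂ)} (hg : IsSFMap g)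
    (hsurj : ∀ y ∈ posPoints P', ∃ x ∈ posPoints P, g x = y) :
    Generically (torus P) fun t => Q (g t) := by
  obtain ⟨q, hq, ⟨y₀, -, hy₀⟩, hqQ⟩ := hQ
  -- The pulled-back open set must be nonempty: by density `q` is nonzero at some positive point,
  -- and `hsurj` lifts that point.
  obtain ⟨y, hy, hy'⟩ : ∃ y ∈ posPoints P', q y ≠ 0 := by
    by_contra! h
    exact hy₀ (polyFun_eq_zero_of_posPoints hq h y₀)
  obtain ⟨x, hx, rfl⟩ := hsurj y hy
  obtain ⟨p, hp, r, hr, h⟩ := hg.polyFun_comp hq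
  obtain ⟨s, hs, hs'⟩ := IsSF.eventually_mem_torus hg
  refine ⟨p * (r * s), (polyFun _).mul_mem hp ((polyFun _).mul_mem hr.mem_polyFun hs.mem_polyFun),
    ⟨x, posPoints_subset_torus hx, ?_⟩, fun t ht h0 => ?_⟩
  · refine mul_ne_zero (fun h0 => hy' ?_) (mul_ne_zero (hr.pos hx).ne' (hs.pos hx).ne')
    rw [h x (posPoints_subset_torus hx) (hr.pos hx).ne', h0, zero_div]
  · have h1 := left_ne_zero_of_mul h0
    have h2 := left_ne_zero_of_mul (right_ne_zero_of_mul h0)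
    have h3 := right_ne_zero_of_mul (right_ne_zero_of_mul h0)
    refine hqQ _ (hs' t ht h3) ?_
    rw [h t ht h2]
    exact div_ne_zero h1 h2

end SubtractionFree

/-! ### Positivity in terms of characters -/

section Positive

variable {P P' : Type} [Fintype P] [Fintype P']

theorem torusChar_add (m m' : P → ℤ) {t : P → ℂ} (ht : t ∈ torus P) :
    torusChar (m + m') t = torusChar m t * torusChar m' t := by
  simp only [torusChar, Pi.add_apply, ← Finset.prod_mul_distrib]
  exact Finset.prod_congr rfl fun p _ => zpow_add₀ (ht p) _ _

-- With positive coefficients nothing cancels: the exponents of a sum form the union of the two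
-- supports, those of a product their Minkowski sum.
open Pointwise in
theorem PosPoly.isPosComb {f : (P → ℂ) → ℂ} (hf : PosPoly f) : IsPosComb f := by
  classical
  induction hf with
  | const a ha => exact ⟨{0}, fun _ => a, by simp, by simp [ha], by simp [torusChar]⟩
  | var p =>
    refine ⟨{Pi.single p 1}, fun _ => 1, by simp, by simp, fun t ht => ?_⟩
    simp only [Finset.sum_singleton, torusChar, Complex.ofReal_one, one_mul]
    rw [Finset.prod_eq_single p]
    · simp
    · intro q _ hq; simp [hq]
    · simp
  | @add f g _ _ hf hg =>
    obtain ⟨s, a, hs, ha, h⟩ := hf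
    obtain ⟨s', a', hs', ha', h'⟩ := hg
    refine ⟨s ∪ s', fun m => (if m ∈ s then a m else 0) + if m ∈ s' then a' m else 0,
      hs.mono Finset.subset_union_left, fun m hm => ?_, fun t ht => ?_⟩
    · have h1 : 0 ≤ if m ∈ s then a m else 0 := by
        split_ifs with h
        exacts [(ha m h).le, le_rfl]
      have h2 : 0 ≤ if m ∈ s' then a' m else 0 := by
        split_ifs with h
        exacts [(ha' m h).le, le_rfl]
      beta_reduce
      rcases Finset.mem_union.1 hm with h | h
      · rw [if_pos h]; exact add_pos_of_pos_of_nonneg (ha m h) h2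
      · rw [if_pos h]; exact add_pos_of_nonneg_of_pos h1 (ha' m h)
    · beta_reduce
      rw [h t ht, h' t ht]
      push_cast
      simp only [add_mul, Finset.sum_add_distrib]
      congr 1
      · rw [← Finset.sum_subset (Finset.subset_union_left (s₁ := s) (s₂ := s'))]
        · exact Finset.sum_congr rfl fun m hm => by simp [hm]
        · intro m _ hm; simp [hm]
      · rw [← Finset.sum_subset (Finset.subset_union_right (s₁ := s) (s₂ := s'))]
        · exact Finset.sum_congr rfl fun m hm => by simp [hm]
        · intro m _ hm; simp [hm]
  | @mul f g _ _ hf hg =>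
    obtain ⟨s, a, hs, ha, h⟩ := hf
    obtain ⟨s', a', hs', ha', h'⟩ := hg
    refine ⟨s + s', fun m => ∑ z ∈ s ×ˢ s' with z.1 + z.2 = m, a z.1 * a' z.2,
      hs.add hs', fun m hm => ?_, fun t ht => ?_⟩
    · obtain ⟨x, hx, y, hy, rfl⟩ := Finset.mem_add.1 hm
      refine Finset.sum_pos (fun z hz => ?_) ⟨(x, y), by simp [hx, hy]⟩
      simp only [Finset.mem_filter, Finset.mem_product] at hz
      exact mul_pos (ha _ hz.1.1) (ha' _ hz.1.2)
    · beta_reduce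
      rw [h t ht, h' t ht, Finset.sum_mul_sum, ← Finset.sum_product',
        ← Finset.sum_fiberwise_of_maps_to (t := s + s') (g := fun z : (P → ℤ) × (P → ℤ) => z.1 + z.2)]
      · refine Finset.sum_congr rfl fun m _ => ?_
        push_cast
        rw [Finset.sum_mul]
        refine Finset.sum_congr rfl fun z hz => ?_
        rw [← (Finset.mem_filter.1 hz).2, torusChar_add _ _ ht]
        ring
      · intro z hz
        rw [Finset.mem_product] at hz
        exact Finset.add_mem_add hz.1 hz.2

theorem IsSF.isPosFun {f : (P → ℂ) → ℂ} (hf : IsSF f) : IsPosFun f := by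
  obtain ⟨p, q, hp, hq, h⟩ := hf
  exact ⟨p, q, hp.isPosComb, hq.isPosComb, hq.generically h⟩

theorem IsPosFun.congr {f g : (P → ℂ) → ℂ} (hf : IsPosFun f)
    (h : Generically (torus P) fun t => g t = f t) : IsPosFun g := by
  obtain ⟨a, b, ha, hb, hab⟩ := hf
  exact ⟨a, b, ha, hb, (h.and isIrreducibleSet_torus hab).mono fun t _ h => h.1.trans h.2⟩

theorem IsSFMap.torusChar {P P' : Type} [Fintype P'] {g : (P → ℂ) → (P' → ℂ)} (hg : IsSFMap g) (m : P' → ℤ) :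
    IsSF fun t => torusChar m (g t) :=
  IsSF.prod _ fun p _ => (hg p).zpow (m p)

end Positive

/-! ### Charts: tori embedded with a regular inverse -/

section Chart

variable {U V V' P : Type} [AddCommGroup V] [Module ℂ V] [AddCommGroup V'] [Module ℂ V']

/-- On `S`, the function `f` is a quotient of polynomials in `η` with nonvanishing denominator. -/
def IsRegVia (S : Set U) (η : U → V) (f : U → ℂ) : Prop :=
  ∃ a ∈ polyFun V, ∃ b ∈ polyFun V, ∀ u ∈ S, b (η u) ≠ 0 ∧ f u = a (η u) / b (η u)

theorem IsRegVia.of_polyFun {S : Set U} {η : U → V} {f : V → ℂ} (hf : f ∈ polyFun V) :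
    IsRegVia S η fun u => f (η u) :=
  ⟨f, hf, fun _ => 1, const_mem_polyFun 1, fun u _ => by simp⟩

theorem IsRegVia.add {S : Set U} {η : U → V} {f g : U → ℂ} (hf : IsRegVia S η f)
    (hg : IsRegVia S η g) : IsRegVia S η fun u => f u + g u := by
  obtain ⟨a, ha, b, hb, h⟩ := hf
  obtain ⟨a', ha', b', hb', h'⟩ := hg
  refine ⟨a * b' + a' * b, (polyFun V).add_mem ((polyFun V).mul_mem ha hb')
    ((polyFun V).mul_mem ha' hb), b * b', (polyFun V).mul_mem hb hb', fun u hu => ?_⟩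
  obtain ⟨h1, h2⟩ := h u hu
  obtain ⟨h3, h4⟩ := h' u hu
  refine ⟨mul_ne_zero h1 h3, ?_⟩
  simp only [h2, h4, Pi.add_apply, Pi.mul_apply]
  field_simp

theorem IsRegVia.mul {S : Set U} {η : U → V} {f g : U → ℂ} (hf : IsRegVia S η f)
    (hg : IsRegVia S η g) : IsRegVia S η fun u => f u * g u := by
  obtain ⟨a, ha, b, hb, h⟩ := hf
  obtain ⟨a', ha', b', hb', h'⟩ := hg
  refine ⟨a * a', (polyFun V).mul_mem ha ha', b * b', (polyFun V).mul_mem hb hb', fun u hu => ?_⟩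
  obtain ⟨h1, h2⟩ := h u hu
  obtain ⟨h3, h4⟩ := h' u hu
  exact ⟨mul_ne_zero h1 h3, by simp only [h2, h4, Pi.mul_apply, div_mul_div_comm]⟩

theorem IsRegVia.const {S : Set U} {η : U → V} (c : ℂ) : IsRegVia S η fun _ => c :=
  IsRegVia.of_polyFun (const_mem_polyFun c)

theorem IsRegVia.sum {ι : Type*} {S : Set U} {η : U → V} (s : Finset ι) {f : ι → U → ℂ}
    (hf : ∀ i ∈ s, IsRegVia S η (f i)) : IsRegVia S η fun u => ∑ i ∈ s, f i u := by
  classical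
  induction s using Finset.induction_on with
  | empty => simpa using IsRegVia.const 0
  | insert a s ha ih =>
    simp only [Finset.sum_insert ha]
    exact (hf a (by simp)).add (ih fun i hi => hf i (by simp [hi]))

theorem IsRegVia.comp {S : Set U} {η : U → V} {h : U → V'}
    (hh : ∀ φ : Module.Dual ℂ V', IsRegVia S η fun u => φ (h u)) {f : V' → ℂ}
    (hf : f ∈ polyFun V') : IsRegVia S η fun u => f (h u) :=
  polyFun_induction (C := fun f => IsRegVia S η fun u => f (h u)) hh IsRegVia.const
    (fun _ _ => IsRegVia.add) (fun _ _ => IsRegVia.mul) hf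

theorem dual_pi_apply [Fintype P] [DecidableEq P] (φ : Module.Dual ℂ (P → ℂ)) (t : P → ℂ) :
    φ t = ∑ p, φ (Pi.single p 1) * t p := by
  rw [LinearMap.pi_apply_eq_sum_univ φ]
  refine Finset.sum_congr rfl fun p _ => ?_
  rw [smul_eq_mul, mul_comm]
  congr 2
  funext q
  simp [Pi.single_apply, eq_comm]

theorem IsRegVia.dual_pi [Fintype P] {S : Set U} {η : U → V} {h : U → P → ℂ}
    (hh : ∀ p, IsRegVia S η fun u => h u p) (φ : Module.Dual ℂ (P → ℂ)) :
    IsRegVia S η fun u => φ (h u) := by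
  classical
  refine (congrArg (IsRegVia S η) (funext fun u => dual_pi_apply φ (h u))).mpr ?_
  exact IsRegVia.sum _ fun p _ => (IsRegVia.const _).mul (hh p)

theorem IsRegVia.comp_pi [Fintype P] {S : Set U} {η : U → V} {h : U → P → ℂ}
    (hh : ∀ p, IsRegVia S η fun u => h u p) {f : (P → ℂ) → ℂ} (hf : f ∈ polyFun (P → ℂ)) :
    IsRegVia S η fun u => f (h u) :=
  IsRegVia.comp (IsRegVia.dual_pi hh) hf

/-- `θ` identifies the torus with the variety `X`, the inverse being regular on `X`. -/
structure IsChart (X : Set V) (θ : (P → ℂ) → V) : Prop where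
  image : X = θ '' torus P
  inv : ∀ p, IsRegVia (torus P) θ fun t => t p
  regular : ∀ φ : Module.Dual ℂ V, IsRegVia (torus P) id fun t => φ (θ t)

variable {X : Set V} {θ : (P → ℂ) → V}

theorem IsChart.mem (h : IsChart X θ) {t : P → ℂ} (ht : t ∈ torus P) : θ t ∈ X := by
  rw [h.image]; exact ⟨t, ht, rfl⟩

theorem IsChart.injOn (h : IsChart X θ) : Set.InjOn θ (torus P) := by
  intro s hs t ht hst
  funext p
  obtain ⟨a, -, b, -, hab⟩ := h.inv p
  beta_reduce at hab
  rw [(hab s hs).2, (hab t ht).2, hst]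

variable [Fintype P]

/-- Substituting the chart, or its inverse, turns a polynomial into a fraction whose denominator
vanishes nowhere on the torus; its numerator therefore has the same nonvanishing locus. -/
theorem IsChart.generically_iff (h : IsChart X θ) {Q : V → Prop} :
    Generically X Q ↔ Generically (torus P) fun t => Q (θ t) := by
  constructor
  · rintro ⟨q, hq, ⟨x, hx, hx0⟩, hqQ⟩
    obtain ⟨a, ha, b, hb, hab⟩ := IsRegVia.comp h.regular hq
    simp only [id] at hab
    rw [h.image] at hx
    obtain ⟨t, ht, rfl⟩ := hx
    refine ⟨a, ha, ⟨t, ht, fun h0 => hx0 ?_⟩, fun t ht h0 => hqQ _ (h.mem ht) ?_⟩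
    · rw [(hab t ht).2, h0, zero_div]
    · rw [(hab t ht).2]
      exact div_ne_zero h0 (hab t ht).1
  · rintro ⟨q, hq, ⟨t, ht, ht0⟩, hqQ⟩
    obtain ⟨a, ha, b, hb, hab⟩ := IsRegVia.comp_pi (h := id) h.inv hq
    simp only [id] at hab
    refine ⟨a, ha, ⟨θ t, h.mem ht, fun h0 => ht0 ?_⟩, fun x hx h0 => ?_⟩
    · have := (hab t ht).2
      rwa [h0, zero_div] at this
    · rw [h.image] at hx
      obtain ⟨t, ht, rfl⟩ := hx
      refine hqQ t ht ?_
      have := (hab t ht).2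
      rw [this]
      exact div_ne_zero h0 (hab t ht).1

theorem IsChart.isIrreducibleSet (h : IsChart X θ) : IsIrreducibleSet X := by
  refine ⟨⟨θ 1, h.mem fun _ => one_ne_zero (α := ℂ)⟩, fun p hp q hq hpq => ?_⟩
  obtain ⟨a, ha, b, hb, hab⟩ := IsRegVia.comp h.regular hp
  simp only [id] at hab
  obtain ⟨a', ha', b', hb', hab'⟩ := IsRegVia.comp h.regular hq
  simp only [id] at hab'
  have key : ∀ t ∈ torus P, a t * a' t = 0 := by
    intro t ht
    have := hpq _ (h.mem ht)
    rw [(hab t ht).2, (hab' t ht).2, div_mul_div_comm, div_eq_zero_iff] at this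
    exact this.resolve_right (mul_ne_zero (hab t ht).1 (hab' t ht).1)
  rw [h.image]
  rcases isIrreducibleSet_torus.2 a ha a' ha' key with h0 | h0
  · left
    rintro _ ⟨t, ht, rfl⟩
    rw [(hab t ht).2, h0 t ht, zero_div]
  · right
    rintro _ ⟨t, ht, rfl⟩
    rw [(hab' t ht).2, h0 t ht, zero_div]

/-- The nonvanishing loci of the two denominators agree exactly, not just generically: `IsDefinedAt`
refers to a prescribed point. -/
theorem IsChart.exists_quotient (h : IsChart X θ) {p q : (P → ℂ) → ℂ} (hp : p ∈ polyFun (P → ℂ))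
    (hq : q ∈ polyFun (P → ℂ)) : ∃ p' ∈ polyFun V, ∃ q' ∈ polyFun V, ∀ t ∈ torus P,
      (q' (θ t) ≠ 0 ↔ q t ≠ 0) ∧ (q t ≠ 0 → p t / q t = p' (θ t) / q' (θ t)) := by
  obtain ⟨a, ha, b, hb, hab⟩ := IsRegVia.comp_pi (h := id) h.inv hp
  simp only [id] at hab
  obtain ⟨a', ha', b', hb', hab'⟩ := IsRegVia.comp_pi (h := id) h.inv hq
  simp only [id] at hab'
  refine ⟨a * b', (polyFun V).mul_mem ha hb', b * a', (polyFun V).mul_mem hb ha',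
    fun t ht => ?_⟩
  obtain ⟨h1, h2⟩ := hab t ht
  obtain ⟨h3, h4⟩ := hab' t ht
  rw [h2, h4]
  refine ⟨by simp [h1, h3], fun h0 => ?_⟩
  have h5 : a' (θ t) ≠ 0 := fun h => h0 (by rw [h, zero_div])
  simp only [Pi.mul_apply]
  field_simp

theorem IsChart.isRatFun (h : IsChart X θ) {f : V → ℂ}
    (hf : IsRatFun (torus P) fun t => f (θ t)) : IsRatFun X f := by
  obtain ⟨p, hp, q, hq, ⟨t, ht, ht0⟩, hpq⟩ := hf
  beta_reduce at hpq
  obtain ⟨p', hp', q', hq', h'⟩ := h.exists_quotient hp hq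
  refine ⟨p', hp', q', hq', ⟨θ t, h.mem ht, (h' t ht).1.2 ht0⟩, fun x hx h0 => ?_⟩
  rw [h.image] at hx
  obtain ⟨t, ht, rfl⟩ := hx
  have h1 := (h' t ht).1.1 h0
  rw [hpq t ht h1, (h' t ht).2 h1]

theorem IsChart.isRatMap (h : IsChart X θ) {Y : Set V'} {f : V → V'}
    (hf : IsRatMap (torus P) Y fun t => f (θ t)) : IsRatMap X Y f :=
  ⟨fun φ => h.isRatFun (hf.1 φ), h.generically_iff.2 hf.2⟩

theorem IsChart.isDefinedAt (h : IsChart X θ) {Y : Set V'} {f : V → V'} {t : P → ℂ}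
    (ht : t ∈ torus P) {y : V'} (hy : y ∈ Y)
    (hf : ∀ φ : Module.Dual ℂ V', ∃ p ∈ polyFun (P → ℂ), ∃ q ∈ polyFun (P → ℂ),
      q t ≠ 0 ∧ (Generically (torus P) fun z => q z ≠ 0 ∧ φ (f (θ z)) = p z / q z) ∧
        φ y = p t / q t) : IsDefinedAt X Y f (θ t) y := by
  refine ⟨h.mem ht, hy, fun φ => ?_⟩
  obtain ⟨p, hp, q, hq, h0, hgen, hval⟩ := hf φ
  obtain ⟨p', hp', q', hq', h'⟩ := h.exists_quotient hp hq
  refine ⟨p', hp', q', hq', (h' t ht).1.2 h0, h.generically_iff.2 ?_, ?_⟩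
  · exact hgen.mono fun z hz h1 => by rw [h1.2, (h' z hz).2 h1.1]
  · rw [hval, (h' t ht).2 h0]

theorem IsChart.gmProd (h : IsChart X θ) :
    IsChart (gmProd X) fun z : Option P → ℂ => (z none, θ fun p => z (some p)) := by
  refine ⟨?_, ?_, ?_⟩
  · ext ⟨c, v⟩
    simp only [GeomCrystal.gmProd, h.image, Set.mem_ofPred_eq, Set.mem_image, Prod.mk.injEq]
    constructor
    · rintro ⟨hc, t, ht, rfl⟩
      refine ⟨fun o => o.elim c t, fun o => ?_, rfl, rfl⟩
      cases o
      exacts [hc, ht _]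
    · rintro ⟨z, hz, rfl, rfl⟩
      exact ⟨hz none, _, fun p => hz (some p), rfl⟩
  · rintro (_ | p)
    · exact IsRegVia.of_polyFun (f := fun w : ℂ × V => w.1)
        (dual_mem_polyFun (V := ℂ × V) (LinearMap.fst ℂ ℂ V))
    · obtain ⟨a, ha, b, hb, hab⟩ := h.inv p
      exact ⟨_, polyFun_comp_linear ha (LinearMap.snd ℂ ℂ V), _,
        polyFun_comp_linear hb (LinearMap.snd ℂ ℂ V), fun z hz => hab _ fun p => hz (some p)⟩
  · intro φ
    have key : ∀ (c : ℂ) (v : V), φ (c, v) = φ (1, 0) * c + φ.comp (LinearMap.inr ℂ ℂ V) v := by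
      intro c v
      rw [LinearMap.comp_apply, LinearMap.inr_apply, mul_comm, ← smul_eq_mul, ← map_smul,
        ← map_add]
      simp
    refine (congrArg (IsRegVia _ _) (funext fun z : Option P → ℂ => key (z none) _)).mpr ?_
    refine ((IsRegVia.const _).mul (IsRegVia.of_polyFun (coord_mem_polyFun none))).add ?_
    obtain ⟨a, ha, b, hb, hab⟩ := h.regular (φ.comp (LinearMap.inr ℂ ℂ V))
    have hL : ∀ f : (P → ℂ) → ℂ, f ∈ polyFun (P → ℂ) →
        (fun z : Option P → ℂ => f fun p => z (some p)) ∈ polyFun (Option P → ℂ) := fun f hf =>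
      polyFun_comp_poly hf fun p => coord_mem_polyFun (some p)
    exact ⟨_, hL a ha, _, hL b hb, fun z hz => hab _ fun p => hz (some p)⟩

end Chart

/-! ### Rationality of subtraction-free functions -/

section RatFun

open scoped ComplexOrder

variable {P P' : Type} [Fintype P] [Fintype P']

theorem isRatFun_dual_of_isSF {Q : Type} [Fintype Q] {f : (P → ℂ) → (Q → ℂ)} {g : (P → ℂ) → (Q → ℂ)}
    (hg : IsSFMap g) (hfg : Generically (torus P) fun t => f t = g t)
    (φ : Module.Dual ℂ (Q → ℂ)) : IsRatFun (torus P) fun t => φ (f t) := by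
  obtain ⟨p, hp, r, hr, h⟩ := hg.polyFun_comp (dual_mem_polyFun φ)
  obtain ⟨q, hq, ⟨t, ht, ht0⟩, hqQ⟩ := hfg
  obtain ⟨s, hs, hs0⟩ := polyFun_mul_ne_zero hq hr.mem_polyFun ⟨t, ht0⟩
    ⟨1, (hr.pos one_mem_posPoints).ne'⟩
  refine ⟨p * q, (polyFun _).mul_mem hp hq, q * r, (polyFun _).mul_mem hq hr.mem_polyFun,
    ⟨s, posPoints_subset_torus hs, hs0⟩, fun t ht h0 => ?_⟩
  have h1 := left_ne_zero_of_mul h0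
  have h2 := right_ne_zero_of_mul h0
  beta_reduce at hqQ ⊢
  rw [hqQ t ht h1, h t ht h2, Pi.mul_apply, Pi.mul_apply, mul_comm (q t),
    mul_div_mul_right _ _ h1]

theorem isRatFun_of_isSF {f g : (P → ℂ) → ℂ} (hg : IsSF g)
    (hfg : Generically (torus P) fun t => f t = g t) : IsRatFun (torus P) f := by
  have := isRatFun_dual_of_isSF (Q := Unit) (f := fun t _ => f t) (g := fun t _ => g t)
    (fun _ => hg) (hfg.mono fun t _ h => funext fun _ => h) (LinearMap.proj ())
  simpa using this

end RatFun

/-! ### Tableau coordinates and cyclic base points -/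

section Coordinates

variable {n k : ℕ}

/-- The coordinate of `v` at the tableau with entry set `s` (zero unless `s` has `k` elements). -/
noncomputable def cf (v : FundRep n k) (s : Finset (Fin (n + 1))) : ℂ :=
  if h : s.card = k then v ⟨s, h⟩ else 0

theorem cf_val (v : FundRep n k) (s : Tab n k) : cf v s.1 = v s := dif_pos s.2

theorem cf_ext {v w : FundRep n k} (h : ∀ s, cf v s = cf w s) : v = w := by
  funext s
  rw [← cf_val v, h, cf_val]

theorem cf_of_card_ne (v : FundRep n k) {s : Finset (Fin (n + 1))} (h : s.card ≠ k) :
    cf v s = 0 := dif_neg h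

theorem cf_add (v w : FundRep n k) (s) : cf (v + w) s = cf v s + cf w s := by
  unfold cf; split_ifs <;> simp

theorem cf_smul (c : ℂ) (v : FundRep n k) (s) : cf (c • v) s = c * cf v s := by
  unfold cf; split_ifs <;> simp

theorem coroot_apply (i : Fin (n + 1)) (c : ℂ) (v : FundRep n k) (s : Tab n k) :
    coroot n k i c v s = (if i ∈ s.1 ∧ i + 1 ∉ s.1 then c
      else if i ∉ s.1 ∧ i + 1 ∈ s.1 then c⁻¹ else 1) * v s := by
  rw [coroot, Module.Basis.constr_apply_fintype, Finset.sum_apply, Finset.sum_eq_single s]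
  · simp only [Pi.basisFun_equivFun, LinearEquiv.refl_apply, Pi.smul_apply, smul_eq_mul]
    split_ifs <;> simp [mul_comm]
  · intro t _ ht
    simp only [Pi.smul_apply, smul_eq_mul]
    split_ifs <;> simp [ht.symm]
  · simp

theorem card_insert_erase {α : Type*} [DecidableEq α] {s : Finset α} {a b : α} (ha : a ∈ s)
    (hb : b ∉ s) : (insert b (s.erase a)).card = s.card := by
  rw [Finset.card_insert_of_notMem fun h => hb (Finset.mem_of_mem_erase h),
    Finset.card_erase_of_mem ha]
  have := Finset.card_pos.2 ⟨a, ha⟩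
  omega

theorem insert_erase_insert_erase {α : Type*} [DecidableEq α] {s : Finset α} {a b : α}
    (ha : a ∈ s) (hb : b ∉ s) : insert a ((insert b (s.erase a)).erase b) = s := by
  rw [Finset.erase_insert fun h => hb (Finset.mem_of_mem_erase h), Finset.insert_erase ha]

theorem cf_chevF (i : Fin (n + 1)) (v : FundRep n k) (s : Finset (Fin (n + 1))) :
    cf (chevF n k i v) s =
      if i ∉ s ∧ i + 1 ∈ s then cf v (insert i (s.erase (i + 1))) else 0 := by
  by_cases hs : s.card = k
  swap
  · rw [cf_of_card_ne _ hs]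
    split_ifs with h
    · rw [cf_of_card_ne]
      rwa [card_insert_erase h.2 h.1]
    · rfl
  rw [show cf (chevF n k i v) s = chevF n k i v ⟨s, hs⟩ from dif_pos hs,
    chevF, Module.Basis.constr_apply_fintype, Finset.sum_apply]
  simp only [Pi.basisFun_equivFun, LinearEquiv.refl_apply, Pi.smul_apply, smul_eq_mul]
  split_ifs with h
  · have hc : (insert i (s.erase (i + 1))).card = k := by rw [card_insert_erase h.2 h.1, hs]
    rw [Finset.sum_eq_single ⟨_, hc⟩]
    · have h1 : i ∈ insert i (s.erase (i + 1)) ∧ i + 1 ∉ insert i (s.erase (i + 1)) := by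
        refine ⟨Finset.mem_insert_self _ _, fun h' => ?_⟩
        rcases Finset.mem_insert.1 h' with h2 | h2
        · exact h.1 (h2 ▸ h.2)
        · simp at h2
      rw [dif_pos h1]
      have : raise i (⟨_, hc⟩ : Tab n k) h1 = ⟨s, hs⟩ :=
        Subtype.ext (insert_erase_insert_erase h.2 h.1)
      rw [this, Pi.single_eq_same, mul_one, cf, dif_pos hc]
    · intro t _ ht
      split_ifs with h1
      · rw [Pi.single_eq_of_ne, mul_zero]
        intro h2
        refine ht (Subtype.ext ?_)
        have h3 := congrArg Subtype.val h2
        simp only [raise] at h3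
        show t.1 = insert i (s.erase (i + 1))
        rw [h3, insert_erase_insert_erase h1.1 h1.2]
      · simp
    · simp
  · refine Finset.sum_eq_zero fun t _ => ?_
    split_ifs with h1
    · rw [Pi.single_eq_of_ne, mul_zero]
      intro h2
      have h3 := congrArg Subtype.val h2
      simp only [raise] at h3
      refine h ⟨?_, ?_⟩
      · rw [h3]
        intro h4
        rcases Finset.mem_insert.1 h4 with h5 | h5
        · exact h1.2 (h5 ▸ h1.1)
        · simp at h5
      · rw [h3]; simp
    · simp

/-- The source tableau of `f_i` is scaled by `c` under the coroot, which cancels the factor `c⁻¹` of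
`f_i`. So an entry is moved with coefficient `1`, the reason why the cluster coordinates come out as
monomials. -/
theorem cf_opY (i : Fin (n + 1)) {c : ℂ} (hc : c ≠ 0) (v : FundRep n k)
    (s : Finset (Fin (n + 1))) : cf (opY n k i c v) s =
      if i ∈ s ∧ i + 1 ∉ s then c * cf v s
      else if i ∉ s ∧ i + 1 ∈ s then c⁻¹ * cf v s + cf v (insert i (s.erase (i + 1)))
      else cf v s := by
  have hco : ∀ s, cf (coroot n k i c v) s = (if i ∈ s ∧ i + 1 ∉ s then c
      else if i ∉ s ∧ i + 1 ∈ s then c⁻¹ else 1) * cf v s := by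
    intro s
    by_cases hs : s.card = k
    · rw [show cf (coroot n k i c v) s = coroot n k i c v ⟨s, hs⟩ from dif_pos hs, coroot_apply,
        show cf v s = v ⟨s, hs⟩ from dif_pos hs]
    · rw [cf_of_card_ne _ hs, cf_of_card_ne _ hs, mul_zero]
  have : opY n k i c v = coroot n k i c v + c⁻¹ • chevF n k i (coroot n k i c v) := by
    simp [opY, add_mul]
  rw [this, cf_add, cf_smul, cf_chevF, hco, hco]
  by_cases h1 : i ∈ s <;> by_cases h2 : i + 1 ∈ s
  · simp [h1, h2]
  · simp [h1, h2]
  · have h3 : i + 1 ≠ i := fun h => h1 (h ▸ h2)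
    simp only [h1, h2, h3, Finset.mem_insert, Finset.mem_erase, not_true_eq_false, and_true,
      if_true, not_false_eq_true, and_false, if_false, or_false, ne_eq, or_self]
    rw [inv_mul_cancel_left₀ hc]
  · simp [h1, h2]

/-- The elements of `ℤ / (n + 1)`, listed from `r`. -/
def wn (n r m : ℕ) : Fin (n + 1) := Fin.ofNat (n + 1) (r + m)

theorem wn_add_one (n r m : ℕ) : wn n r m + 1 = wn n r (m + 1) := by
  apply Fin.ext
  simp [wn, Fin.val_add, ← add_assoc]

theorem wn_shift (n r m s : ℕ) : wn n (r + s) m = wn n r (m + s) := by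
  simp only [wn]; congr 1; omega

theorem wn_add_card (n r m : ℕ) : wn n (r + (n + 1)) m = wn n r m := by
  apply Fin.ext
  simp only [wn, Fin.ofNat]
  rw [show r + (n + 1) + m = r + m + (n + 1) by ring, Nat.add_mod_right]

theorem wn_inj {n r m m' : ℕ} (hm : m < n + 1) (hm' : m' < n + 1) :
    wn n r m = wn n r m' ↔ m = m' := by
  refine ⟨fun h => ?_, fun h => by rw [h]⟩
  have h := congrArg Fin.val h
  simp only [wn, Fin.ofNat] at h
  have : m ≡ m' [MOD n + 1] := Nat.ModEq.add_left_cancel' r h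
  rwa [Nat.ModEq, Nat.mod_eq_of_lt hm, Nat.mod_eq_of_lt hm'] at this

theorem wn_surj (n r : ℕ) (i : Fin (n + 1)) : ∃ m < n + 1, wn n r m = i := by
  refine ⟨(i.1 + (n + 1) * r - r) % (n + 1), Nat.mod_lt _ n.succ_pos, Fin.ext ?_⟩
  simp only [wn, Fin.ofNat]
  have : r ≤ (n + 1) * r := Nat.le_mul_of_pos_left _ n.succ_pos
  rw [Nat.add_mod_mod, show r + (i.1 + (n + 1) * r - r) = i.1 + (n + 1) * r by omega,
    Nat.add_mul_mod_self_left, Nat.mod_eq_of_lt i.2]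

theorem wn_mem_image {n r m : ℕ} {s : Finset ℕ} (hm : m < n + 1) (hs : s ⊆ Finset.range (n + 1)) :
    wn n r m ∈ s.image (wn n r) ↔ m ∈ s := by
  rw [Finset.mem_image]
  constructor
  · rintro ⟨m', hm', h⟩
    rwa [← (wn_inj (Finset.mem_range.1 (hs hm')) hm).1 h]
  · exact fun h => ⟨m, h, rfl⟩

theorem wn_image_erase {n r m : ℕ} {s : Finset ℕ} (hm : m < n + 1)
    (hs : s ⊆ Finset.range (n + 1)) :
    (s.erase m).image (wn n r) = (s.image (wn n r)).erase (wn n r m) := by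
  ext i
  obtain ⟨m', hm', rfl⟩ := wn_surj n r i
  rw [wn_mem_image hm' ((Finset.erase_subset _ _).trans hs), Finset.mem_erase, Finset.mem_erase,
    wn_mem_image hm' hs, Ne, Ne, wn_inj hm' hm]

theorem wn_image_injOn {n r : ℕ} {s t : Finset ℕ} (hs : s ⊆ Finset.range (n + 1))
    (ht : t ⊆ Finset.range (n + 1)) : s.image (wn n r) = t.image (wn n r) ↔ s = t := by
  refine ⟨fun h => ?_, fun h => by rw [h]⟩
  ext m
  by_cases hm : m < n + 1
  · rw [← wn_mem_image (r := r) hm hs, h, wn_mem_image hm ht]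
  · exact ⟨fun h => absurd (Finset.mem_range.1 (hs h)) hm,
      fun h => absurd (Finset.mem_range.1 (ht h)) hm⟩

theorem card_wn_image {n r : ℕ} {s : Finset ℕ} (hs : s ⊆ Finset.range (n + 1)) :
    (s.image (wn n r)).card = s.card :=
  Finset.card_image_of_injOn fun _ ha _ hb h =>
    (wn_inj (Finset.mem_range.1 (hs ha)) (Finset.mem_range.1 (hs hb))).1 h

theorem exists_wn_image {n r : ℕ} (s : Finset (Fin (n + 1))) :
    ∃ t ⊆ Finset.range (n + 1), t.image (wn n r) = s := by
  refine ⟨(Finset.range (n + 1)).filter fun m => wn n r m ∈ s, Finset.filter_subset _ _, ?_⟩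
  ext i
  obtain ⟨m, hm, rfl⟩ := wn_surj n r i
  rw [wn_mem_image hm (Finset.filter_subset _ _)]
  simp [hm]

/-- The coordinates of `v`, the tableaux being described by subsets of `{0, …, n}` counted
from `r`. -/
noncomputable def pc (r : ℕ) (v : FundRep n k) (s : Finset ℕ) : ℂ := cf v (s.image (wn n r))

theorem pc_ext (r : ℕ) {v w : FundRep n k}
    (h : ∀ s ⊆ Finset.range (n + 1), s.card = k → pc r v s = pc r w s) : v = w := by
  refine cf_ext fun s => ?_
  by_cases hk : s.card = k
  · obtain ⟨t, ht, rfl⟩ := exists_wn_image (r := r) s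
    exact h t ht (by rwa [card_wn_image ht] at hk)
  · rw [cf_of_card_ne _ hk, cf_of_card_ne _ hk]

theorem pc_smul (r : ℕ) (c : ℂ) (v : FundRep n k) (s) : pc r (c • v) s = c * pc r v s :=
  cf_smul _ _ _

theorem pc_of_card_ne (r : ℕ) (v : FundRep n k) {s : Finset ℕ} (hs : s ⊆ Finset.range (n + 1))
    (h : s.card ≠ k) : pc r v s = 0 :=
  cf_of_card_ne _ (by rwa [card_wn_image hs])

theorem pc_opY {r w : ℕ} (hw : w < n) {c : ℂ} (hc : c ≠ 0) (v : FundRep n k) {s : Finset ℕ}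
    (hs : s ⊆ Finset.range (n + 1)) : pc r (opY n k (wn n r w) c v) s =
      if w ∈ s ∧ w + 1 ∉ s then c * pc r v s
      else if w ∉ s ∧ w + 1 ∈ s then c⁻¹ * pc r v s + pc r v (insert w (s.erase (w + 1)))
      else pc r v s := by
  have h1 := wn_mem_image (n := n) (r := r) (m := w) (by omega) hs
  have h2 := wn_mem_image (n := n) (r := r) (m := w + 1) (by omega) hs
  rw [pc, cf_opY _ hc, wn_add_one]
  simp only [h1, h2]
  rw [pc, pc, Finset.image_insert, wn_image_erase (by omega) hs]

/-- The operation on subsets of `{0, …, n}` corresponding to a change of base point. -/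
def rot (n m : ℕ) : ℕ := if m = n then 0 else m + 1

theorem wn_succ_eq_rot {n r m : ℕ} (_ : m < n + 1) : wn n (r + 1) m = wn n r (rot n m) := by
  unfold rot
  split_ifs with h
  · rw [h, wn_shift, ← wn_add_card n r 0, wn_shift, Nat.zero_add]
  · rw [wn_shift]

theorem pc_succ (r : ℕ) (v : FundRep n k) {s : Finset ℕ} (hs : s ⊆ Finset.range (n + 1)) :
    pc (r + 1) v s = pc r v (s.image (rot n)) := by
  rw [pc, pc, Finset.image_image]
  congr 1
  exact Finset.image_congr fun m hm => wn_succ_eq_rot (Finset.mem_range.1 (hs hm))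

theorem pc_add_card (r : ℕ) (v : FundRep n k) (s : Finset ℕ) :
    pc (r + (n + 1)) v s = pc r v s := by
  rw [pc, pc]
  congr 1
  exact Finset.image_congr fun m _ => wn_add_card n r m

end Coordinates

/-! ### Decomposable vectors and cyclically invariant Plücker relations -/

section Plucker

variable {n k : ℕ}

/-- `v` is decomposable: its coordinates are the maximal minors of a matrix with rows `N`. -/
def IsDecomposable (r : ℕ) (v : FundRep n k) : Prop :=
  ∃ N : ℕ → Fin k → ℂ, ∀ o : Fin k → ℕ, StrictMono o → (∀ i, o i < n + 1) →
    pc r v (Finset.univ.image o) = (Matrix.of fun i => N (o i)).det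

theorem strictMono_lower {k w : ℕ} {o : Fin k → ℕ} (ho : StrictMono o) (hw : ∀ i, o i ≠ w)
    (i₀ : Fin k) (hi₀ : o i₀ = w + 1) : StrictMono (Function.update o i₀ w) := by
  intro i j hij
  have h1 := ho hij
  have h2 := hw i
  have h3 := hw j
  simp only [Function.update_apply]
  split_ifs with h4 h5 h5
  · subst h4; subst h5; omega
  · subst h4; omega
  · subst h5; omega
  · exact h1

theorem image_update_eq {k : ℕ} {o : Fin k → ℕ} (ho : Function.Injective o) (i₀ : Fin k) (w : ℕ) :
    Finset.univ.image (Function.update o i₀ w) =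
      insert w ((Finset.univ.image o).erase (o i₀)) := by
  ext m
  simp only [Finset.mem_image, Finset.mem_univ, true_and, Finset.mem_insert, Finset.mem_erase,
    Function.update_apply]
  constructor
  · rintro ⟨i, rfl⟩
    split_ifs with h
    · exact .inl rfl
    · exact .inr ⟨fun h' => h (ho h'), i, rfl⟩
  · rintro (rfl | ⟨h, i, rfl⟩)
    · exact ⟨i₀, by simp⟩
    · exact ⟨i, if_neg fun h' => h (by rw [h'])⟩

/-- The operator is the `k`-th exterior power of a matrix of determinant `1` mixing the rows `w` and
`w + 1`. Because `w < n`, the letter does not wrap around the base point, so lowering an entry keeps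
the rows sorted and no sign arises. -/
theorem IsDecomposable.opY {r w : ℕ} (hw : w < n) {c : ℂ} (hc : c ≠ 0) {v : FundRep n k}
    (hv : IsDecomposable r v) : IsDecomposable r (opY n k (wn n r w) c v) := by
  classical
  obtain ⟨N, hN⟩ := hv
  refine ⟨fun m => if m = w then c • N w else if m = w + 1 then c⁻¹ • N (w + 1) + N w else N m,
    fun o ho hon => ?_⟩
  have hs : Finset.univ.image o ⊆ Finset.range (n + 1) := by
    intro m hm
    obtain ⟨i, -, rfl⟩ := Finset.mem_image.1 hm
    exact Finset.mem_range.2 (hon i)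
  rw [pc_opY hw hc v hs]
  set A : Matrix (Fin k) (Fin k) ℂ := Matrix.of fun i => N (o i) with hA
  have hdet := hN o ho hon
  by_cases h1 : w ∈ Finset.univ.image o
  · obtain ⟨i₀, -, hi₀⟩ := Finset.mem_image.1 h1
    by_cases h2 : w + 1 ∈ Finset.univ.image o
    · obtain ⟨i₁, -, hi₁⟩ := Finset.mem_image.1 h2
      have h01 : i₁ ≠ i₀ := fun h => by rw [h, hi₀] at hi₁; omega
      rw [if_neg (by tauto), if_neg (by tauto), hdet]
      have : (Matrix.of fun i => if o i = w then c • N w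
          else if o i = w + 1 then c⁻¹ • N (w + 1) + N w else N (o i)) =
          (A.updateRow i₀ (c • A i₀)).updateRow i₁ (c⁻¹ • A i₁ + A i₀) := by
        ext i j
        by_cases hi : i = i₁
        · subst hi
          simp [hi₁, hA, hi₀]
        · by_cases hi' : i = i₀
          · subst hi'
            simp [hi₀, hA, Matrix.updateRow_apply, hi]
          · have h3 : o i ≠ w := fun h => hi' (ho.injective (h.trans hi₀.symm))
            have h4 : o i ≠ w + 1 := fun h => hi (ho.injective (h.trans hi₁.symm))
            simp [h3, h4, hA, Matrix.updateRow_apply, hi, hi']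
      have hcomm : ∀ x y, (A.updateRow i₀ x).updateRow i₁ y = (A.updateRow i₁ y).updateRow i₀ x := by
        intro x y
        exact Function.update_comm h01.symm x y A
      have h5 : ∀ x, (A.updateRow i₁ x).updateRow i₀ (A i₀) = A.updateRow i₁ x := by
        intro x
        ext i j
        by_cases hi : i = i₀
        · subst hi
          simp [Matrix.updateRow_apply, h01.symm]
        · simp [Matrix.updateRow_apply, hi]
      have h6 : (A.updateRow i₁ (A i₀)).det = 0 :=
        Matrix.det_zero_of_row_eq h01.symm (by
          funext j
          simp [Matrix.updateRow_apply, h01.symm])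
      rw [this, Matrix.det_updateRow_add, Matrix.det_updateRow_smul, hcomm, hcomm,
        Matrix.det_updateRow_smul, Matrix.det_updateRow_smul, h5, h5, h6, Matrix.updateRow_eq_self]
      field_simp
      simp [hA]
    · rw [if_pos ⟨h1, h2⟩, hdet]
      have : (Matrix.of fun i => if o i = w then c • N w
          else if o i = w + 1 then c⁻¹ • N (w + 1) + N w else N (o i)) =
          A.updateRow i₀ (c • A i₀) := by
        ext i j
        by_cases hi' : i = i₀
        · subst hi'
          simp [hi₀, hA]
        · have h3 : o i ≠ w := fun h => hi' (ho.injective (h.trans hi₀.symm))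
          have h4 : o i ≠ w + 1 := fun h => h2 (Finset.mem_image.2 ⟨i, Finset.mem_univ _, h⟩)
          simp [h3, h4, hA, Matrix.updateRow_apply, hi']
      rw [this, Matrix.det_updateRow_smul, Matrix.updateRow_eq_self]
  · have h3 : ∀ i, o i ≠ w := fun i h => h1 (Finset.mem_image.2 ⟨i, Finset.mem_univ _, h⟩)
    by_cases h2 : w + 1 ∈ Finset.univ.image o
    · obtain ⟨i₁, -, hi₁⟩ := Finset.mem_image.1 h2
      rw [if_neg (by tauto), if_pos ⟨h1, h2⟩, hdet]
      have : (Matrix.of fun i => if o i = w then c • N w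
          else if o i = w + 1 then c⁻¹ • N (w + 1) + N w else N (o i)) =
          A.updateRow i₁ (c⁻¹ • A i₁ + N w) := by
        ext i j
        by_cases hi : i = i₁
        · subst hi
          simp [hi₁, hA]
        · have h4 : o i ≠ w + 1 := fun h => hi (ho.injective (h.trans hi₁.symm))
          simp [h3 i, h4, hA, Matrix.updateRow_apply, hi]
      rw [this, Matrix.det_updateRow_add, Matrix.det_updateRow_smul, Matrix.updateRow_eq_self]
      congr 1
      have h4 := hN _ (strictMono_lower ho h3 i₁ hi₁) fun i => by
        simp only [Function.update_apply]
        split_ifs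
        · omega
        · exact hon i
      rw [image_update_eq ho.injective, hi₁] at h4
      rw [h4]
      congr 1
      ext i j
      by_cases hi : i = i₁
      · subst hi
        simp
      · simp [hi, hA, Matrix.updateRow_apply]
    · rw [if_neg (by tauto), if_neg (by tauto), hdet]
      congr 1
      ext i j
      have h4 : o i ≠ w + 1 := fun h => h2 (Finset.mem_image.2 ⟨i, Finset.mem_univ _, h⟩)
      simp [h3 i, h4]

/-- The three-term Plücker relations, in the cyclic order starting at `r`. -/
def IsPlucker (r : ℕ) (v : FundRep n k) : Prop :=
  ∀ T ⊆ Finset.range (n + 1), ∀ a b c d, a < b → b < c → c < d → d < n + 1 →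
    a ∉ T → b ∉ T → c ∉ T → d ∉ T →
    pc r v (insert a (insert c T)) * pc r v (insert b (insert d T)) =
      pc r v (insert a (insert b T)) * pc r v (insert c (insert d T)) +
        pc r v (insert a (insert d T)) * pc r v (insert b (insert c T))

/-- Modulo the rows `τ` the four vectors live in a plane, where this is the classical identity
between `2 × 2` determinants. -/
theorem det_exchange {m : ℕ} (τ : Fin m → Fin (m + 2) → ℂ) (a b c d : Fin (m + 2) → ℂ) :
    (Matrix.of (Fin.cons a (Fin.cons c τ : Fin (m + 1) → _) : Fin (m + 2) → _)).det *
      (Matrix.of (Fin.cons b (Fin.cons d τ : Fin (m + 1) → _) : Fin (m + 2) → _)).det =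
    (Matrix.of (Fin.cons a (Fin.cons b τ : Fin (m + 1) → _) : Fin (m + 2) → _)).det *
      (Matrix.of (Fin.cons c (Fin.cons d τ : Fin (m + 1) → _) : Fin (m + 2) → _)).det +
    (Matrix.of (Fin.cons a (Fin.cons d τ : Fin (m + 1) → _) : Fin (m + 2) → _)).det *
      (Matrix.of (Fin.cons b (Fin.cons c τ : Fin (m + 1) → _) : Fin (m + 2) → _)).det := by
  set G : (Fin (m + 2) → ℂ) → (Fin (m + 2) → ℂ) → ℂ := fun x y =>
    (Matrix.of (Fin.cons x (Fin.cons y τ : Fin (m + 1) → _) : Fin (m + 2) → _)).det with hG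
  have hup0 : ∀ x y z, (Matrix.of (Fin.cons x (Fin.cons y τ : Fin (m + 1) → _) :
      Fin (m + 2) → _)).updateRow 0 z =
      Matrix.of (Fin.cons z (Fin.cons y τ : Fin (m + 1) → _) : Fin (m + 2) → _) := by
    intro x y z
    ext i j
    refine Fin.cases ?_ (fun i => ?_) i <;> simp [Matrix.updateRow_apply]
  have hup1 : ∀ x y z, (Matrix.of (Fin.cons x (Fin.cons y τ : Fin (m + 1) → _) :
      Fin (m + 2) → _)).updateRow 1 z =
      Matrix.of (Fin.cons x (Fin.cons z τ : Fin (m + 1) → _) : Fin (m + 2) → _) := by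
    intro x y z
    ext i j
    refine Fin.cases ?_ (fun i => ?_) i
    · simp [Matrix.updateRow_apply]
    · refine Fin.cases ?_ (fun i => ?_) i
      · simp [Matrix.updateRow_apply]
      · simp [Matrix.updateRow_apply, Fin.ext_iff]
  have hanti : ∀ x y, G x y = - G y x := by
    intro x y
    have h := Matrix.det_permute (Equiv.swap (0 : Fin (m + 2)) 1)
      (Matrix.of (Fin.cons y (Fin.cons x τ : Fin (m + 1) → _) : Fin (m + 2) → _))
    rw [Equiv.Perm.sign_swap (by simp)] at h
    have h2 : (Matrix.of (Fin.cons y (Fin.cons x τ : Fin (m + 1) → _) :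
        Fin (m + 2) → _)).submatrix (Equiv.swap (0 : Fin (m + 2)) 1) id =
        Matrix.of (Fin.cons x (Fin.cons y τ : Fin (m + 1) → _) : Fin (m + 2) → _) := by
      funext i
      refine Fin.cases ?_ (fun i => ?_) i
      · funext j; simp
      · refine Fin.cases ?_ (fun i => ?_) i
        · funext j; simp
        · funext j
          rw [Matrix.submatrix_apply, Equiv.swap_apply_of_ne_of_ne (by simp [Fin.ext_iff])
            (by simp [Fin.ext_iff])]
          simp
    rw [h2] at h
    simp only [hG]
    rw [h]; simp
  have hzero : ∀ (i : Fin m) y, G (τ i) y = 0 := fun i y =>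
    Matrix.det_zero_of_row_eq (i := 0) (j := i.succ.succ) (Fin.succ_ne_zero _).symm (by
      funext j; simp)
  -- Cramer's rule expresses `G b c • a` through `b`, `c` and the rows of `τ`.
  have hcramer : G b c • a = G a c • b + G b a • c +
      ∑ i : Fin m, ((Matrix.of (Fin.cons b (Fin.cons c τ : Fin (m + 1) → _) :
        Fin (m + 2) → _)).updateRow i.succ.succ a).det • τ i := by
    set B : Matrix (Fin (m + 2)) (Fin (m + 2)) ℂ :=
      Matrix.of (Fin.cons b (Fin.cons c τ : Fin (m + 1) → _) : Fin (m + 2) → _) with hB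
    have h := Matrix.mulVec_cramer B.transpose a
    rw [Matrix.det_transpose] at h
    rw [show G b c = B.det from rfl, ← h]
    funext j
    rw [Matrix.mulVec, dotProduct, Fin.sum_univ_succ, Fin.sum_univ_succ]
    simp only [Matrix.transpose_apply, Matrix.cramer_transpose_apply, Fin.succ_zero_eq_one,
      Pi.add_apply, Pi.smul_apply, smul_eq_mul, Finset.sum_apply]
    have e0 : (B.updateRow 0 a).det = G a c := congrArg Matrix.det (hup0 b c a)
    have e1 : (B.updateRow 1 a).det = G b a := congrArg Matrix.det (hup1 b c a)
    have e2 : B 0 j = b j := by simp [hB]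
    have e3 : B 1 j = c j := by rw [hB]; rfl
    have e4 : ∀ i : Fin m, B i.succ.succ j = τ i j := fun i => by simp [hB]
    simp only [e0, e1, e2, e3, e4]
    rw [← add_assoc, mul_comm (b j), mul_comm (c j)]
    congr 1
    exact Finset.sum_congr rfl fun i _ => mul_comm _ _
  have hlin : ∀ x y z, G (x + y) z = G x z + G y z := by
    intro x y z
    simp only [hG]
    rw [← hup0 0 z (x + y), Matrix.det_updateRow_add, hup0, hup0]
  have hsm : ∀ (s : ℂ) x z, G (s • x) z = s * G x z := by
    intro s x z
    simp only [hG]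
    rw [← hup0 0 z (s • x), Matrix.det_updateRow_smul, hup0]
  have hsum : ∀ (s : Finset (Fin m)) (e : Fin m → ℂ) z, G (∑ i ∈ s, e i • τ i) z = 0 := by
    intro s e z
    induction s using Finset.induction_on with
    | empty =>
      have := hsm 0 0 z
      rwa [zero_smul, zero_mul] at this
    | insert i s hi ih => rw [Finset.sum_insert hi, hlin, hsm, hzero, ih, mul_zero, add_zero]
  have h := congrArg (fun x => G x d) hcramer
  simp only [hlin, hsm, hsum, add_zero] at h
  have h2 := hanti b a
  show G a c * G b d = G a b * G c d + G a d * G b c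
  linear_combination -h - G c d * h2

theorem vandermonde_pos {k : ℕ} {o : Fin k → ℕ} (ho : StrictMono o) :
    0 < (Matrix.vandermonde fun i => (o i : ℝ)).det := by
  rw [Matrix.det_vandermonde]
  refine Finset.prod_pos fun i _ => Finset.prod_pos fun j hj => sub_pos.2 ?_
  exact_mod_cast ho (Finset.mem_Ioi.1 hj)

/-- A coordinate of a decomposable vector as the determinant of the rows in any order. -/
theorem pc_eq_sign_mul_det {r : ℕ} {v : FundRep n k} {N : ℕ → Fin k → ℂ}
    (hN : ∀ o : Fin k → ℕ, StrictMono o → (∀ i, o i < n + 1) →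
      pc r v (Finset.univ.image o) = (Matrix.of fun i => N (o i)).det)
    {g : Fin k → ℕ} (hg : Function.Injective g) (hgn : ∀ i, g i < n + 1) :
    pc r v (Finset.univ.image g) =
      (SignType.sign (Matrix.vandermonde fun i => (g i : ℝ)).det : ℂ) *
        (Matrix.of fun i => N (g i)).det := by
  classical
  have hcard : (Finset.univ.image g).card = k := by
    rw [Finset.card_image_of_injective _ hg, Finset.card_univ, Fintype.card_fin]
  set o := (Finset.univ.image g).orderEmbOfFin hcard with ho
  have hex : ∀ i, ∃ j, o j = g i := fun i => by
    have : g i ∈ Set.range o := by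
      rw [ho, Finset.range_orderEmbOfFin]; simp
    exact this
  choose σ hσ using hex
  have hinj : Function.Injective σ := fun i j h => hg (by rw [← hσ, ← hσ, h])
  let e : Equiv.Perm (Fin k) := Equiv.ofBijective σ (Finite.injective_iff_bijective.1 hinj)
  have he : ∀ i, g i = o (e i) := fun i => (hσ i).symm
  have h1 : (Matrix.of fun i => N (g i)).det =
      (Equiv.Perm.sign e : ℂ) * (Matrix.of fun i => N (o i)).det := by
    rw [← Matrix.det_permute]
    congr 1
    ext i j
    simp [he]
  -- The Vandermonde determinant changes by the same sign as the minor and is positive on increasing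
  -- sequences, so its sign is that of the sorting permutation.
  have h2 : (Matrix.vandermonde fun i => (g i : ℝ)).det =
      (Equiv.Perm.sign e : ℝ) * (Matrix.vandermonde fun i => (o i : ℝ)).det := by
    rw [← Matrix.det_permute]
    congr 1
    funext i j
    simp [he, Matrix.vandermonde_apply]
  have h3 := vandermonde_pos o.strictMono
  have h4 : Finset.univ.image o = Finset.univ.image g := by
    apply Finset.coe_injective
    rw [Finset.coe_image, Finset.coe_univ, Set.image_univ, ho, Finset.range_orderEmbOfFin]
  have h5 := hN o o.strictMono fun i => by
    obtain ⟨j, -, hj⟩ := Finset.mem_image.1 (Finset.orderEmbOfFin_mem _ hcard i)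
    rw [← ho] at hj
    rw [← hj]; exact hgn j
  rw [← h4, h5, h1, h2, sign_mul, sign_pos h3]
  rcases Int.units_eq_one_or (Equiv.Perm.sign e) with h | h <;> simp [h]

/-- For `x < y` the sorting sign of `x, y, τ` is a factor depending on `x` times a factor depending
on `y`. All three products of a Plücker relation thus carry the same sign, and it drops out. -/
theorem vandermonde_cons_cons {m : ℕ} (x y : ℝ) (τ : Fin m → ℝ) :
    (Matrix.vandermonde (Fin.cons x (Fin.cons y τ : Fin (m + 1) → ℝ) : Fin (m + 2) → ℝ)).det =
      (y - x) * (∏ i, (τ i - x)) * (∏ i, (τ i - y)) * (Matrix.vandermonde τ).det := by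
  rw [Matrix.det_vandermonde, Matrix.det_vandermonde, Fin.prod_univ_succ, Fin.prod_univ_succ]
  simp only [Fin.prod_Ioi_zero, Fin.prod_Ioi_succ, Fin.prod_univ_succ, Fin.cons_zero,
    Fin.cons_succ]
  ring

theorem IsDecomposable.isPlucker {r : ℕ} {v : FundRep n k} (hv : IsDecomposable r v) :
    IsPlucker r v := by
  intro T hT a b c d hab hbc hcd hd haT hbT hcT hdT
  have hsub : ∀ x y, x < n + 1 → y < n + 1 → insert x (insert y T) ⊆ Finset.range (n + 1) := by
    intro x y hx hy z hz
    rcases Finset.mem_insert.1 hz with rfl | hz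
    · exact Finset.mem_range.2 hx
    rcases Finset.mem_insert.1 hz with rfl | hz
    · exact Finset.mem_range.2 hy
    · exact hT hz
  have hcard : ∀ x y, x ≠ y → x ∉ T → y ∉ T → (insert x (insert y T)).card = T.card + 2 := by
    intro x y hxy hx hy
    rw [Finset.card_insert_of_notMem (by simp [hxy, hx]), Finset.card_insert_of_notMem hy]
  by_cases hk : T.card + 2 = k
  swap
  · have h0 : ∀ x y, x ≠ y → x < n + 1 → y < n + 1 → x ∉ T → y ∉ T →
        pc r v (insert x (insert y T)) = 0 := fun x y hxy hx hy hxT hyT =>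
      pc_of_card_ne r v (hsub x y hx hy) (by rwa [hcard x y hxy hxT hyT])
    rw [h0 a c, h0 a b, h0 a d] <;> first | assumption | omega | simp
  obtain ⟨m, hm⟩ : ∃ m, m = T.card := ⟨_, rfl⟩
  obtain rfl : k = m + 2 := by omega
  obtain ⟨N, hN⟩ := hv
  set τ := T.orderEmbOfFin hm.symm with hτ
  have hτT : ∀ i, τ i ∈ T := fun i => Finset.orderEmbOfFin_mem _ _ i
  have himg : Finset.univ.image τ = T := by
    apply Finset.coe_injective
    rw [Finset.coe_image, Finset.coe_univ, Set.image_univ, hτ, Finset.range_orderEmbOfFin]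
  let s : ℕ → ℂ := fun x => (SignType.sign (∏ i, ((τ i : ℝ) - x)) : ℂ)
  have hs : ∀ x, x ∉ T → s x ≠ 0 := by
    intro x hx
    have : ∏ i, ((τ i : ℝ) - x) ≠ 0 := Finset.prod_ne_zero_iff.2 fun i _ => sub_ne_zero.2 fun h =>
      hx (by rw [← Nat.cast_injective h]; exact hτT i)
    simp only [s]
    rcases this.lt_or_gt with h | h
    · simp [sign_neg h]
    · simp [sign_pos h]
  let D : ℕ → ℕ → ℂ := fun x y => (Matrix.of (Fin.cons (N x)
    (Fin.cons (N y) (fun i => N (τ i)) : Fin (m + 1) → _) : Fin (m + 2) → _)).det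
  have key : ∀ x y, x < y → x < n + 1 → y < n + 1 → x ∉ T → y ∉ T →
      pc r v (insert x (insert y T)) = s x * s y * D x y := by
    intro x y hxy hx hy hxT hyT
    let g : Fin (m + 2) → ℕ := Fin.cons x (Fin.cons y τ : Fin (m + 1) → ℕ)
    have hginj : Function.Injective g := by
      refine Fin.cons_injective_iff.2 ⟨?_, Fin.cons_injective_iff.2 ⟨?_, τ.injective⟩⟩
      · rintro ⟨i, hi⟩
        revert hi
        refine Fin.cases ?_ (fun i => ?_) i
        · simp only [Fin.cons_zero]; omega
        · simp only [Fin.cons_succ]; exact fun h => hxT (h ▸ hτT i)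
      · rintro ⟨i, hi⟩
        exact hyT (hi ▸ hτT i)
    have hgimg : Finset.univ.image g = insert x (insert y T) := by
      ext z
      simp only [Finset.mem_image, Finset.mem_univ, true_and, Finset.mem_insert, ← himg,
        Fin.exists_fin_succ, g, Fin.cons_zero, Fin.cons_succ, eq_comm]
    have hgn : ∀ i, g i < n + 1 := fun i => Finset.mem_range.1
      (hsub x y hx hy (hgimg ▸ Finset.mem_image_of_mem g (Finset.mem_univ i)))
    have h1 := pc_eq_sign_mul_det hN hginj hgn
    rw [hgimg] at h1
    have h2 : (fun i => ((g i : ℕ) : ℝ)) = (Fin.cons (x : ℝ)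
        (Fin.cons (y : ℝ) (fun i => (τ i : ℝ)) : Fin (m + 1) → ℝ) : Fin (m + 2) → ℝ) := by
      funext i
      refine Fin.cases ?_ (fun i => ?_) i
      · simp [g]
      · refine Fin.cases ?_ (fun i => ?_) i <;> simp [g]
    have h3 : (fun i => N (g i)) = (Fin.cons (N x)
        (Fin.cons (N y) (fun i => N (τ i)) : Fin (m + 1) → _) : Fin (m + 2) → _) := by
      funext i
      refine Fin.cases ?_ (fun i => ?_) i
      · simp [g]
      · refine Fin.cases ?_ (fun i => ?_) i <;> simp [g]
    rw [h1, h2, h3, vandermonde_cons_cons, sign_mul, sign_mul, sign_mul,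
      sign_pos (vandermonde_pos τ.strictMono),
      sign_pos (sub_pos.2 (Nat.cast_lt.2 hxy : (x : ℝ) < y))]
    simp [s, D]
  rw [key a c, key b d, key a b, key c d, key a d, key b c] <;> first | assumption | omega | skip
  have := det_exchange (fun i => N (τ i)) (N a) (N b) (N c) (N d)
  linear_combination s a * s b * s c * s d * this

/-- Rotating `a, b, c, d` cyclically preserves the product on the left and exchanges the two
products on the right; the coordinates are indexed by sets, so wrapping around costs no sign. -/
theorem IsPlucker.succ {r : ℕ} {v : FundRep n k} (hv : IsPlucker r v) : IsPlucker (r + 1) v := by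
  have hrot : ∀ x y, x < n + 1 → y < n + 1 → rot n x = rot n y → x = y := by
    intro x y hx hy h
    unfold rot at h
    split_ifs at h <;> omega
  intro T hT a b c d hab hbc hcd hd haT hbT hcT hdT
  have hT' : T.image (rot n) ⊆ Finset.range (n + 1) := by
    intro z hz
    obtain ⟨m, hm, rfl⟩ := Finset.mem_image.1 hz
    have := Finset.mem_range.1 (hT hm)
    rw [Finset.mem_range]
    unfold rot
    split_ifs <;> omega
  have hnot : ∀ x, x < n + 1 → x ∉ T → rot n x ∉ T.image (rot n) := by
    intro x hx hxT h
    obtain ⟨m, hm, h⟩ := Finset.mem_image.1 h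
    exact hxT (hrot _ _ (Finset.mem_range.1 (hT hm)) hx h ▸ hm)
  have hpc : ∀ x y, x < n + 1 → y < n + 1 → pc (r + 1) v (insert x (insert y T)) =
      pc r v (insert (rot n x) (insert (rot n y) (T.image (rot n)))) := by
    intro x y hx hy
    rw [pc_succ, Finset.image_insert, Finset.image_insert]
    intro z hz
    simp only [Finset.mem_insert] at hz
    rcases hz with rfl | rfl | hz
    · exact Finset.mem_range.2 hx
    · exact Finset.mem_range.2 hy
    · exact hT hz
  have hna := hnot a (by omega) haT
  have hnb := hnot b (by omega) hbT
  have hnc := hnot c (by omega) hcT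
  have hnd := hnot d (by omega) hdT
  rw [hpc a c, hpc b d, hpc a b, hpc c d, hpc a d, hpc b c] <;> try omega
  have ha : rot n a = a + 1 := if_neg (by omega)
  have hb : rot n b = b + 1 := if_neg (by omega)
  have hc : rot n c = c + 1 := if_neg (by omega)
  by_cases hdn : d = n
  · have hd' : rot n d = 0 := if_pos hdn
    rw [ha, hb, hc, hd']
    have := hv _ hT' 0 (a + 1) (b + 1) (c + 1) (by omega) (by omega) (by omega) (by omega)
      (hd' ▸ hnd) (ha ▸ hna) (hb ▸ hnb) (hc ▸ hnc)
    rw [Finset.insert_comm (b + 1) 0, Finset.insert_comm (c + 1) 0, Finset.insert_comm (a + 1) 0]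
    linear_combination this
  · have hd' : rot n d = d + 1 := if_neg (by omega)
    rw [ha, hb, hc, hd']
    exact hv _ hT' (a + 1) (b + 1) (c + 1) (d + 1) (by omega) (by omega) (by omega) (by omega)
      (ha ▸ hna) (hb ▸ hnb) (hc ▸ hnc) (hd' ▸ hnd)

theorem IsPlucker.all {r : ℕ} {v : FundRep n k} (hv : IsPlucker r v) (r' : ℕ) :
    IsPlucker r' v := by
  have h1 : ∀ m, IsPlucker (r + m) v := fun m => by
    induction m with
    | zero => exact hv
    | succ m ih => exact ih.succ
  have h2 : ∀ m r', IsPlucker (r' + m * (n + 1)) v → IsPlucker r' v := by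
    intro m
    induction m with
    | zero => intro r' h; simpa using h
    | succ m ih =>
      intro r' h
      refine ih r' ?_
      intro T hT a b c d hab hbc hcd hd haT hbT hcT hdT
      have := h T hT a b c d hab hbc hcd hd haT hbT hcT hdT
      rw [show r' + (m + 1) * (n + 1) = r' + m * (n + 1) + (n + 1) by ring] at this
      simpa only [pc_add_card] using this
  -- Base points only go up: from `r`, after `r' + r * n` steps, one reaches `r' + r * (n + 1)`,
  -- which is `r'` modulo the period.
  refine h2 r r' ?_
  have := h1 (r' + r * n)
  rwa [show r + (r' + r * n) = r' + r * (n + 1) by ring] at this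

theorem IsPlucker.smul {r : ℕ} {v : FundRep n k} (hv : IsPlucker r v) (c : ℂ) :
    IsPlucker r (c • v) := by
  intro T hT a b c' d hab hbc hcd hd haT hbT hcT hdT
  simp only [pc_smul]
  linear_combination c ^ 2 * hv T hT a b c' d hab hbc hcd hd haT hbT hcT hdT

end Plucker

/-! ### Vectors of words and their monomial coordinates -/

section WordVector

variable {n k : ℕ}

/-- The vector of the tableau `{r, r + 1, …, r + k - 1}`. -/
noncomputable def baseVec (n k r : ℕ) : FundRep n k :=
  tabVec n k ((Finset.range k).image (wn n r))

/-- Application of `m` operators `Y` with the consecutive letters `r + a, r + a + 1, …`. -/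
noncomputable def rowApply (r : ℕ) (x : ℕ → ℂ) (a : ℕ) : ℕ → FundRep n k → FundRep n k
  | 0, v => v
  | m + 1, v => opY n k (wn n r (a + m)) (x (a + m)) (rowApply r x a m v)

/-- The product of the last `l` blocks of a word, applied to the highest weight vector; the
variable `x l w` belongs to the letter `r + w`. -/
noncomputable def wordVec (n k r : ℕ) (x : ℕ → ℕ → ℂ) : ℕ → FundRep n k
  | 0 => baseVec n k r
  | l + 1 => rowApply r (x (l + 1)) (k - (l + 1)) (n + 1 - k) (wordVec n k r x l)

theorem prod_map_row (r : ℕ) (g : ℕ → Module.End ℂ (FundRep n k)) (x : ℕ → ℂ) (a b m : ℕ)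
    (hg : ∀ i < m, g (b + i) = opY n k (wn n r (a + i)) (x (a + i))) (u : FundRep n k) :
    ((List.Ico b (b + m)).reverse.map g).prod u = rowApply r x a m u := by
  induction m with
  | zero => simp [rowApply]
  | succ m ih =>
    rw [← add_assoc, List.Ico.succ_top (by omega), List.reverse_append, List.map_append,
      List.prod_append, Module.End.mul_apply, ih fun i hi => hg i (by omega)]
    simp [rowApply, hg m (by omega)]

theorem u1_eq_baseVec : u1 n k = baseVec n k 1 := by
  rw [u1, baseVec]
  congr 1
  ext i
  simp only [Finset.mem_image, Finset.mem_Icc, Finset.mem_range, wn]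
  constructor
  · rintro ⟨m, hm, rfl⟩
    exact ⟨m - 1, by omega, by congr 1; omega⟩
  · rintro ⟨m, hm, rfl⟩
    exact ⟨1 + m, by omega, rfl⟩

theorem v1_eq_wordVec (hkn : k ≤ n) (x : lat1 n k → ℂ) :
    v1 n k x = wordVec n k 1 (fun l w => at' x (l, w + 1)) k := by
  have key : ∀ K ≤ k, (((List.Ico 1 (K + 1)).reverse.flatMap fun l =>
      (List.Ico (k + 1 - l) (n + 2 - l)).reverse.map fun m => (l, m)).map fun p =>
        opY n k (letter n p) (at' x p)).prod (u1 n k) =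
      wordVec n k 1 (fun l w => at' x (l, w + 1)) K := by
    intro K hK
    induction K with
    | zero => simp [u1_eq_baseVec, wordVec]
    | succ K ih =>
      rw [List.Ico.succ_top (by omega), List.reverse_append, List.flatMap_append, List.map_append,
        List.prod_append, Module.End.mul_apply, ih (by omega), wordVec]
      simp only [List.reverse_cons, List.reverse_nil, List.nil_append, List.flatMap_cons,
        List.flatMap_nil, List.append_nil, List.map_map]
      rw [show n + 2 - (K + 1) = k + 1 - (K + 1) + (n + 1 - k) by omega]
      refine prod_map_row 1 _ _ _ _ _ (fun i _ => ?_) _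
      simp only [Function.comp_apply, letter, wn]
      rw [show k + 1 - (K + 1) + i = 1 + (k - (K + 1) + i) by omega,
        show 1 + (k - (K + 1) + i) = k - (K + 1) + i + 1 by omega]
  exact key k le_rfl

theorem u2_eq_baseVec (hk : 1 ≤ k) : u2 n k = baseVec n k 0 := by
  rw [u2, baseVec]
  congr 1
  ext i
  simp only [Finset.mem_insert, Finset.mem_image, Finset.mem_Icc, Finset.mem_range, wn, zero_add]
  constructor
  · rintro (rfl | ⟨m, hm, rfl⟩)
    · exact ⟨0, hk, rfl⟩
    · exact ⟨m, by omega, rfl⟩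
  · rintro ⟨m, hm, rfl⟩
    rcases Nat.eq_zero_or_pos m with rfl | h
    · exact .inl rfl
    · exact .inr ⟨m, by omega, rfl⟩

theorem v2_eq_wordVec (hk : 1 ≤ k) (hkn : k ≤ n) (x : lat2 n k → ℂ) :
    v2 n k x = wordVec n k 0 (fun l w => at' x (l, w)) k := by
  have key : ∀ K ≤ k, (((List.Ico 1 (K + 1)).reverse.flatMap fun l =>
      (List.Ico (k - l) (n + 1 - l)).reverse.map fun m => (l, m)).map fun p =>
        opY n k (letter n p) (at' x p)).prod (u2 n k) =
      wordVec n k 0 (fun l w => at' x (l, w)) K := by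
    intro K hK
    induction K with
    | zero => simp [u2_eq_baseVec hk, wordVec]
    | succ K ih =>
      rw [List.Ico.succ_top (by omega), List.reverse_append, List.flatMap_append, List.map_append,
        List.prod_append, Module.End.mul_apply, ih (by omega), wordVec]
      simp only [List.reverse_cons, List.reverse_nil, List.nil_append, List.flatMap_cons,
        List.flatMap_nil, List.append_nil, List.map_map]
      rw [show n + 1 - (K + 1) = k - (K + 1) + (n + 1 - k) by omega]
      refine prod_map_row 0 _ _ _ _ _ (fun i _ => ?_) _
      simp only [Function.comp_apply, letter, wn, zero_add]
  exact key k le_rfl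

theorem pc_baseVec (hkn : k ≤ n) (r : ℕ) {s : Finset ℕ} (hs : s ⊆ Finset.range (n + 1)) :
    pc r (baseVec n k r) s = if s = Finset.range k then 1 else 0 := by
  have hk : Finset.range k ⊆ Finset.range (n + 1) := Finset.range_subset_range.2 (by omega)
  by_cases hc : s.card = k
  · rw [pc, cf, dif_pos (by rwa [card_wn_image hs]), baseVec, tabVec]
    simp only [wn_image_injOn hs hk]
  · rw [pc_of_card_ne r _ hs hc, if_neg fun h => hc (by rw [h, Finset.card_range])]

theorem isDecomposable_baseVec (hkn : k ≤ n) (r : ℕ) : IsDecomposable r (baseVec n k r) := by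
  refine ⟨fun m j => if m = j then 1 else 0, fun o ho hon => ?_⟩
  have hs : Finset.univ.image o ⊆ Finset.range (n + 1) := by
    intro m hm
    obtain ⟨i, -, rfl⟩ := Finset.mem_image.1 hm
    exact Finset.mem_range.2 (hon i)
  rw [pc_baseVec hkn r hs]
  by_cases h : ∀ i, o i < k
  · have ho' : ∀ i, o i = i := by
      let e : Fin k → Fin k := fun i => ⟨o i, h i⟩
      have he : StrictMono e := fun i j hij => ho hij
      intro i
      have := he.le_apply (x := i)
      have h2 : (e : Fin k → Fin k) = id := by
        have hinj := he.injective
        let E : Fin k ≃o Fin k := StrictMono.orderIsoOfSurjective e he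
          (Finite.injective_iff_surjective.1 hinj)
        have : E = OrderIso.refl _ := Subsingleton.elim _ _
        funext j
        exact congrArg (fun F : Fin k ≃o Fin k => F j) this
      exact congrArg Fin.val (congrFun h2 i)
    rw [if_pos]
    · have : (Matrix.of fun i j : Fin k => if o i = (j : ℕ) then (1 : ℂ) else 0) = 1 := by
        ext i j
        simp [ho', Matrix.one_apply, Fin.ext_iff]
      rw [this, Matrix.det_one]
    · ext m
      simp only [Finset.mem_image, Finset.mem_univ, true_and, Finset.mem_range, ho']
      exact ⟨fun ⟨i, hi⟩ => hi ▸ i.2, fun hm => ⟨⟨m, hm⟩, rfl⟩⟩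
  · push Not at h
    obtain ⟨i, hi⟩ := h
    rw [if_neg, Matrix.det_eq_zero_of_row_eq_zero i]
    · intro j
      have : o i ≠ j := by have := j.2; omega
      simp [this]
    · intro h
      have : o i ∈ Finset.range k := h ▸ Finset.mem_image_of_mem o (Finset.mem_univ i)
      have := Finset.mem_range.1 this
      omega

theorem isDecomposable_rowApply {r : ℕ} {x : ℕ → ℂ} (hx : ∀ w, x w ≠ 0) {a m : ℕ}
    (ham : a + m ≤ n) {v : FundRep n k} (hv : IsDecomposable r v) :
    IsDecomposable r (rowApply r x a m v) := by
  induction m with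
  | zero => exact hv
  | succ m ih => exact (ih (by omega)).opY (by omega) (hx _)

theorem isDecomposable_wordVec (hkn : k ≤ n) {r : ℕ} {x : ℕ → ℕ → ℂ} (hx : ∀ l w, x l w ≠ 0)
    {l : ℕ} (hl : l ≤ k) : IsDecomposable r (wordVec n k r x l) := by
  induction l with
  | zero => exact isDecomposable_baseVec hkn r
  | succ l ih => exact isDecomposable_rowApply (hx _) (by omega) (ih (by omega))

/-- A class of functions containing `0`, `1`, the variables of a word and their inverses, and closed
under sums and products contains the coordinates of the corresponding vector. -/
theorem wordVec_induction {P : Type} {C : ((P → ℂ) → ℂ) → Prop} (hkn : k ≤ n) (r : ℕ)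
    (x : (P → ℂ) → ℕ → ℕ → ℂ) (hx : ∀ t ∈ torus P, ∀ l w, x t l w ≠ 0)
    (hcongr : ∀ f g, (∀ t ∈ torus P, f t = g t) → C g → C f)
    (h0 : C fun _ => 0) (h1 : C fun _ => 1)
    (hadd : ∀ f g, C f → C g → C fun t => f t + g t)
    (hmul : ∀ f g, C f → C g → C fun t => f t * g t)
    (hvar : ∀ l w, C fun t => x t l w) (hinv : ∀ l w, C fun t => (x t l w)⁻¹)
    {l : ℕ} (hl : l ≤ k) {s : Finset ℕ} (hs : s ⊆ Finset.range (n + 1)) :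
    C fun t => pc r (wordVec n k r (x t) l) s := by
  induction l generalizing s with
  | zero =>
    simp only [wordVec, pc_baseVec hkn r hs]
    split_ifs
    exacts [h1, h0]
  | succ l ih =>
    simp only [wordVec]
    have key : ∀ m ≤ n + 1 - k, ∀ s ⊆ Finset.range (n + 1),
        C fun t => pc r (rowApply r (x t (l + 1)) (k - (l + 1)) m (wordVec n k r (x t) l)) s := by
      intro m
      induction m with
      | zero => intro _ s hs; exact ih (by omega) hs
      | succ m ihm =>
        intro hm s hs
        have hlow : insert (k - (l + 1) + m) (s.erase (k - (l + 1) + m + 1)) ⊆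
            Finset.range (n + 1) := by
          intro z hz
          rcases Finset.mem_insert.1 hz with rfl | hz
          · rw [Finset.mem_range]; omega
          · exact hs (Finset.mem_of_mem_erase hz)
        refine hcongr _ _ (fun t ht => pc_opY (w := k - (l + 1) + m) (by omega) (hx t ht _ _) _ hs)
          ?_
        split_ifs
        · exact hmul _ _ (hvar _ _) (ihm (by omega) s hs)
        · exact hadd _ _ (hmul _ _ (hinv _ _) (ihm (by omega) s hs)) (ihm (by omega) _ hlow)
        · exact ihm (by omega) s hs
    exact key _ le_rfl s hs

/-- The letters `q, …, q + m - 1` never move an entry below `q`, and they carry the entry `q` at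
most as far as `q + m`. -/
theorem pc_rowApply_support {r : ℕ} {x : ℕ → ℂ} (hx : ∀ w, x w ≠ 0) {q m : ℕ} (hqm : q + m ≤ n)
    {v : FundRep n k} (hv : ∀ s ⊆ Finset.range (n + 1), pc r v s ≠ 0 → Finset.range (q + 1) ⊆ s)
    {s : Finset ℕ} (hs : s ⊆ Finset.range (n + 1)) (h : pc r (rowApply r x q m v) s ≠ 0) :
    Finset.range q ⊆ s ∧ ∃ e ∈ s, q ≤ e ∧ e ≤ q + m := by
  induction m generalizing s with
  | zero =>
    have := hv s hs h
    exact ⟨fun z hz => this (Finset.mem_range.2 ((Finset.mem_range.1 hz).trans q.lt_succ_self)),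
      q, this (Finset.self_mem_range_succ q), le_rfl, le_rfl⟩
  | succ m ih =>
    by_cases h0 : pc r (rowApply r x q m v) s = 0
    swap
    · obtain ⟨h1, e, he, h2, h3⟩ := ih (by omega) hs h0
      exact ⟨h1, e, he, h2, by omega⟩
    rw [rowApply, pc_opY (by omega) (hx _) _ hs, h0] at h
    split_ifs at h with h1 h2
    · simp at h
    · rw [mul_zero, zero_add] at h
      have hlow : insert (q + m) (s.erase (q + m + 1)) ⊆ Finset.range (n + 1) := by
        intro z hz
        rcases Finset.mem_insert.1 hz with rfl | hz
        · rw [Finset.mem_range]; omega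
        · exact hs (Finset.mem_of_mem_erase hz)
      refine ⟨fun z hz => ?_, q + m + 1, h2.2, by omega, by omega⟩
      have h3 := (ih (by omega) hlow h).1 hz
      rw [Finset.mem_insert, Finset.mem_erase] at h3
      rw [Finset.mem_range] at hz
      rcases h3 with h3 | h3
      · omega
      · exact h3.2
    · simp at h

theorem wordVec_support (hkn : k ≤ n) {r : ℕ} {x : ℕ → ℕ → ℂ} (hx : ∀ l w, x l w ≠ 0) {l : ℕ}
    (hl : l ≤ k) {s : Finset ℕ} (hs : s ⊆ Finset.range (n + 1))
    (h : pc r (wordVec n k r x l) s ≠ 0) : Finset.range (k - l) ⊆ s := by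
  induction l generalizing s with
  | zero =>
    rw [wordVec, pc_baseVec hkn r hs] at h
    split_ifs at h with h1
    · rw [h1]; simp
    · simp at h
  | succ l ih =>
    refine (pc_rowApply_support (hx _) (by omega) (fun s hs h => ?_) hs h).1
    rw [show k - (l + 1) + 1 = k - l by omega]
    exact ih (by omega) hs h

/-- The set `{0, …, q - 1} ∪ {a, …, a + j - 1} ∪ {n + 1 - k + q + j, …, n}`. -/
def clusterSet (n k q j a : ℕ) : Finset ℕ :=
  Finset.range q ∪ Finset.Ico a (a + j) ∪ Finset.Ico (n + 1 - k + q + j) (n + 1)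

theorem mem_clusterSet {q j a m : ℕ} : m ∈ clusterSet n k q j a ↔
    m < q ∨ (a ≤ m ∧ m < a + j) ∨ (n + 1 - k + q + j ≤ m ∧ m < n + 1) := by
  simp [clusterSet]

theorem pc_rowApply_clusterSet (hkn : k ≤ n) {r : ℕ} {x : ℕ → ℂ} (hx : ∀ w, x w ≠ 0)
    {q j a : ℕ} (hq : q < k) (hx1 : ∀ w, n + 1 - k + q ≤ w → x w = 1) (hj : 1 ≤ j)
    (hjk : q + j ≤ k) (hqa : q ≤ a) (ha : a ≤ n + 1 - k + q) {v : FundRep n k}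
    (hv : ∀ s ⊆ Finset.range (n + 1), pc r v s ≠ 0 → Finset.range (q + 1) ⊆ s) :
    pc r (rowApply r x q (n + 1 - k) v) (clusterSet n k q j a) =
      x (a + j - 1) * pc r v (clusterSet n k (q + 1) (j - 1) (a + 1)) := by
  have hsub : clusterSet n k q j a ⊆ Finset.range (n + 1) := by
    intro z hz
    rw [mem_clusterSet] at hz
    rw [Finset.mem_range]
    omega
  -- If `q + m` is the first entry of `s` from `q` on, the entry `q` was carried all the way there,
  -- with coefficient `1` at every step.
  have first : ∀ m, q + m ≤ n → ∀ s ⊆ Finset.range (n + 1), q + m ∈ s →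
      (∀ e, q ≤ e → e < q + m → e ∉ s) →
      pc r (rowApply r x q m v) s = pc r v (insert q (s.erase (q + m))) := by
    intro m
    induction m with
    | zero => intro _ s _ h _; rw [add_zero] at h ⊢; rw [Finset.insert_erase h]; rfl
    | succ m ih =>
      intro hm s hs hmem hnot
      have h1 : q + m ∉ s := hnot _ (by omega) (by omega)
      have h0 : pc r (rowApply r x q m v) s = 0 := by
        by_contra h
        obtain ⟨-, e, he, h2, h3⟩ := pc_rowApply_support hx (by omega) hv hs h
        exact hnot e h2 (by omega) he
      rw [rowApply, pc_opY (by omega) (hx _) _ hs, if_neg (fun h => h1 h.1), if_pos ⟨h1, hmem⟩, h0,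
        mul_zero, zero_add, ih (by omega), Finset.erase_insert
          fun h => h1 (Finset.mem_of_mem_erase h)]
      · rfl
      · intro z hz
        rcases Finset.mem_insert.1 hz with rfl | hz
        · rw [Finset.mem_range]; omega
        · exact hs (Finset.mem_of_mem_erase hz)
      · exact Finset.mem_insert_self _ _
      · intro e h2 h3 h4
        rcases Finset.mem_insert.1 h4 with rfl | h4
        · omega
        · exact hnot e h2 (by omega) (Finset.mem_of_mem_erase h4)
  -- The letters from `a` on leave the block in place; only the one at its right end, `a + j - 1`,
  -- contributes a factor.
  have second : ∀ m, q + m ≤ n + 1 - k + q → a ≤ q + m →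
      pc r (rowApply r x q m v) (clusterSet n k q j a) =
        (if a + j - 1 < q + m then x (a + j - 1) else 1) *
          pc r v (insert q ((clusterSet n k q j a).erase a)) := by
    intro m
    induction m with
    | zero =>
      intro _ h
      obtain rfl : a = q := by omega
      rw [if_neg (by omega), one_mul]
      exact first 0 (by omega) _ hsub (mem_clusterSet.2 (by omega))
        fun e _ _ => by omega
    | succ m ih =>
      intro hm ham
      rcases Nat.lt_or_ge (q + m) a with h | h
      · obtain rfl : a = q + (m + 1) := by omega
        rw [if_neg (by omega), one_mul]
        exact first (m + 1) (by omega) _ hsub (mem_clusterSet.2 (by omega))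
          fun e _ _ => by rw [mem_clusterSet]; omega
      · rw [rowApply, pc_opY (by omega) (hx _) _ hsub, ih (by omega) h]
        simp only [mem_clusterSet]
        rcases lt_trichotomy (q + m) (a + j - 1) with h1 | h1 | h1
        · rw [if_neg (by omega), if_neg (by omega), if_neg (by omega), if_neg (by omega)]
        · rw [if_pos (by omega), if_neg (by omega), if_pos (by omega), h1, one_mul]
        · rw [if_neg (by omega), if_neg (by omega), if_pos (by omega), if_pos (by omega)]
  rw [second (n + 1 - k) (by omega) (by omega)]
  congr 1
  -- When the block ends beyond the letters of the row there is no factor, in accordance with the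
  -- convention `hx1` for such variables.
  · split_ifs with h
    · rfl
    · exact (hx1 _ (by omega)).symm
  · congr 1
    ext z
    rw [Finset.mem_insert, Finset.mem_erase, mem_clusterSet, mem_clusterSet]
    omega

/-- The cluster coordinates of the vector of a word are monomials. -/
theorem pc_wordVec_clusterSet (hkn : k ≤ n) {r : ℕ} {x : ℕ → ℕ → ℂ} (hx : ∀ l w, x l w ≠ 0)
    (hx1 : ∀ l w, n < l + w → x l w = 1) {l q j a : ℕ} (hl : q + l = k) (hjl : j ≤ l)
    (hqa : q ≤ a) (ha : a ≤ n + 1 - k + q) :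
    pc r (wordVec n k r x l) (clusterSet n k q j a) =
      ∏ i ∈ Finset.Ioc (l - j) l, x i (a + j - 1) := by
  have step : ∀ l q j a, q + (l + 1) = k → 1 ≤ j → j ≤ l + 1 → q ≤ a → a ≤ n + 1 - k + q →
      pc r (wordVec n k r x (l + 1)) (clusterSet n k q j a) =
        x (l + 1) (a + j - 1) *
          pc r (wordVec n k r x l) (clusterSet n k (q + 1) (j - 1) (a + 1)) := by
    intro l q j a hl hj hjl hqa ha
    obtain rfl : q = k - (l + 1) := by omega
    refine pc_rowApply_clusterSet hkn (hx _) (by omega) (fun w hw => hx1 _ _ (by omega)) hj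
      (by omega) hqa ha fun s hs h => ?_
    have := wordVec_support hkn hx (by omega) hs h
    rwa [show k - (l + 1) + 1 = k - l by omega]
  have zero : ∀ l q a, q + l = k →
      pc r (wordVec n k r x l) (clusterSet n k q 0 a) = 1 := by
    intro l
    induction l with
    | zero =>
      intro q a hl
      obtain rfl : q = k := by omega
      have h : clusterSet n q q 0 a = Finset.range q := by
        ext z
        rw [mem_clusterSet, Finset.mem_range]
        omega
      rw [wordVec, h, pc_baseVec hkn r (Finset.range_subset_range.2 (by omega)), if_pos rfl]
    | succ l ih =>
      intro q a hl
      -- The first element of the tail counts as a block of length one; its variable lies outside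
      -- the lattice and equals `1`.
      have h : clusterSet n k q 0 a = clusterSet n k q 1 (n + 1 - k + q) := by
        ext z
        rw [mem_clusterSet, mem_clusterSet]
        omega
      rw [h, step l q 1 _ hl le_rfl (by omega) (by omega) le_rfl, hx1 _ _ (by omega), one_mul]
      exact ih _ _ (by omega)
  induction l generalizing q j a with
  | zero =>
    obtain rfl : j = 0 := by omega
    rw [zero 0 q a hl]
    simp
  | succ l ih =>
    rcases Nat.eq_zero_or_pos j with rfl | hj
    · rw [zero _ q a hl]
      simp
    · rw [step l q j a hl hj hjl hqa ha, ih (by omega) (by omega) (by omega) (by omega),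
        show a + 1 + (j - 1) - 1 = a + j - 1 by omega,
        show l - (j - 1) = l + 1 - j by omega, ← Finset.insert_Ioc_right_eq_Ioc_add_one (by omega),
        Finset.prod_insert (by simp)]

end WordVector

/-! ### Reaching every coordinate from the cluster without subtraction -/

section Cluster

variable {n k : ℕ}

/-- Let `d` be the largest missing element of `s`. If the entries below `d` form an interval, `s` is
a cluster set. Otherwise take their minimum `a`, their maximum `c` and a gap `x` between: in the
exchange relation for `a < x < c < d`, each of the other five sets loses `a` or `c` below `d`, so
its entries there lie in a shorter window. -/
theorem cluster_induction (hkn : k ≤ n) {C : Finset ℕ → Prop}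
    (hcl : ∀ j ≤ k, ∀ a ≤ n + 1 - k, C (clusterSet n k 0 j a))
    (hstep : ∀ T ⊆ Finset.range (n + 1), ∀ a b c d, a < b → b < c → c < d → d < n + 1 →
      a ∉ T → b ∉ T → c ∉ T → d ∉ T → C (insert b (insert d T)) → C (insert a (insert b T)) →
      C (insert c (insert d T)) → C (insert a (insert d T)) → C (insert b (insert c T)) →
      C (insert a (insert c T)))
    {s : Finset ℕ} (hs : s ⊆ Finset.range (n + 1)) (hsk : s.card = k) : C s := by
  -- Induction on the length `m` of a window starting at `lo` that contains all entries below `D`,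
  -- where `D` bounds the largest missing element.
  have main : ∀ m lo D, ∀ s ⊆ Finset.range (n + 1), s.card = k →
      (∀ p ∈ s, p < D → lo ≤ p ∧ p < lo + m) → (∀ q, D < q → q ≤ n → q ∈ s) → C s := by
    intro m
    induction m with
    | zero => ?_
    | succ m ih => ?_
    all_goals
      intro lo D s hs hsk h1 h2
      have hne : (Finset.range (n + 1) \ s).Nonempty := by
        rw [Finset.sdiff_nonempty]
        intro h
        have := Finset.card_le_card h
        rw [Finset.card_range] at this
        omega
      obtain ⟨d, hd⟩ : ∃ d, d = (Finset.range (n + 1) \ s).max' hne := ⟨_, rfl⟩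
      have hdmem : d < n + 1 ∧ d ∉ s := by
        have := Finset.max'_mem _ hne
        rwa [← hd, Finset.mem_sdiff, Finset.mem_range] at this
      have hdmax : ∀ q, d < q → q ≤ n → q ∈ s := by
        intro q hq hqn
        by_contra h
        have := Finset.le_max' (Finset.range (n + 1) \ s) q (Finset.mem_sdiff.2 ⟨Finset.mem_range.2 (by omega), h⟩)
        omega
      have hdD : d ≤ D := by
        by_contra h
        exact hdmem.2 (h2 d (by omega) (by omega))
      have hempty : (∀ p ∈ s, d < p) → C s := by
        intro h
        have hs' : s = Finset.Ico (d + 1) (n + 1) := by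
          ext p
          rw [Finset.mem_Ico]
          refine ⟨fun hp => ⟨h p hp, Finset.mem_range.1 (hs hp)⟩, fun hp => hdmax p hp.1 ?_⟩
          omega
        have hc : n - d = k := by
          rw [← hsk, hs', Nat.card_Ico]; omega
        have : s = clusterSet n k 0 0 0 := by
          ext p
          rw [hs', Finset.mem_Ico, mem_clusterSet]
          omega
        rw [this]
        exact hcl _ (by omega) _ (by omega)
    · refine hempty fun p hp => ?_
      by_contra h
      have : p ≠ d := fun h' => hdmem.2 (h' ▸ hp)
      have := h1 p hp (by omega)
      omega
    by_cases hS : ∀ p ∈ s, d < p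
    · exact hempty hS
    have hSne : (s.filter (· < d)).Nonempty := by
      push Not at hS
      obtain ⟨p, hp, hpd⟩ := hS
      have : p ≠ d := fun h' => hdmem.2 (h' ▸ hp)
      exact ⟨p, Finset.mem_filter.2 ⟨hp, by omega⟩⟩
    obtain ⟨a, ha⟩ : ∃ a, a = (s.filter (· < d)).min' hSne := ⟨_, rfl⟩
    obtain ⟨c, hc⟩ : ∃ c, c = (s.filter (· < d)).max' hSne := ⟨_, rfl⟩
    have hamem := Finset.min'_mem _ hSne
    have hcmem := Finset.max'_mem _ hSne
    rw [← ha, Finset.mem_filter] at hamem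
    rw [← hc, Finset.mem_filter] at hcmem
    have hale : ∀ p ∈ s, p < d → a ≤ p := fun p hp hpd =>
      ha ▸ Finset.min'_le _ _ (Finset.mem_filter.2 ⟨hp, hpd⟩)
    have hcge : ∀ p ∈ s, p < d → p ≤ c := fun p hp hpd =>
      hc ▸ Finset.le_max' _ _ (Finset.mem_filter.2 ⟨hp, hpd⟩)
    by_cases hint : ∀ x, a < x → x < c → x ∈ s
    · have hac := hale c hcmem.1 hcmem.2
      have hs' : s = Finset.Ico a (c + 1) ∪ Finset.Ico (d + 1) (n + 1) := by
        ext p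
        rw [Finset.mem_union, Finset.mem_Ico, Finset.mem_Ico]
        constructor
        · intro hp
          have : p ≠ d := fun h' => hdmem.2 (h' ▸ hp)
          have h3 := Finset.mem_range.1 (hs hp)
          rcases Nat.lt_or_ge p d with h | h
          · have := hale p hp h
            have := hcge p hp h
            omega
          · omega
        · rintro (⟨h3, h4⟩ | ⟨h3, h4⟩)
          · rcases Nat.eq_or_lt_of_le h3 with rfl | h5
            · exact hamem.1
            rcases Nat.eq_or_lt_of_le (Nat.le_of_lt_succ h4) with rfl | h6
            · exact hcmem.1
            exact hint p h5 h6
          · exact hdmax p (by omega) (by omega)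
      have hcard : (c + 1 - a) + (n - d) = k := by
        rw [← hsk, hs', Finset.card_union_of_disjoint, Nat.card_Ico, Nat.card_Ico]
        · omega
        · rw [Finset.disjoint_left]
          intro p
          rw [Finset.mem_Ico, Finset.mem_Ico]
          omega
      have : s = clusterSet n k 0 (c + 1 - a) a := by
        ext p
        rw [hs', Finset.mem_union, Finset.mem_Ico, Finset.mem_Ico, mem_clusterSet]
        omega
      rw [this]
      exact hcl _ (by omega) _ (by omega)
    push Not at hint
    obtain ⟨x, hax, hxc, hxs⟩ := hint
    have hT : ∀ p, p ∈ (s.erase a).erase c ↔ p ≠ c ∧ p ≠ a ∧ p ∈ s := fun p => by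
      rw [Finset.mem_erase, Finset.mem_erase]
    have hsT : s = insert a (insert c ((s.erase a).erase c)) := by
      rw [Finset.insert_erase (Finset.mem_erase.2 ⟨by omega, hcmem.1⟩),
        Finset.insert_erase hamem.1]
    have hTcard : ((s.erase a).erase c).card + 2 = k := by
      rw [Finset.card_erase_of_mem (Finset.mem_erase.2 ⟨by omega, hcmem.1⟩),
        Finset.card_erase_of_mem hamem.1, hsk]
      have h3 : 1 < s.card := Finset.one_lt_card.2 ⟨a, hamem.1, c, hcmem.1, by omega⟩
      omega
    have hlo := h1 a hamem.1 (by omega)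
    have hhi := h1 c hcmem.1 (by omega)
    -- The induction hypothesis is used with bound `d`; the new window starts at `lo` if the maximum
    -- was dropped and at `lo + 1` if the minimum was.
    have child : ∀ y z lo', y ≠ z → y ∉ (s.erase a).erase c → z ∉ (s.erase a).erase c →
        y < n + 1 → z < n + 1 → (y < d → lo' ≤ y ∧ y < lo' + m) →
        (z < d → lo' ≤ z ∧ z < lo' + m) →
        (∀ p, a < p → p < c → lo' ≤ p ∧ p < lo' + m) →
        C (insert y (insert z ((s.erase a).erase c))) := by
      intro y z lo' hyz hy hz hyn hzn hylo hzlo hlo'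
      refine ih lo' d _ ?_ ?_ ?_ ?_
      · intro p hp
        rw [Finset.mem_insert, Finset.mem_insert, hT] at hp
        rcases hp with rfl | rfl | hp
        · exact Finset.mem_range.2 hyn
        · exact Finset.mem_range.2 hzn
        · exact hs hp.2.2
      · rw [Finset.card_insert_of_notMem (by simp only [Finset.mem_insert]; tauto),
          Finset.card_insert_of_notMem hz]
        exact hTcard
      · intro p hp hpd
        rw [Finset.mem_insert, Finset.mem_insert, hT] at hp
        rcases hp with rfl | rfl | hp
        · exact hylo hpd
        · exact hzlo hpd
        · have := hale p hp.2.2 hpd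
          have := hcge p hp.2.2 hpd
          exact hlo' p (by omega) (by omega)
      · intro q hq hqn
        rw [Finset.mem_insert, Finset.mem_insert, hT]
        have := hdmax q hq hqn
        exact .inr (.inr ⟨by omega, by omega, this⟩)
    have haT : a ∉ (s.erase a).erase c := by rw [hT]; tauto
    have hcT : c ∉ (s.erase a).erase c := by rw [hT]; tauto
    have hxT : x ∉ (s.erase a).erase c := by rw [hT]; tauto
    have hdT : d ∉ (s.erase a).erase c := by rw [hT]; tauto
    rw [hsT]
    refine hstep _ (fun p hp => hs ((hT p).1 hp).2.2) a x c d hax hxc hcmem.2 hdmem.1 haT hxT hcT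
      hdT ?_ ?_ ?_ ?_ ?_
    · exact child x d lo (by omega) hxT hdT (by omega) (by omega) (by omega) (by omega)
        (by omega)
    · exact child a x lo (by omega) haT hxT (by omega) (by omega) (by omega) (by omega)
        (by omega)
    · exact child c d (lo + 1) (by omega) hcT hdT (by omega) (by omega) (by omega) (by omega)
        (by omega)
    · exact child a d lo (by omega) haT hdT (by omega) (by omega) (by omega) (by omega)
        (by omega)
    · exact child x c (lo + 1) (by omega) hxT hcT (by omega) (by omega) (by omega) (by omega)
        (by omega)
  refine main (n + 1) 0 (n + 1) s hs hsk (fun p hp _ => ?_) (fun q _ _ => by omega)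
  have := Finset.mem_range.1 (hs hp)
  omega

theorem pc_pos_of_cluster (hkn : k ≤ n) {r : ℕ} {v : FundRep n k} (hv : IsPlucker r v)
    (hcl : ∀ j ≤ k, ∀ a ≤ n + 1 - k, 0 < pc r v (clusterSet n k 0 j a)) {s : Finset ℕ}
    (hs : s ⊆ Finset.range (n + 1)) (hsk : s.card = k) : 0 < pc r v s := by
  refine cluster_induction hkn (C := fun s => 0 < pc r v s) hcl ?_ hs hsk
  intro T hT a b c d hab hbc hcd hd ha hb hc hd' h1 h2 h3 h4 h5
  have h := hv T hT a b c d hab hbc hcd hd ha hb hc hd'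
  rw [eq_div_of_mul_eq h1.ne' h]
  positivity

/-- Positivity has to be carried along with equality, since each exchange step divides by a
coordinate reached before. -/
theorem eq_of_cluster (hkn : k ≤ n) {r : ℕ} {v w : FundRep n k} (hv : IsPlucker r v)
    (hw : IsPlucker r w) (hcl : ∀ j ≤ k, ∀ a ≤ n + 1 - k, 0 < pc r v (clusterSet n k 0 j a))
    (hvw : ∀ j ≤ k, ∀ a ≤ n + 1 - k,
      pc r v (clusterSet n k 0 j a) = pc r w (clusterSet n k 0 j a)) : v = w := by
  refine pc_ext r fun s hs hsk => ?_
  refine (cluster_induction hkn (C := fun s => 0 < pc r v s ∧ pc r v s = pc r w s)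
    (fun j hj a ha => ⟨hcl j hj a ha, hvw j hj a ha⟩) ?_ hs hsk).2
  intro T hT a b c d hab hbc hcd hd ha hb hc hd' h1 h2 h3 h4 h5
  have h := hv T hT a b c d hab hbc hcd hd ha hb hc hd'
  have h' := hw T hT a b c d hab hbc hcd hd ha hb hc hd'
  rw [← h1.2, ← h2.2, ← h3.2, ← h4.2, ← h5.2] at h'
  rw [eq_div_of_mul_eq h1.1.ne' h, eq_div_of_mul_eq h1.1.ne' h']
  have := h1.1
  have := h2.1
  have := h3.1
  have := h4.1
  have := h5.1
  exact ⟨by positivity, rfl⟩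

end Cluster

/-! ### Words, their variables and their charts -/

section Word

variable {n k : ℕ}

/-- `L` is the set of positions of the variables of a word whose letters are counted from `r`. -/
structure IsWord (n k r : ℕ) (L : Finset (ℕ × ℕ)) : Prop where
  mem_iff : ∀ l w, (l, w + r) ∈ L ↔ 1 ≤ l ∧ l ≤ k ∧ k ≤ l + w ∧ l + w ≤ n
  le : ∀ p ∈ L, r ≤ p.2

theorem isWord_lat1 : IsWord n k 1 (lat1 n k) := by
  constructor
  · intro l w
    simp only [lat1, Finset.mem_filter, Finset.mem_product, Finset.mem_Icc, Finset.mem_range]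
    omega
  · rintro ⟨l, m⟩ h
    simp only [lat1, Finset.mem_filter, Finset.mem_product, Finset.mem_Icc, Finset.mem_range] at h
    show 1 ≤ m
    omega

theorem isWord_lat2 : IsWord n k 0 (lat2 n k) := by
  constructor
  · intro l w
    simp only [lat2, Finset.mem_filter, Finset.mem_product, Finset.mem_Icc, Finset.mem_range]
    omega
  · rintro ⟨l, m⟩ _
    exact Nat.zero_le _

theorem IsWord.exists_eq {r : ℕ} {L : Finset (ℕ × ℕ)} (hL : IsWord n k r L) {p : ℕ × ℕ}
    (hp : p ∈ L) : ∃ w, p = (p.1, w + r) ∧ 1 ≤ p.1 ∧ p.1 ≤ k ∧ k ≤ p.1 + w ∧ p.1 + w ≤ n := by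
  have h := hL.le p hp
  have h1 : p = (p.1, p.2 - r + r) := by rw [Nat.sub_add_cancel h]
  refine ⟨p.2 - r, h1, (hL.mem_iff _ _).1 (h1 ▸ hp)⟩

variable {r : ℕ} {L : Finset (ℕ × ℕ)}

/-- The vector of the word, with variables `x`. -/
noncomputable def vec (n k r : ℕ) (x : L → ℂ) : FundRep n k :=
  wordVec n k r (fun l w => at' x (l, w + r)) k

theorem v1_eq_vec (hkn : k ≤ n) : v1 n k = vec n k 1 := funext fun x => v1_eq_wordVec hkn x

theorem v2_eq_vec (hk : 1 ≤ k) (hkn : k ≤ n) : v2 n k = vec n k 0 :=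
  funext fun x => v2_eq_wordVec hk hkn x

theorem at'_of_notMem (x : L → ℂ) {p : ℕ × ℕ} (hp : p ∉ L) : at' x p = 1 := dif_neg hp

theorem at'_of_mem (x : L → ℂ) {p : ℕ × ℕ} (hp : p ∈ L) : at' x p = x ⟨p, hp⟩ := dif_pos hp

theorem at'_ne_zero {x : L → ℂ} (hx : x ∈ torus L) (p : ℕ × ℕ) : at' x p ≠ 0 := by
  unfold at'
  split_ifs
  exacts [hx _, one_ne_zero]

theorem at'_pos {x : L → ℂ} (hx : x ∈ posPoints L) (p : ℕ × ℕ) : 0 < at' x p := by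
  unfold at'
  split_ifs
  exacts [hx _, one_pos]

theorem isSF_at' (p : ℕ × ℕ) : IsSF fun x : L → ℂ => at' x p := by
  unfold at'
  split_ifs with h
  exacts [IsSF.var _, IsSF.one]

theorem IsWord.at'_eq_one (hL : IsWord n k r L) (x : L → ℂ) {l w : ℕ}
    (h : ¬(1 ≤ l ∧ l ≤ k ∧ k ≤ l + w ∧ l + w ≤ n)) : at' x (l, w + r) = 1 :=
  at'_of_notMem x fun h' => h ((hL.mem_iff l w).1 h')

theorem IsWord.isPlucker_vec (_ : IsWord n k r L) (hkn : k ≤ n) {x : L → ℂ} (hx : x ∈ torus L)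
    (r' : ℕ) : IsPlucker r' (vec n k r x) :=
  (isDecomposable_wordVec hkn (fun _ _ => at'_ne_zero hx _) le_rfl).isPlucker.all r'

theorem IsWord.pc_vec_clusterSet (hL : IsWord n k r L) (hkn : k ≤ n) {x : L → ℂ}
    (hx : x ∈ torus L) {j a : ℕ} (hj : j ≤ k) (ha : a ≤ n + 1 - k) :
    pc r (vec n k r x) (clusterSet n k 0 j a) =
      ∏ i ∈ Finset.Ioc (k - j) k, at' x (i, a + j - 1 + r) :=
  pc_wordVec_clusterSet hkn (fun _ _ => at'_ne_zero hx _)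
    (fun l w h => hL.at'_eq_one x (by omega)) (by omega) hj (by omega) (by omega)

theorem IsWord.pc_vec_pos (hL : IsWord n k r L) (hkn : k ≤ n) {x : L → ℂ}
    (hx : x ∈ posPoints L) (r' : ℕ) {s : Finset ℕ} (hs : s ⊆ Finset.range (n + 1))
    (hsk : s.card = k) : 0 < pc r' (vec n k r x) s := by
  have key : ∀ s ⊆ Finset.range (n + 1), s.card = k → 0 < pc r (vec n k r x) s := by
    intro s hs hsk
    refine pc_pos_of_cluster hkn
      (hL.isPlucker_vec hkn (posPoints_subset_torus hx) r) (fun j hj a ha => ?_) hs hsk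
    rw [hL.pc_vec_clusterSet hkn (posPoints_subset_torus hx) hj ha]
    exact Finset.prod_pos fun i _ => at'_pos hx _
  obtain ⟨t, ht, hts⟩ := exists_wn_image (r := r) (s.image (wn n r'))
  have hcard : t.card = k := by
    rw [← card_wn_image (r := r) ht, hts, card_wn_image hs, hsk]
  have := key t ht hcard
  rwa [pc, hts] at this

theorem IsWord.cf_vec_pos (hL : IsWord n k r L) (hkn : k ≤ n) {x : L → ℂ}
    (hx : x ∈ posPoints L) {s : Finset (Fin (n + 1))} (hsk : s.card = k) :
    0 < cf (vec n k r x) s := by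
  obtain ⟨t, ht, rfl⟩ := exists_wn_image (r := 0) s
  exact hL.pc_vec_pos hkn hx 0 ht (by rwa [card_wn_image ht] at hsk)

/-- The variables of a word as quotients of cluster coordinates. -/
theorem IsWord.var_eq_div (hL : IsWord n k r L) (hkn : k ≤ n) {x : L → ℂ} (hx : x ∈ torus L)
    {l w : ℕ} (h : (l, w + r) ∈ L) : x ⟨(l, w + r), h⟩ =
      pc r (vec n k r x) (clusterSet n k 0 (k + 1 - l) (l + w - k)) /
        pc r (vec n k r x) (clusterSet n k 0 (k - l) (l + w - k + 1)) := by
  have h' := (hL.mem_iff l w).1 h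
  rw [hL.pc_vec_clusterSet hkn hx (by omega) (by omega),
    hL.pc_vec_clusterSet hkn hx (by omega) (by omega),
    show l + w - k + (k + 1 - l) - 1 = w by omega, show l + w - k + 1 + (k - l) - 1 = w by omega,
    show k - (k + 1 - l) = l - 1 by omega, show k - (k - l) = l by omega]
  have : Finset.Ioc (l - 1) k = insert l (Finset.Ioc l k) := by
    ext i
    simp only [Finset.mem_Ioc, Finset.mem_insert]
    omega
  rw [this, Finset.prod_insert (by simp), at'_of_mem x h, mul_div_cancel_right₀]
  exact Finset.prod_ne_zero_iff.2 fun i _ => at'_ne_zero hx _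

theorem IsWord.pc_vec_clusterSet_ne_zero (hL : IsWord n k r L) (hkn : k ≤ n) {x : L → ℂ}
    (hx : x ∈ torus L) {j a : ℕ} (hj : j ≤ k) (ha : a ≤ n + 1 - k) :
    pc r (vec n k r x) (clusterSet n k 0 j a) ≠ 0 := by
  rw [hL.pc_vec_clusterSet hkn hx hj ha]
  exact Finset.prod_ne_zero_iff.2 fun i _ => at'_ne_zero hx _

theorem pc_mem_polyFun (r : ℕ) (s : Finset ℕ) :
    (fun v : FundRep n k => pc r v s) ∈ polyFun (FundRep n k) := by
  unfold pc cf
  split_ifs with h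
  · exact coord_mem_polyFun _
  · exact const_mem_polyFun 0

theorem IsRegVia.congr {U V : Type} [AddCommGroup V] [Module ℂ V] {S : Set U} {η : U → V}
    {f g : U → ℂ} (hg : IsRegVia S η g) (h : ∀ u ∈ S, f u = g u) : IsRegVia S η f := by
  obtain ⟨a, ha, b, hb, hab⟩ := hg
  exact ⟨a, ha, b, hb, fun u hu => by rw [h u hu]; exact hab u hu⟩

theorem IsSF.congr {P : Type} {f g : (P → ℂ) → ℂ} (hg : IsSF g) (h : ∀ t ∈ torus P, f t = g t) :
    IsSF f := by
  obtain ⟨p, q, hp, hq, hpq⟩ := hg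
  exact ⟨p, q, hp, hq, fun t ht h0 => by rw [h t ht]; exact hpq t ht h0⟩

theorem exists_pc_eq (r : ℕ) (s : Tab n k) :
    ∃ t ⊆ Finset.range (n + 1), t.card = k ∧ ∀ v : FundRep n k, v s = pc r v t := by
  obtain ⟨t, ht, hts⟩ := exists_wn_image (r := r) s.1
  refine ⟨t, ht, ?_, fun v => ?_⟩
  · rw [← card_wn_image (r := r) ht, hts, s.2]
  · rw [pc, hts, cf_val]

/-- Coordinates are built from the variables and their inverses by sums and products, and each
variable is a quotient of two cluster coordinates, which are monomials and vanish nowhere on the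
torus. -/
theorem IsWord.isChart (hL : IsWord n k r L) (hkn : k ≤ n) :
    IsChart (vec n k r '' torus L) (vec n k r (L := L)) := by
  refine ⟨rfl, ?_, ?_⟩
  · rintro ⟨p, hp⟩
    obtain ⟨w, hw, h1, h2, h3, h4⟩ := hL.exists_eq hp
    generalize p.1 = l at *
    subst hw
    exact ⟨_, pc_mem_polyFun r _, _, pc_mem_polyFun r _, fun t ht =>
      ⟨hL.pc_vec_clusterSet_ne_zero hkn ht (by omega) (by omega), hL.var_eq_div hkn ht hp⟩⟩
  · refine IsRegVia.dual_pi fun s => ?_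
    obtain ⟨t, ht, -, hts⟩ := exists_pc_eq (n := n) (k := k) r s
    refine IsRegVia.congr ?_ fun x _ => hts (vec n k r x)
    have hvar : ∀ l w, IsRegVia (torus L) id fun x : L → ℂ => at' x (l, w + r) := by
      intro l w
      unfold at'
      split_ifs with h
      · exact IsRegVia.of_polyFun (coord_mem_polyFun _)
      · exact IsRegVia.const 1
    have hinv : ∀ l w, IsRegVia (torus L) id fun x : L → ℂ => (at' x (l, w + r))⁻¹ := by
      intro l w
      unfold at'
      split_ifs with h
      · exact ⟨fun _ => 1, const_mem_polyFun 1, _, coord_mem_polyFun ⟨_, h⟩, fun x hx =>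
          ⟨hx _, (one_div _).symm⟩⟩
      · exact IsRegVia.const _
    exact wordVec_induction (C := IsRegVia (torus L) id) hkn r (fun x l w => at' x (l, w + r))
      (fun x hx l w => at'_ne_zero hx _) (fun f g h hg => hg.congr h) (IsRegVia.const 0)
      (IsRegVia.const 1) (fun _ _ => IsRegVia.add) (fun _ _ => IsRegVia.mul) hvar hinv le_rfl ht

/-- Being zero or subtraction-free survives every step of building the vector; the value at the
point with all variables `1` is positive, which excludes zero. -/
theorem IsWord.isSF_pc_vec (hL : IsWord n k r L) (hkn : k ≤ n) (r' : ℕ) {s : Finset ℕ}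
    (hs : s ⊆ Finset.range (n + 1)) (hsk : s.card = k) :
    IsSF fun x : L → ℂ => pc r' (vec n k r x) s := by
  obtain ⟨t, ht, hts⟩ := exists_wn_image (r := r) (s.image (wn n r'))
  have hcard : t.card = k := by
    rw [← card_wn_image (r := r) ht, hts, card_wn_image hs, hsk]
  have key := wordVec_induction (P := L)
    (C := fun f => (∀ x ∈ torus L, f x = 0) ∨ IsSF f) hkn r (fun x l w => at' x (l, w + r))
    (fun x hx l w => at'_ne_zero hx _) ?_ (.inl fun _ _ => rfl) (.inr IsSF.one) ?_ ?_
    (fun l w => .inr (isSF_at' _)) (fun l w => .inr (isSF_at' _).inv) le_rfl ht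
  · have h : (fun x : L → ℂ => pc r' (vec n k r x) s) = fun x => pc r (vec n k r x) t := by
      simp only [pc, hts]
    rw [h]
    refine key.resolve_left fun h0 => ?_
    exact (hL.pc_vec_pos hkn one_mem_posPoints r ht hcard).ne'
      (h0 1 (posPoints_subset_torus one_mem_posPoints))
  · rintro f g h (hg | hg)
    · exact .inl fun x hx => (h x hx).trans (hg x hx)
    · exact .inr (hg.congr h)
  · rintro f g (hf | hf) (hg | hg)
    · exact .inl fun x hx => by simp [hf x hx, hg x hx]
    · exact .inr (hg.congr fun x hx => by rw [hf x hx, zero_add])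
    · exact .inr (hf.congr fun x hx => by rw [hg x hx, add_zero])
    · exact .inr (hf.add hg)
  · rintro f g (hf | hf) (hg | hg)
    · exact .inl fun x hx => by simp [hf x hx]
    · exact .inl fun x hx => by simp [hf x hx]
    · exact .inl fun x hx => by simp [hg x hx]
    · exact .inr (hf.mul hg)

theorem IsWord.prod_eq (hL : IsWord n k r L) (g : ℕ × ℕ → ℂ) (hg : ∀ p ∉ L, g p = 1) :
    ∏ q : L, g q.1 = ∏ w ∈ Finset.range (n + 1), ∏ l ∈ Finset.Ioc 0 k, g (l, w + r) := by
  rw [Finset.prod_coe_sort L g, ← Finset.prod_product',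
    ← Finset.prod_image (s := Finset.range (n + 1) ×ˢ Finset.Ioc 0 k)
      (g := fun z : ℕ × ℕ => (z.2, z.1 + r)) (f := g)]
  · refine Finset.prod_subset (fun p hp => ?_) fun p _ hp => hg p hp
    obtain ⟨w, hw, h⟩ := hL.exists_eq hp
    refine Finset.mem_image.2 ⟨(w, p.1), ?_, hw.symm⟩
    simp only [Finset.mem_product, Finset.mem_range, Finset.mem_Ioc]
    omega
  · rintro ⟨a, b⟩ _ ⟨a', b'⟩ _ h
    simp only [Prod.mk.injEq] at h ⊢
    omega

end Word

/-! ### Cyclic intervals -/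

section CyclicInterval

variable {n k : ℕ}

/-- The cyclic interval `{i - k + 1, …, i}`. -/
def cycInt (n k : ℕ) (i : Fin (n + 1)) : Finset (Fin (n + 1)) :=
  Finset.univ.filter fun e => (i - e).val < k

theorem mem_cycInt {i e : Fin (n + 1)} : e ∈ cycInt n k i ↔ (i - e).val < k := by
  simp [cycInt]

theorem wn_sub_val {r w e : ℕ} (hw : w < n + 1) (he : e < n + 1) :
    (wn n r w - wn n r e).val = if e ≤ w then w - e else w + (n + 1) - e := by
  have key : ∀ d < n + 1, wn n r (e + d) - wn n r e = Fin.ofNat (n + 1) d := by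
    intro d _
    rw [sub_eq_iff_eq_add]
    apply Fin.ext
    simp only [wn, Fin.ofNat, Fin.val_add]
    rw [Nat.mod_add_mod, Nat.add_mod_mod]
    congr 1
    omega
  split_ifs with h
  · have := key (w - e) (by omega)
    rw [show e + (w - e) = w by omega] at this
    rw [this]
    exact Nat.mod_eq_of_lt (by omega)
  · have := key (w + (n + 1) - e) (by omega)
    rw [show e + (w + (n + 1) - e) = w + (n + 1) by omega, ← wn_shift, wn_add_card] at this
    rw [this]
    exact Nat.mod_eq_of_lt (by omega)

/-- For `w + 1 < k` the interval wraps around and its beginning forms the tail. Cyclic intervals are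
thus cluster sets for every base point at once. -/
theorem cycInt_wn (hkn : k ≤ n) {r w : ℕ} (hw : w < n + 1) : cycInt n k (wn n r w) =
    (clusterSet n k 0 (min k (w + 1)) (w + 1 - k)).image (wn n r) := by
  ext i
  obtain ⟨e, he, rfl⟩ := wn_surj n r i
  rw [wn_mem_image he, mem_cycInt, wn_sub_val hw he, mem_clusterSet]
  · split_ifs <;> omega
  · intro z hz
    rw [mem_clusterSet] at hz
    rw [Finset.mem_range]
    omega

theorem val_sub_add_one {i j : Fin (n + 1)} (h : i ≠ j) :
    (j - (i + 1)).val + 1 = (j - i).val := by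
  obtain ⟨c, rfl⟩ : ∃ c, i = wn n c 0 :=
    ⟨i.val, Fin.ext (by simp [wn, Fin.ofNat, Nat.mod_eq_of_lt i.2])⟩
  obtain ⟨e, he, rfl⟩ := wn_surj n c j
  have h0 : e ≠ 0 := by
    rintro rfl
    exact h rfl
  rw [wn_add_one, wn_sub_val he (by omega), if_pos (by omega), wn_sub_val he (by omega),
    if_pos (by omega)]
  omega

theorem val_sub_add_one_self (i : Fin (n + 1)) : (i - (i + 1)).val = n := by
  obtain ⟨c, rfl⟩ : ∃ c, i = wn n c 0 :=
    ⟨i.val, Fin.ext (by simp [wn, Fin.ofNat, Nat.mod_eq_of_lt i.2])⟩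
  rcases Nat.eq_zero_or_pos n with rfl | hn
  · omega
  rw [wn_add_one, wn_sub_val (by omega) (by omega), if_neg (by omega)]
  omega

end CyclicInterval

/-! ### Raising operators and their commutation with `opY` -/

section Raising

variable {n k : ℕ}

/-- The Chevalley generator `e_i`, replacing the entry `i + 1` of a tableau by `i`. -/
noncomputable def chevE (i : Fin (n + 1)) (v : FundRep n k) : FundRep n k := fun t =>
  if i ∈ t.1 ∧ i + 1 ∉ t.1 then cf v (insert (i + 1) (t.1.erase i)) else 0

theorem cf_chevE (i : Fin (n + 1)) (v : FundRep n k) (s : Finset (Fin (n + 1))) :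
    cf (chevE i v) s = if i ∈ s ∧ i + 1 ∉ s then cf v (insert (i + 1) (s.erase i)) else 0 := by
  by_cases hs : s.card = k
  · rw [show cf (chevE i v) s = chevE i v ⟨s, hs⟩ from dif_pos hs]
    rfl
  · rw [cf_of_card_ne _ hs]
    split_ifs with h
    · rw [cf_of_card_ne]
      rwa [card_insert_erase h.1 h.2]
    · rfl

theorem chevE_add (i : Fin (n + 1)) (v w : FundRep n k) :
    chevE i (v + w) = chevE i v + chevE i w := by
  refine cf_ext fun s => ?_
  rw [cf_add]
  simp only [cf_chevE, cf_add]
  split_ifs <;> simp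

theorem chevE_smul (i : Fin (n + 1)) (c : ℂ) (v : FundRep n k) :
    chevE i (c • v) = c • chevE i v := by
  refine cf_ext fun s => ?_
  rw [cf_smul]
  simp only [cf_chevE, cf_smul]
  split_ifs <;> simp

/-- `exp (a e_i)`. -/
noncomputable def expE (i : Fin (n + 1)) (a : ℂ) (v : FundRep n k) : FundRep n k :=
  v + a • chevE i v

theorem cf_expE (i : Fin (n + 1)) (a : ℂ) (v : FundRep n k) (s : Finset (Fin (n + 1))) :
    cf (expE i a v) s = cf v s +
      if i ∈ s ∧ i + 1 ∉ s then a * cf v (insert (i + 1) (s.erase i)) else 0 := by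
  rw [expE, cf_add, cf_smul, cf_chevE]
  split_ifs <;> simp

theorem add_one_ne (hn : 1 ≤ n) (i : Fin (n + 1)) : i + 1 ≠ i := by
  intro h
  have := val_sub_add_one_self i
  rw [h, sub_self] at this
  simp at this
  omega

theorem add_two_ne (hn : 2 ≤ n) (i : Fin (n + 1)) : i + 1 + 1 ≠ i := by
  intro h
  have h1 := val_sub_add_one_self i
  have h2 := val_sub_add_one (i := i + 1) (j := i) (add_one_ne (by omega) i)
  rw [h, sub_self, h1] at h2
  simp at h2
  omega

/-- A relation in `SL₂`; tableaux containing both or neither of `i`, `i + 1` are fixed by every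
factor. -/
theorem expE_opY_self (hn : 1 ≤ n) (i : Fin (n + 1)) {a c : ℂ} (hc : c ≠ 0) (hca : c + a ≠ 0)
    (v : FundRep n k) :
    expE i a (opY n k i c v) = opY n k i (c + a) (expE i (a / (c * (c + a))) v) := by
  have hi := add_one_ne hn i
  refine cf_ext fun s => ?_
  rw [cf_expE, cf_opY i hc, cf_opY i hca]
  simp only [cf_expE, cf_opY i hc]
  by_cases h1 : i ∈ s <;> by_cases h2 : i + 1 ∈ s
  · simp [h1, h2]
  · simp [h1, h2, hi.symm]
    field_simp
    ring
  · simp [h1, h2, hi, hi.symm]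
    field_simp
    ring
  · simp [h1, h2]

/-- For `i ≠ j` the generators `e_i` and `f_j` commute, so only the torus part of `opY` acts,
rescaling the parameter by the weight of `e_i`. -/
theorem expE_opY_of_ne (hn : 2 ≤ n) {i j : Fin (n + 1)} (hij : i ≠ j) (a : ℂ) {c : ℂ}
    (hc : c ≠ 0) (v : FundRep n k) :
    expE i a (opY n k j c v) = opY n k j c (expE i (a * c ^ (-cartan n j i)) v) := by
  have hi := add_one_ne (by omega) i
  have hj := add_one_ne (by omega) j
  have hi2 := add_two_ne hn i
  have hj2 := add_two_ne hn j
  have hij1 : i + 1 ≠ j + 1 := fun h => hij (add_right_cancel h)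
  by_cases hadj : j = i + 1 ∨ i = j + 1
  · have hcart : c ^ (-cartan n j i) = c := by
      rw [cartan, if_neg hij.symm, if_pos hadj, neg_neg, zpow_one]
    rw [hcart]
    refine cf_ext fun s => ?_
    rw [cf_expE, cf_opY j hc, cf_opY j hc]
    simp only [cf_expE, cf_opY j hc]
    rcases hadj with rfl | rfl
    · by_cases h1 : i ∈ s <;> by_cases h2 : i + 1 ∈ s <;> by_cases h3 : i + 1 + 1 ∈ s <;>
        simp [h1, h2, h3, hi, hi.symm, hi2, hi2.symm, hj, hj.symm] <;> field_simp <;> ring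
    · by_cases h1 : j ∈ s <;> by_cases h2 : j + 1 ∈ s <;> by_cases h3 : j + 1 + 1 ∈ s <;>
        simp [h1, h2, h3, hi, hi.symm, hj2, hj2.symm, hj, hj.symm] <;> field_simp <;> ring
  · have hcart : c ^ (-cartan n j i) = 1 := by
      rw [cartan, if_neg hij.symm, if_neg hadj, neg_zero, zpow_zero]
    rw [hcart, mul_one]
    push Not at hadj
    obtain ⟨hA, hB⟩ := hadj
    refine cf_ext fun s => ?_
    rw [cf_expE, cf_opY j hc, cf_opY j hc]
    simp only [cf_expE, cf_opY j hc]
    have hset : insert (i + 1) ((insert j (s.erase (j + 1))).erase i) =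
        insert j ((insert (i + 1) (s.erase i)).erase (j + 1)) := by
      ext z
      simp only [Finset.mem_insert, Finset.mem_erase]
      grind
    by_cases h1 : i ∈ s <;> by_cases h2 : i + 1 ∈ s <;> by_cases h3 : j ∈ s <;>
      by_cases h4 : j + 1 ∈ s <;>
      simp [h1, h2, h3, h4, hset, hij, hij.symm, hA, hB, Ne.symm hA, Ne.symm hB, hij1,
        hij1.symm] <;> ring

/-- The base tableau is highest for all letters except the one wrapping around `r`. Base point `1`
therefore governs `e_1, …, e_n` and base point `0` governs `e_0, …, e_{n-1}`. -/
theorem chevE_baseVec (hkn : k ≤ n) {r w : ℕ} (hw : w < n) :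
    chevE (wn n r w) (baseVec n k r) = 0 := by
  refine cf_ext fun s => ?_
  obtain ⟨t, ht, rfl⟩ := exists_wn_image (r := r) s
  have h1 := wn_mem_image (n := n) (r := r) (m := w) (by omega) ht
  have h2 := wn_mem_image (n := n) (r := r) (m := w + 1) (by omega) ht
  rw [cf_chevE, wn_add_one]
  simp only [h1, h2]
  rw [← wn_image_erase (by omega) ht, ← Finset.image_insert]
  have hz : cf (0 : FundRep n k) (t.image (wn n r)) = 0 := by
    unfold cf; split_ifs <;> rfl
  rw [hz]
  split_ifs with h
  · change pc r (baseVec n k r) (insert (w + 1) (t.erase w)) = 0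
    rw [pc_baseVec hkn, if_neg]
    · intro h3
      have h4 : w + 1 ∈ Finset.range k := h3 ▸ Finset.mem_insert_self _ _
      have h5 : w ∈ insert (w + 1) (t.erase w) := by
        rw [h3]
        rw [Finset.mem_range] at h4 ⊢
        omega
      rw [Finset.mem_insert, Finset.mem_erase] at h5
      rcases h5 with h5 | h5
      · omega
      · exact h5.1 rfl
    · intro z hz
      rcases Finset.mem_insert.1 hz with rfl | hz
      · rw [Finset.mem_range]; omega
      · exact ht (Finset.mem_of_mem_erase hz)
  · rfl

end Raising

/-! ### Pushing one-parameter groups through a word -/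

section WordAction

variable {n k : ℕ}

/-- Moving `exp (a e_i)` through a product of operators `Y`. -/
theorem expE_prod_opY (hn : 2 ≤ n) (i : Fin (n + 1)) {ι : Type*} (lett : ι → Fin (n + 1))
    {c c' mono : ι → ℂ} (hc : ∀ p, c p ≠ 0) (hc' : ∀ p, c' p ≠ 0) {τ : ℂ}
    {u : FundRep n k} (hu : ∀ a, expE i a u = u) (W : List ι) (N Pf : List ι → ℂ)
    (hPf : ∀ A p, Pf (A ++ [p]) = Pf A * c p ^ cartan n (lett p) i)
    (hPf0 : ∀ A, Pf A ≠ 0) (hN0 : ∀ A B, W = A ++ B → N A ≠ 0)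
    (hN : ∀ A p B, W = A ++ p :: B → N (A ++ [p]) = N A + if lett p = i then τ / mono p else 0)
    (hmono : ∀ A p B, W = A ++ p :: B → mono p = Pf A * c p)
    (hcN : ∀ A p B, W = A ++ p :: B → c' p = c p * (N (A ++ [p]) / N A)) :
    ∀ B A, W = A ++ B →
      expE i (τ / (N A * Pf A)) ((B.map fun p => opY n k (lett p) (c p)).prod u) =
        (B.map fun p => opY n k (lett p) (c' p)).prod u := by
  -- `A` is the part of the word already crossed and `B` the part still ahead; `τ / (N A * Pf A)` is
  -- the parameter reached so far. At the end of the word the vector `u` absorbs it.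
  intro B
  induction B with
  | nil => intro A _; simpa using hu _
  | cons p B ih =>
    intro A hA
    have hA' : W = A ++ [p] ++ B := by simpa using hA
    have hNA := hN0 A _ hA
    have hNA' := hN0 _ _ hA'
    have hPA := hPf0 A
    have h0 := hc p
    have hcp := hcN A p B hA
    rw [List.map_cons, List.map_cons, List.prod_cons, List.prod_cons, Module.End.mul_apply,
      Module.End.mul_apply, ← ih _ hA']
    by_cases hp : lett p = i
    · have hNp := hN A p B hA
      rw [if_pos hp, hmono A p B hA] at hNp
      have hsum : c p + τ / (N A * Pf A) = c' p := by
        rw [hcp, hNp]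
        field_simp
      rw [hp, expE_opY_self (by omega) i h0 (by rw [hsum]; exact hc' p), hsum, hPf, hp]
      congr 2
      rw [hcp, cartan, if_pos rfl]
      have : c p ^ (2 : ℤ) = c p * c p := by rw [zpow_ofNat, sq]
      rw [this]
      field_simp
    · have hNp := hN A p B hA
      rw [if_neg hp, add_zero] at hNp
      have hcc : c' p = c p := by
        rw [hcp, hNp, div_self hNA, mul_one]
      rw [expE_opY_of_ne hn (Ne.symm hp) _ h0, hcc, hNp, hPf]
      congr 2
      rw [zpow_neg]
      have := zpow_ne_zero (cartan n (lett p) i) h0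
      field_simp

/-- A telescoping product: it computes by how much `e_i^c` changes the product of the variables. -/
theorem prod_ratio {ι : Type*} (W : List ι) (N : List ι → ℂ) (ρ : ι → ℂ)
    (hN0 : ∀ A B, W = A ++ B → N A ≠ 0)
    (hρ : ∀ A p B, W = A ++ p :: B → ρ p = N (A ++ [p]) / N A) :
    ∀ B A, W = A ++ B → (B.map ρ).prod = N W / N A := by
  intro B
  induction B with
  | nil =>
    intro A hA
    rw [List.append_nil] at hA
    rw [hA, List.map_nil, List.prod_nil, div_self (hN0 A [] (by simpa using hA))]
  | cons p B ih =>
    intro A hA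
    have hA' : W = A ++ [p] ++ B := by simpa using hA
    rw [List.map_cons, List.prod_cons, ih _ hA', hρ A p B hA]
    have := hN0 _ _ hA
    have := hN0 _ _ hA'
    field_simp

end WordAction

/-! ### Words as sorted lists of positions -/

section SortedList

variable {L : Finset (ℕ × ℕ)}

theorem list_map_prod_eq {A : List (ℕ × ℕ)} (hA : A.Nodup) (hAL : ∀ p ∈ A, p ∈ L)
    (f : ℕ × ℕ → ℂ) : (A.map f).prod = ∏ m : L with m.1 ∈ A, f m.1 := by
  rw [Finset.prod_filter, Finset.prod_coe_sort L fun m => if m ∈ A then f m else 1,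
    ← Finset.prod_filter, ← List.prod_toFinset f hA]
  refine Finset.prod_congr ?_ fun _ _ => rfl
  ext p
  simp only [List.mem_toFinset, Finset.mem_filter]
  exact ⟨fun h => ⟨hAL p h, h⟩, fun h => h.2⟩

theorem not_before_self (p : ℕ × ℕ) : ¬ Before p p := by
  unfold Before; omega

theorem Before.asymm {p q : ℕ × ℕ} (h : Before p q) : ¬ Before q p := by
  unfold Before at *; omega

theorem before_iff_mem {W A B : List (ℕ × ℕ)} {p : ℕ × ℕ} (hW : W.Pairwise Before)
    (h : W = A ++ p :: B) {q : ℕ × ℕ} (hq : q ∈ W) : Before q p ↔ q ∈ A := by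
  subst h
  rw [List.pairwise_append, List.pairwise_cons] at hW
  constructor
  · intro hqp
    rcases List.mem_append.1 hq with h | h
    · exact h
    rcases List.mem_cons.1 h with rfl | h
    · exact absurd hqp (not_before_self _)
    · exact absurd hqp (hW.2.1.1 q h).asymm
  · intro hqA
    exact hW.2.2 q hqA p (by simp)

theorem not_before_iff_mem {W A B : List (ℕ × ℕ)} {p : ℕ × ℕ} (hW : W.Pairwise Before)
    (h : W = A ++ p :: B) {q : ℕ × ℕ} (hq : q ∈ W) : ¬ Before p q ↔ q ∈ A ++ [p] := by
  subst h
  rw [List.pairwise_append, List.pairwise_cons] at hW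
  constructor
  · intro hqp
    rcases List.mem_append.1 hq with h | h
    · exact List.mem_append_left _ h
    rcases List.mem_cons.1 h with rfl | h
    · simp
    · exact absurd (hW.2.1.1 q h) hqp
  · intro hqA
    rcases List.mem_append.1 hqA with h | h
    · exact (hW.2.2 q h p (by simp)).asymm
    · rw [List.mem_singleton.1 h]
      exact not_before_self _

theorem nodup_of_pairwise_before {W : List (ℕ × ℕ)} (hW : W.Pairwise Before) : W.Nodup :=
  hW.imp fun h => by rintro rfl; exact not_before_self _ h

end SortedList

/-! ### The crystal structure expressed by coordinates of vectors -/

section CrystalOnVectors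

variable {n k : ℕ}

/-- The coordinate of weight extremal for `i`. -/
noncomputable def dC (i : Fin (n + 1)) (v : FundRep n k) : ℂ := cf v (cycInt n k i)

/-- The coordinate obtained from `dC i` by replacing `i` by `i + 1`. -/
noncomputable def aC (i : Fin (n + 1)) (v : FundRep n k) : ℂ :=
  cf v (insert (i + 1) ((cycInt n k i).erase i))

/-- The action `e_i^c` in terms of vectors. -/
noncomputable def actC (i : Fin (n + 1)) (c : ℂ) (v : FundRep n k) : FundRep n k :=
  expE i ((c - 1) * dC i v / aC i v) v

/-- On the vector of a word `dC j` is the product of all variables with letter `j`, so this is the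
weight function of the word. -/
noncomputable def gammaC (i : Fin (n + 1)) (v : FundRep n k) : ℂ :=
  ∏ j, dC j v ^ cartan n j i

noncomputable def epsC (i : Fin (n + 1)) (v : FundRep n k) : ℂ := aC i v / dC i v

theorem self_mem_cycInt (hk : 1 ≤ k) (i : Fin (n + 1)) : i ∈ cycInt n k i := by
  rw [mem_cycInt, sub_self]
  exact hk

theorem add_one_notMem_cycInt (hkn : k ≤ n) (i : Fin (n + 1)) : i + 1 ∉ cycInt n k i := by
  rw [mem_cycInt, val_sub_add_one_self]
  omega

/-- A cyclic interval has a single right end. Consequently `expE i` changes `dC i` and no other `dC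
j`. -/
theorem mem_cycInt_and_add_one (hk : 1 ≤ k) (hkn : k ≤ n) {i j : Fin (n + 1)} :
    (i ∈ cycInt n k j ∧ i + 1 ∉ cycInt n k j) ↔ i = j := by
  constructor
  · rintro ⟨h1, h2⟩
    by_contra h
    have := val_sub_add_one h
    rw [mem_cycInt] at h1 h2
    omega
  · rintro rfl
    exact ⟨self_mem_cycInt hk i, add_one_notMem_cycInt hkn i⟩

theorem dC_expE_self (hk : 1 ≤ k) (hkn : k ≤ n) (i : Fin (n + 1)) (a : ℂ) (v : FundRep n k) :
    dC i (expE i a v) = dC i v + a * aC i v := by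
  rw [dC, cf_expE, if_pos ((mem_cycInt_and_add_one hk hkn).2 rfl)]
  rfl

theorem dC_expE_of_ne (hk : 1 ≤ k) (hkn : k ≤ n) {i j : Fin (n + 1)} (hij : i ≠ j) (a : ℂ)
    (v : FundRep n k) : dC j (expE i a v) = dC j v := by
  rw [dC, cf_expE, if_neg (mt (mem_cycInt_and_add_one hk hkn).1 hij), add_zero]
  rfl

end CrystalOnVectors

/-! ### The crystal formulas of a word as weighted sums -/

section WordFormula

variable {L : Finset (ℕ × ℕ)} {n : ℕ}

/-- The weighted sum of the reciprocals of the `i`-monomials. -/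
noncomputable def weightedSum (n : ℕ) (i : Fin (n + 1)) (x : L → ℂ) (f : ℕ × ℕ → ℂ) : ℂ :=
  ∑ m : L with letter n m.1 = i, f m.1 / wordMono n i x m

theorem wordEps_eq (i : Fin (n + 1)) (x : L → ℂ) :
    wordEps n i x = weightedSum n i x fun _ => 1 := rfl

/-- The denominator gives weight `t` to the positions before `p`, the numerator also to `p` itself.
Along the word these are consecutive members of one sequence, so the ratios telescope. -/
theorem wordE_apply (i : Fin (n + 1)) (t : ℂ) (x : L → ℂ) (p : L) :
    wordE n i t x p = x p * ((weightedSum n i x fun m => if Before p.1 m then 1 else t) /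
      (weightedSum n i x fun m => if Before m p.1 then t else 1)) := by
  unfold wordE weightedSum
  simp only [Finset.sum_filter, ite_and, ← Finset.sum_add_distrib]
  congr 2
  · refine Finset.sum_congr rfl fun m _ => ?_
    split_ifs <;> simp_all
  · refine Finset.sum_congr rfl fun m _ => ?_
    split_ifs <;> simp_all

theorem isSF_wordMono {P : Type} (i : Fin (n + 1)) {x : (P → ℂ) → L → ℂ} (hx : IsSFMap x) (m : L) :
    IsSF fun t => wordMono n i (x t) m :=
  (IsSF.prod _ fun q _ => (hx q).zpow _).mul (hx m)

theorem isSF_weightedSum {P : Type} {i : Fin (n + 1)} (hi : ∃ m : L, letter n m.1 = i)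
    {x : (P → ℂ) → L → ℂ} (hx : IsSFMap x) {f : (P → ℂ) → ℕ × ℕ → ℂ}
    (hf : ∀ m, IsSF fun t => f t m) : IsSF fun t => weightedSum n i (x t) (f t) := by
  obtain ⟨m, hm⟩ := hi
  exact IsSF.sum ⟨m, by simpa using hm⟩ fun q _ => (hf _).div (isSF_wordMono i hx q)

theorem isSFMap_wordE {P : Type} {i : Fin (n + 1)} (hi : ∃ m : L, letter n m.1 = i)
    {x : (P → ℂ) → L → ℂ} (hx : IsSFMap x) {c : (P → ℂ) → ℂ} (hc : IsSF c) :
    IsSFMap fun t => wordE n i (c t) (x t) := by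
  intro p
  simp only [wordE_apply]
  refine (hx p).mul ((isSF_weightedSum hi hx fun m => ?_).div (isSF_weightedSum hi hx fun m => ?_))
  · split_ifs
    exacts [IsSF.one, hc]
  · split_ifs
    exacts [hc, IsSF.one]

theorem isSF_wordEps {P : Type} {i : Fin (n + 1)} (hi : ∃ m : L, letter n m.1 = i)
    {x : (P → ℂ) → L → ℂ} (hx : IsSFMap x) : IsSF fun t => wordEps n i (x t) :=
  isSF_weightedSum hi hx fun _ => IsSF.one

theorem isSF_wordGamma {P : Type} (i : Fin (n + 1)) {x : (P → ℂ) → L → ℂ} (hx : IsSFMap x) :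
    IsSF fun t => wordGamma n i (x t) :=
  IsSF.prod _ fun q _ => (hx q).zpow _

theorem wordMono_pos (i : Fin (n + 1)) {x : L → ℂ} (hx : x ∈ posPoints L) (m : L) :
    0 < wordMono n i x m :=
  (isSF_wordMono i (IsSFMap.id) m).pos hx

theorem weightedSum_pos {i : Fin (n + 1)} (hi : ∃ m : L, letter n m.1 = i) {x : L → ℂ}
    (hx : x ∈ posPoints L) {f : ℕ × ℕ → ℂ} (hf : ∀ m, 0 < f m) : 0 < weightedSum n i x f := by
  obtain ⟨m, hm⟩ := hi
  exact Finset.sum_pos (fun q _ => div_pos (hf _) (wordMono_pos i hx q)) ⟨m, by simpa using hm⟩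

theorem weightedSum_const (i : Fin (n + 1)) (x : L → ℂ) (t : ℂ) :
    (weightedSum n i x fun _ => t) = t * wordEps n i x := by
  rw [wordEps, weightedSum, Finset.mul_sum]
  exact Finset.sum_congr rfl fun m _ => by ring

theorem wordE_pos {i : Fin (n + 1)} (hi : ∃ m : L, letter n m.1 = i) {x : L → ℂ}
    (hx : x ∈ posPoints L) {t : ℂ} (ht : 0 < t) : wordE n i t x ∈ posPoints L := by
  intro p
  rw [wordE_apply]
  refine mul_pos (hx p) (div_pos (weightedSum_pos hi hx fun m => ?_)
    (weightedSum_pos hi hx fun m => ?_)) <;> split_ifs <;> first | exact ht | exact one_pos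

end WordFormula

/-! ### Comparing the word formulas with the vector formulas -/

section WordVector

variable {n k r : ℕ} {L : Finset (ℕ × ℕ)} {W : List (ℕ × ℕ)}

/-- The list `W` enumerates the positions in `L`, and describes the vector of the word. -/
structure IsWordList (n k r : ℕ) (L : Finset (ℕ × ℕ)) (W : List (ℕ × ℕ)) : Prop
    extends IsWord n k r L where
  pairwise : W.Pairwise Before
  mem_list_iff : ∀ p, p ∈ W ↔ p ∈ L
  vec_eq : ∀ x : L → ℂ, vec n k r x =
    (W.map fun p => opY n k (letter n p) (at' x p)).prod (baseVec n k r)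

theorem isWordList_word1 (hkn : k ≤ n) : IsWordList n k 1 (lat1 n k) (word1 n k) where
  toIsWord := isWord_lat1
  pairwise := pairwise_word1 n k
  mem_list_iff _ := mem_word1
  vec_eq x := by rw [← v1_eq_vec hkn, v1, u1_eq_baseVec]

theorem isWordList_word2 (hk : 1 ≤ k) (hkn : k ≤ n) :
    IsWordList n k 0 (lat2 n k) (word2 n k) where
  toIsWord := isWord_lat2
  pairwise := pairwise_word2 n k
  mem_list_iff _ := mem_word2
  vec_eq x := by rw [← v2_eq_vec hk hkn, v2, u2_eq_baseVec hk]

theorem letter_eq_wn (l w : ℕ) : letter n (l, w + r) = wn n r w :=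
  congrArg (Fin.ofNat (n + 1)) (add_comm w r)

theorem IsWord.exists_letter (hL : IsWord n k r L) (hk : 1 ≤ k) (hkn : k ≤ n) {w : ℕ}
    (hw : w < n) : ∃ m : L, letter n m.1 = wn n r w :=
  ⟨⟨(max 1 (k - w), w + r), (hL.mem_iff _ _).2 (by omega)⟩, letter_eq_wn _ _⟩

/-- The coordinates `dC i` as products of the variables. -/
theorem IsWord.dC_vec (hL : IsWord n k r L) (hk : 1 ≤ k) (hkn : k ≤ n) {x : L → ℂ}
    (hx : x ∈ torus L) (i : Fin (n + 1)) :
    dC i (vec n k r x) = ∏ q : L, if letter n q.1 = i then x q else 1 := by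
  obtain ⟨w, hw, rfl⟩ := wn_surj n r i
  have h1 : (∏ q : L, if letter n q.1 = wn n r w then x q else 1) =
      ∏ q : L, (fun p => if letter n p = wn n r w then at' x p else 1) q.1 := by
    refine Finset.prod_congr rfl fun q _ => ?_
    beta_reduce
    rw [at'_of_mem x q.2]
  rw [h1, hL.prod_eq (fun p => if letter n p = wn n r w then at' x p else 1)
      fun p hp => by rw [at'_of_notMem x hp, ite_self],
    Finset.prod_eq_single w]
  · rw [dC, cycInt_wn hkn hw, ← pc, hL.pc_vec_clusterSet hkn hx (by omega) (by omega)]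
    rw [show w + 1 - k + min k (w + 1) - 1 = w by omega]
    simp only [letter_eq_wn, if_true]
    refine Finset.prod_subset (Finset.Ioc_subset_Ioc_left (by omega)) fun l hl hl' => ?_
    rw [Finset.mem_Ioc] at hl hl'
    exact hL.at'_eq_one x (by omega)
  · intro w' hw' hne
    refine Finset.prod_eq_one fun l _ => ?_
    rw [letter_eq_wn, if_neg]
    rwa [wn_inj (Finset.mem_range.1 hw') hw]
  · intro h
    exact absurd (Finset.mem_range.2 hw) h

theorem IsWord.wordGamma_eq (hL : IsWord n k r L) (hk : 1 ≤ k) (hkn : k ≤ n) {x : L → ℂ}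
    (hx : x ∈ torus L) (i : Fin (n + 1)) : wordGamma n i x = gammaC i (vec n k r x) := by
  unfold gammaC wordGamma
  simp only [hL.dC_vec hk hkn hx, ← Finset.prod_zpow]
  rw [Finset.prod_comm]
  refine Finset.prod_congr rfl fun q _ => ?_
  rw [Finset.prod_eq_single (letter n q.1)]
  · rw [if_pos rfl]
  · intro j _ hj
    rw [if_neg hj.symm, one_zpow]
  · simp

section

variable (hW : IsWordList n k r L W) {i : Fin (n + 1)} (hi : ∃ m : L, letter n m.1 = i)
  {x : L → ℂ} (hx : x ∈ posPoints L) {t : ℂ} (ht : 0 < t)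
include hW

theorem IsWordList.wordE_at' {A B : List (ℕ × ℕ)} {p : ℕ × ℕ} (h : W = A ++ p :: B) (x : L → ℂ)
    (t : ℂ) : at' (wordE n i t x) p =
      at' x p * ((weightedSum n i x fun m => if m ∈ A ++ [p] then t else 1) /
        (weightedSum n i x fun m => if m ∈ A then t else 1)) := by
  have hp : p ∈ L := (hW.mem_list_iff p).1 (h ▸ by simp)
  rw [at'_of_mem _ hp, at'_of_mem _ hp, wordE_apply]
  congr 2
  · refine Finset.sum_congr rfl fun m _ => ?_
    have := not_before_iff_mem hW.pairwise h ((hW.mem_list_iff _).2 m.2)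
    by_cases hb : Before p m.1 <;> simp only [hb, if_true, if_false, ← this, not_true_eq_false,
      not_false_eq_true]
  · refine Finset.sum_congr rfl fun m _ => ?_
    have := before_iff_mem hW.pairwise h ((hW.mem_list_iff _).2 m.2)
    simp only [this]

theorem IsWordList.weightedSum_append {A B : List (ℕ × ℕ)} {p : ℕ × ℕ} (h : W = A ++ p :: B)
    (hp : p ∈ L) (x : L → ℂ) (t : ℂ) :
    (weightedSum n i x fun m => if m ∈ A ++ [p] then t else 1) =
      (weightedSum n i x fun m => if m ∈ A then t else 1) +
        if letter n p = i then (t - 1) / wordMono n i x ⟨p, hp⟩ else 0 := by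
  have hpA : p ∉ A := by
    have := nodup_of_pairwise_before hW.pairwise
    rw [h, List.nodup_append] at this
    exact fun hA => this.2.2 p hA p (by simp) rfl
  have h1 : (if letter n p = i then (t - 1) / wordMono n i x ⟨p, hp⟩ else 0) =
      ∑ m : L with letter n m.1 = i, if m = ⟨p, hp⟩ then (t - 1) / wordMono n i x m else 0 := by
    rw [Finset.sum_ite_eq']
    simp
  rw [h1, weightedSum, weightedSum, ← Finset.sum_add_distrib]
  refine Finset.sum_congr rfl fun m _ => ?_
  by_cases hm : m = ⟨p, hp⟩
  · subst hm
    simp [hpA]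
    ring
  · have : m.1 ≠ p := fun h => hm (Subtype.ext h)
    simp [hm, this]

theorem IsWordList.wordMono_eq {A B : List (ℕ × ℕ)} {p : ℕ × ℕ} (h : W = A ++ p :: B)
    (hp : p ∈ L) (x : L → ℂ) : wordMono n i x ⟨p, hp⟩ =
      (A.map fun q => at' x q ^ cartan n (letter n q) i).prod * at' x p := by
  have hA : ∀ q ∈ A, q ∈ L := fun q hq => (hW.mem_list_iff q).1 (h ▸ by simp [hq])
  have hAn : A.Nodup := by
    have := nodup_of_pairwise_before hW.pairwise
    rw [h, List.nodup_append] at this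
    exact this.1
  rw [list_map_prod_eq hAn hA, wordMono, at'_of_mem x hp]
  congr 1
  refine Finset.prod_congr ?_ fun q _ => by rw [at'_of_mem x q.2]
  ext q
  simp only [Finset.mem_filter, Finset.mem_univ, true_and]
  exact before_iff_mem hW.pairwise h ((hW.mem_list_iff _).2 q.2)

include hi hx ht

/-- The transformation of the variables describes the one-parameter group of `e_i`. -/
theorem IsWordList.vec_wordE_eq_expE (hn : 2 ≤ n) (hu : chevE i (baseVec n k r) = 0) :
    vec n k r (wordE n i t x) = expE i ((t - 1) / wordEps n i x) (vec n k r x) := by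
  have hpos : ∀ A : List (ℕ × ℕ), 0 < weightedSum n i x fun m => if m ∈ A then t else 1 :=
    fun A => weightedSum_pos hi hx fun m => by split_ifs; exacts [ht, one_pos]
  have h0 := posPoints_subset_torus hx
  have key := expE_prod_opY (k := k) hn i (letter n) (c := at' x) (c' := at' (wordE n i t x))
    (mono := fun p => (∏ q : L with Before q.1 p, x q ^ cartan n (letter n q.1) i) * at' x p)
    (fun p => at'_ne_zero h0 p)
    (fun p => at'_ne_zero (posPoints_subset_torus (wordE_pos hi hx ht)) p)
    (τ := t - 1) (u := baseVec n k r)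
    (fun a => by rw [expE, hu, smul_zero, add_zero]) W
    (fun A => weightedSum n i x fun m => if m ∈ A then t else 1)
    (fun A => (A.map fun q => at' x q ^ cartan n (letter n q) i).prod)
    (fun A p => by simp)
    (fun A => List.prod_ne_zero (by
      simp only [List.mem_map, not_exists, not_and]
      exact fun q _ => zpow_ne_zero _ (at'_ne_zero h0 q)))
    (fun A _ _ => (hpos A).ne')
    (fun A p B h => by
      have hp : p ∈ L := (hW.mem_list_iff p).1 (h ▸ by simp)
      rw [hW.weightedSum_append h hp]
      rw [wordMono, at'_of_mem x hp])
    (fun A p B h => by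
      have hp : p ∈ L := (hW.mem_list_iff p).1 (h ▸ by simp)
      rw [← hW.wordMono_eq h hp, wordMono, at'_of_mem x hp])
    (fun A p B h => hW.wordE_at' h x t) W [] rfl
  rw [← hW.vec_eq, ← hW.vec_eq] at key
  rw [← key]
  simp [wordEps_eq]

/-- The ratios of new to old variables telescope to the sum with all weights `t` over the sum with
all weights `1`, that is `t`; only the variables with letter `i` change. -/
theorem IsWordList.dC_vec_wordE (hk : 1 ≤ k) (hkn : k ≤ n) :
    dC i (vec n k r (wordE n i t x)) = t * dC i (vec n k r x) := by
  have hpos : ∀ A : List (ℕ × ℕ), 0 < weightedSum n i x fun m => if m ∈ A then t else 1 :=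
    fun A => weightedSum_pos hi hx fun m => by split_ifs; exacts [ht, one_pos]
  have h0 := posPoints_subset_torus hx
  rw [hW.dC_vec hk hkn h0, hW.dC_vec hk hkn (posPoints_subset_torus (wordE_pos hi hx ht))]
  have hρ := prod_ratio W (fun A => weightedSum n i x fun m => if m ∈ A then t else 1)
    (fun p => at' (wordE n i t x) p / at' x p) (fun A _ _ => (hpos A).ne')
    (fun A p B h => by
      rw [hW.wordE_at' h]
      field_simp [at'_ne_zero h0 p]) W [] rfl
  rw [list_map_prod_eq (L := L) (nodup_of_pairwise_before hW.pairwise)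
    (fun p hp => (hW.mem_list_iff p).1 hp)] at hρ
  have hS : (weightedSum n i x fun m => if m ∈ W then t else 1) = t * wordEps n i x := by
    rw [← weightedSum_const]
    refine Finset.sum_congr rfl fun m _ => ?_
    beta_reduce
    rw [if_pos ((hW.mem_list_iff _).2 m.2)]
  have hS0 := hpos []
  simp only [List.not_mem_nil, if_false] at hρ hS0
  rw [hS, ← wordEps_eq, mul_div_cancel_right₀ _ (by rw [wordEps_eq]; exact hS0.ne')] at hρ
  conv_rhs => lhs; rw [← hρ]
  rw [Finset.prod_filter, ← Finset.prod_mul_distrib]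
  refine Finset.prod_congr rfl fun q _ => ?_
  rw [if_pos ((hW.mem_list_iff _).2 q.2), at'_of_mem _ q.2, at'_of_mem _ q.2]
  have hq : x q ≠ 0 := h0 q
  by_cases h : letter n q.1 = i
  · rw [if_pos h, if_pos h]
    field_simp
  · rw [if_neg h, if_neg h, mul_one]
    obtain ⟨A, B, hAB⟩ := List.append_of_mem ((hW.mem_list_iff _).2 q.2)
    have := hW.wordE_at' (i := i) hAB x t
    rw [at'_of_mem _ q.2, at'_of_mem _ q.2, hW.weightedSum_append hAB q.2, if_neg h, add_zero,
      div_self (hpos A).ne', mul_one] at this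
    rw [this, div_self hq]

end

/-- Two evaluations of `dC i` after acting with `t = 2` are compared: telescoping gives `2 D`, and
the linear action of `expE` gives `D + A / ε`. -/
theorem IsWordList.wordEps_eq_epsC (hW : IsWordList n k r L W) (hk : 1 ≤ k) (hkn : k ≤ n)
    (hn : 2 ≤ n) {w : ℕ} (hw : w < n) {x : L → ℂ} (hx : x ∈ posPoints L) :
    wordEps n (wn n r w) x = epsC (wn n r w) (vec n k r x) := by
  have hi := hW.exists_letter hk hkn hw
  have hu := chevE_baseVec (n := n) (k := k) hkn (r := r) hw
  have h1 := hW.dC_vec_wordE hi hx (t := 2) two_pos hk hkn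
  rw [hW.vec_wordE_eq_expE hi hx two_pos hn hu, dC_expE_self hk hkn] at h1
  have hS : wordEps n (wn n r w) x ≠ 0 := (weightedSum_pos hi hx fun _ => one_pos).ne'
  have hD : dC (wn n r w) (vec n k r x) ≠ 0 := by
    rw [hW.dC_vec hk hkn (posPoints_subset_torus hx)]
    refine Finset.prod_ne_zero_iff.2 fun q _ => ?_
    split_ifs
    exacts [(hx q).ne', one_ne_zero]
  rw [epsC, eq_div_iff hD]
  field_simp at h1
  linear_combination -h1

theorem IsWordList.vec_wordE (hW : IsWordList n k r L W) (hk : 1 ≤ k) (hkn : k ≤ n)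
    (hn : 2 ≤ n) {w : ℕ} (hw : w < n) {x : L → ℂ} (hx : x ∈ posPoints L) {t : ℂ} (ht : 0 < t) :
    vec n k r (wordE n (wn n r w) t x) = actC (wn n r w) t (vec n k r x) := by
  rw [hW.vec_wordE_eq_expE (hW.exists_letter hk hkn hw) hx ht hn (chevE_baseVec hkn hw),
    hW.wordEps_eq_epsC hk hkn hn hw hx, actC, epsC, div_div_eq_mul_div]

end WordVector

/-! ### Recovering the variables from a vector; exchange between two base points -/

section ClusterCoordinates

variable {n k r : ℕ} {L : Finset (ℕ × ℕ)}

theorem clusterSet_subset (hkn : k ≤ n) {j a : ℕ} (hj : j ≤ k) (ha : a ≤ n + 1 - k) :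
    clusterSet n k 0 j a ⊆ Finset.range (n + 1) := by
  intro z hz
  rw [mem_clusterSet] at hz
  rw [Finset.mem_range]
  omega

theorem card_clusterSet (hkn : k ≤ n) {j a : ℕ} (hj : j ≤ k) (ha : a ≤ n + 1 - k) :
    (clusterSet n k 0 j a).card = k := by
  have h : clusterSet n k 0 j a = (Finset.Ico a (a + j)).disjUnion
      (Finset.Ico (n + 1 - k + j) (n + 1)) (by
        rw [Finset.disjoint_left]
        intro z
        simp only [Finset.mem_Ico]
        omega) := by
    ext z
    simp only [mem_clusterSet, Finset.mem_disjUnion, Finset.mem_Ico]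
    omega
  rw [h, Finset.card_disjUnion, Nat.card_Ico, Nat.card_Ico]
  omega

/-- The lowest coordinate. -/
noncomputable def lowest (r : ℕ) (v : FundRep n k) : ℂ := pc r v (clusterSet n k 0 0 0)

theorem lowest_eq_zero_left (r : ℕ) (v : FundRep n k) (a : ℕ) :
    pc r v (clusterSet n k 0 0 a) = lowest r v := by
  rw [lowest]
  congr 1
  ext z
  simp only [mem_clusterSet]
  omega

theorem lowest_eq_of_top (hkn : k ≤ n) (r : ℕ) (v : FundRep n k) {j : ℕ} (hj : j ≤ k) :
    pc r v (clusterSet n k 0 j (n + 1 - k)) = lowest r v := by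
  rw [lowest]
  congr 1
  ext z
  simp only [mem_clusterSet]
  omega

/-- The variables of the word with given cluster coordinates. -/
noncomputable def clusterVars (r : ℕ) (L : Finset (ℕ × ℕ)) (v : FundRep n k) : L → ℂ := fun p =>
  pc r v (clusterSet n k 0 (k + 1 - p.1.1) (p.1.1 + (p.1.2 - r) - k)) /
    pc r v (clusterSet n k 0 (k - p.1.1) (p.1.1 + (p.1.2 - r) - k + 1))

theorem clusterVars_smul (r : ℕ) (L : Finset (ℕ × ℕ)) {c : ℂ} (hc : c ≠ 0) (v : FundRep n k) :
    clusterVars r L (c • v) = clusterVars r L v := by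
  funext p
  simp only [clusterVars, pc_smul, mul_div_mul_left _ _ hc]

theorem IsWord.clusterVars_vec (hL : IsWord n k r L) (hkn : k ≤ n) {x : L → ℂ}
    (hx : x ∈ torus L) : clusterVars r L (vec n k r x) = x := by
  funext ⟨p, hp⟩
  obtain ⟨w, hw, h⟩ := hL.exists_eq hp
  generalize p.1 = l at *
  subst hw
  rw [hL.var_eq_div hkn hx, clusterVars, Nat.add_sub_cancel]

theorem IsWord.mem_cluster_range (hL : IsWord n k r L) (p : L) :
    k + 1 - p.1.1 ≤ k ∧ p.1.1 + (p.1.2 - r) - k ≤ n + 1 - k ∧ k - p.1.1 ≤ k ∧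
      p.1.1 + (p.1.2 - r) - k + 1 ≤ n + 1 - k := by
  obtain ⟨w, hw, h⟩ := hL.exists_eq p.2
  rw [show p.1.2 = w + r from congrArg Prod.snd hw]
  omega

theorem IsWord.clusterVars_pos (hL : IsWord n k r L) {v : FundRep n k}
    (hv : ∀ j ≤ k, ∀ a ≤ n + 1 - k, 0 < pc r v (clusterSet n k 0 j a)) :
    clusterVars r L v ∈ posPoints L := fun p => by
  obtain ⟨h1, h2, h3, h4⟩ := hL.mem_cluster_range p
  exact div_pos (hv _ h1 _ h2) (hv _ h3 _ h4)

/-- Vectors with positive cluster coordinates come from the word, up to a scalar. -/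
theorem IsWord.vec_clusterVars (hL : IsWord n k r L) (hkn : k ≤ n) {v : FundRep n k}
    (hp : IsPlucker r v)
    (hv : ∀ j ≤ k, ∀ a ≤ n + 1 - k, 0 < pc r v (clusterSet n k 0 j a)) :
    vec n k r (clusterVars r L v) = (lowest r v)⁻¹ • v := by
  have hx := hL.clusterVars_pos hv
  have h0 : 0 < lowest r v := hv 0 (by omega) 0 (by omega)
  have hx0 := posPoints_subset_torus hx
  refine eq_of_cluster hkn (hL.isPlucker_vec hkn hx0 r) (hp.smul _)
    (fun j hj a ha => hL.pc_vec_pos hkn hx r (clusterSet_subset hkn hj ha)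
      (card_clusterSet hkn hj ha)) ?_
  intro j
  -- Passing from the block of length `j` at `a + 1` to the block of length `j + 1` at `a`
  -- multiplies the coordinate by one variable, which `clusterVars` defines as precisely this ratio.
  induction j with
  | zero =>
    intro _ a ha
    rw [hL.pc_vec_clusterSet hkn hx0 (by omega) ha, pc_smul, lowest_eq_zero_left, Nat.sub_zero,
      Finset.Ioc_self, Finset.prod_empty, inv_mul_cancel₀ h0.ne']
  | succ j ih =>
    intro hj a ha
    rcases ha.eq_or_lt with rfl | ha'
    · rw [hL.pc_vec_clusterSet hkn hx0 hj ha, pc_smul, lowest_eq_of_top hkn _ _ hj,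
        inv_mul_cancel₀ h0.ne']
      refine Finset.prod_eq_one fun i hi => ?_
      rw [Finset.mem_Ioc] at hi
      exact hL.at'_eq_one _ (by omega)
    · have h1 := ih (by omega) (a + 1) ha'
      rw [hL.pc_vec_clusterSet hkn hx0 (by omega) ha', pc_smul] at h1
      have h2 : Finset.Ioc (k - (j + 1)) k = insert (k - j) (Finset.Ioc (k - j) k) := by
        ext z
        simp only [Finset.mem_Ioc, Finset.mem_insert]
        omega
      rw [hL.pc_vec_clusterSet hkn hx0 hj ha, h2, Finset.prod_insert (by simp),
        show a + (j + 1) - 1 = a + 1 + j - 1 by omega, h1, pc_smul]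
      have hmem : (k - j, a + 1 + j - 1 + r) ∈ L := (hL.mem_iff _ _).2 (by omega)
      have h3 := (hv j (by omega) (a + 1) ha').ne'
      rw [at'_of_mem _ hmem, clusterVars]
      dsimp only
      rw [show k + 1 - (k - j) = j + 1 by omega, show k - (k - j) = j by omega,
        show k - j + (a + 1 + j - 1 + r - r) - k = a by omega]
      field_simp

theorem IsWord.isSF_clusterVars_vec (hL : IsWord n k r L) (hkn : k ≤ n) {r' : ℕ}
    {L' : Finset (ℕ × ℕ)} (hL' : IsWord n k r' L') :
    IsSFMap fun x : L → ℂ => clusterVars r' L' (vec n k r x) := fun p => by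
  obtain ⟨h1, h2, h3, h4⟩ := hL'.mem_cluster_range p
  exact (hL.isSF_pc_vec hkn r' (clusterSet_subset hkn h1 h2) (card_clusterSet hkn h1 h2)).div
    (hL.isSF_pc_vec hkn r' (clusterSet_subset hkn h3 h4) (card_clusterSet hkn h3 h4))

theorem pc_one_eq (v : FundRep n k) {s t : Finset ℕ} (hs : s ⊆ Finset.range (n + 1))
    (h : ∀ z, z ∈ t ↔ (z = 0 ∧ n ∈ s) ∨ (1 ≤ z ∧ z ≤ n ∧ z - 1 ∈ s)) : pc 1 v s = pc 0 v t := by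
  rw [pc_succ 0 v hs]
  congr 1
  ext z
  rw [h, Finset.mem_image]
  constructor
  · rintro ⟨m, hm, rfl⟩
    have := Finset.mem_range.1 (hs hm)
    unfold rot
    split_ifs with h1
    · exact .inl ⟨rfl, h1 ▸ hm⟩
    · exact .inr ⟨by omega, by omega, hm⟩
  · rintro (⟨rfl, h1⟩ | ⟨h1, h2, h3⟩)
    · exact ⟨n, h1, if_pos rfl⟩
    · exact ⟨z - 1, h3, by rw [rot, if_neg (by omega)]; omega⟩

/-- The exchange relation between the cluster coordinates for two consecutive base points. -/
theorem IsPlucker.cluster_exchange (hkn : k ≤ n) {v : FundRep n k} (hv : IsPlucker 0 v) {j a : ℕ}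
    (hj : 1 ≤ j) (hjk : j < k) (ha : 1 ≤ a) (hak : a ≤ n - k) :
    pc 0 v (clusterSet n k 0 j a) * pc 1 v (clusterSet n k 0 j a) =
      pc 1 v (clusterSet n k 0 j (a - 1)) * pc 0 v (clusterSet n k 0 j (a + 1)) +
        pc 1 v (clusterSet n k 0 (j - 1) a) * pc 0 v (clusterSet n k 0 (j + 1) a) := by
  -- Seen from base point `0`, cluster sets for base point `1` are shifted up by one and, as `j <
  -- k`, the last tail element `n` wraps to `0`. The relation is taken on the entries `0`, `a`, `a +
  -- j` and `n + 1 - k + j`, the last being the first tail element.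
  have h := hv (Finset.Ico (a + 1) (a + j) ∪ Finset.Ico (n + 2 - k + j) (n + 1)) (by
      intro z
      simp only [Finset.mem_union, Finset.mem_Ico, Finset.mem_range]
      omega) 0 a (a + j) (n + 1 - k + j) (by omega) (by omega) (by omega) (by omega)
    (by simp; omega) (by simp; omega) (by simp; omega) (by simp; omega)
  rw [pc_one_eq v (clusterSet_subset hkn (by omega) (by omega))
      (t := insert 0 (insert (a + j) (Finset.Ico (a + 1) (a + j) ∪
        Finset.Ico (n + 2 - k + j) (n + 1)))),
    pc_one_eq v (clusterSet_subset hkn (by omega) (by omega))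
      (t := insert 0 (insert a (Finset.Ico (a + 1) (a + j) ∪
        Finset.Ico (n + 2 - k + j) (n + 1)))),
    pc_one_eq v (clusterSet_subset hkn (by omega) (by omega))
      (t := insert 0 (insert (n + 1 - k + j) (Finset.Ico (a + 1) (a + j) ∪
        Finset.Ico (n + 2 - k + j) (n + 1))))]
  · rw [mul_comm]
    convert h using 3
    all_goals
      congr 1
      ext z
      simp only [mem_clusterSet, Finset.mem_insert, Finset.mem_union, Finset.mem_Ico]
      omega
  all_goals
    intro z
    simp only [mem_clusterSet, Finset.mem_insert, Finset.mem_union, Finset.mem_Ico]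
    omega

end ClusterCoordinates

/-! ### Lattice paths and the map `mapSigma` -/

section Paths

variable {n k : ℕ}

theorem mem_lat1 {l m : ℕ} : (l, m) ∈ lat1 n k ↔ 1 ≤ l ∧ l ≤ k ∧ k < l + m ∧ l + m ≤ n + 1 := by
  simp only [lat1, Finset.mem_filter, Finset.mem_product, Finset.mem_Icc, Finset.mem_range]
  omega

theorem paths_eq_empty {p : ℕ × ℕ} (hp : p ∉ lat1 n k) : paths n k p = ∅ := by
  ext s
  simp only [paths, Set.mem_ofPred_eq, Set.mem_empty_iff_false, iff_false, not_and]
  intro h1 _ _ h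
  exact hp (h p (List.mem_of_mem_head? (h1 ▸ rfl)))

theorem paths_eq_cons {l m : ℕ} (hp : (l, m) ∈ lat1 n k) (hm : m < n) :
    paths n k (l, m) = List.cons (l, m) ''
      (paths n k (l, m + 1) ∪ paths n k (l - 1, m + 1)) := by
  have hl := (mem_lat1.1 hp).1
  ext s
  simp only [Set.mem_image, Set.mem_union]
  constructor
  · rintro ⟨h1, h2, h3, h4⟩
    match s, h1, h2, h3, h4 with
    | [p], h1, h2, _, _ =>
      simp at h1 h2
      rw [h1] at h2
      simp at h2
      omega
    | p :: q :: s, h1, h2, h3, h4 =>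
      obtain rfl : p = (l, m) := by simpa using h1
      rw [List.isChain_cons_cons] at h3
      have hmem : ∀ q', q' = q → q :: s ∈ paths n k q' := by
        rintro q' rfl
        exact ⟨rfl, by simpa using h2, h3.2, fun z hz => h4 z (List.mem_cons_of_mem _ hz)⟩
      refine ⟨q :: s, ?_, rfl⟩
      obtain ⟨h5, h6 | h6⟩ := h3.1
      · exact .inl (hmem _ (Prod.ext h6.symm h5.symm))
      · exact .inr (hmem _ (Prod.ext (by dsimp only at h6 ⊢; omega) h5.symm))
  · rintro ⟨s, hs, rfl⟩
    have key : ∀ q, PathStep (l, m) q → s ∈ paths n k q → (l, m) :: s ∈ paths n k (l, m) := by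
      rintro q hq ⟨h1, h2, h3, h4⟩
      match s, h1, h2, h3, h4 with
      | q' :: s, h1, h2, h3, h4 =>
        obtain rfl : q' = q := by simpa using h1
        refine ⟨rfl, by simpa using h2, List.isChain_cons_cons.2 ⟨hq, h3⟩, fun z hz => ?_⟩
        rcases List.mem_cons.1 hz with rfl | hz
        exacts [hp, h4 z hz]
    rcases hs with hs | hs
    · exact key (l, m + 1) ⟨rfl, .inl rfl⟩ hs
    · exact key (l - 1, m + 1) ⟨rfl, .inr (by dsimp only; omega)⟩ hs

theorem paths_end (hk : 1 ≤ k) (hkn : k ≤ n) : paths n k (1, n) = {[(1, n)]} := by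
  ext s
  rw [Set.mem_singleton_iff]
  constructor
  · rintro ⟨h1, h2, h3, h4⟩
    match s, h1, h2, h3, h4 with
    | [p], h1, _, _, _ => simpa using h1
    | p :: q :: s, h1, _, h3, h4 =>
      obtain rfl : p = (1, n) := by simpa using h1
      rw [List.isChain_cons_cons] at h3
      have h5 := (mem_lat1 (n := n) (k := k) (l := q.1) (m := q.2)).1 (h4 q (by simp))
      have := h3.1.1
      dsimp only at this
      omega
  · rintro rfl
    refine ⟨rfl, rfl, by simp, fun q hq => ?_⟩
    rw [List.mem_singleton.1 hq, mem_lat1]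
    omega

theorem finite_paths (p : ℕ × ℕ) : (paths n k p).Finite := by
  obtain ⟨l, m⟩ := p
  by_cases hp : (l, m) ∈ lat1 n k
  swap
  · rw [paths_eq_empty hp]
    exact Set.finite_empty
  have h := mem_lat1.1 hp
  obtain ⟨d, hd⟩ : ∃ d, m + d = n := ⟨n - m, by omega⟩
  induction d generalizing l m with
  | zero =>
    obtain rfl : m = n := hd
    obtain rfl : l = 1 := by omega
    rw [paths_end (by omega) (by omega)]
    exact Set.finite_singleton _
  | succ d ih =>
    rw [paths_eq_cons hp (by omega)]
    refine (Set.Finite.union ?_ ?_).image _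
    · by_cases h' : (l, m + 1) ∈ lat1 n k
      · exact ih _ _ h' (mem_lat1.1 h') (by omega)
      · rw [paths_eq_empty h']
        exact Set.finite_empty
    · by_cases h' : (l - 1, m + 1) ∈ lat1 n k
      · exact ih _ _ h' (mem_lat1.1 h') (by omega)
      · rw [paths_eq_empty h']
        exact Set.finite_empty

/-- The sum of the weights of all paths. -/
noncomputable def pathTotal (n k : ℕ) (x : lat1 n k → ℂ) (p : ℕ × ℕ) : ℂ :=
  ∑ᶠ s ∈ paths n k p, pathWeight x s

theorem pathTotal_of_notMem (x : lat1 n k → ℂ) {p : ℕ × ℕ} (hp : p ∉ lat1 n k) :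
    pathTotal n k x p = 0 := by
  rw [pathTotal, paths_eq_empty hp, finsum_mem_empty]

theorem pathTotal_end (hk : 1 ≤ k) (hkn : k ≤ n) (x : lat1 n k → ℂ) :
    pathTotal n k x (1, n) = 1 := by
  rw [pathTotal, paths_end hk hkn, finsum_mem_singleton]
  rfl

theorem pathWeight_cons (x : lat1 n k → ℂ) (p : ℕ × ℕ) {q : ℕ × ℕ} {s : List (ℕ × ℕ)}
    (hs : s ∈ paths n k q) : pathWeight x (p :: s) =
      (if q.1 = p.1 then at' x p / at' x q else 1) * pathWeight x s := by
  obtain ⟨h1, -⟩ := hs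
  match s, h1 with
  | q' :: s, h1 =>
    obtain rfl : q' = q := by simpa using h1
    rfl

/-- Paths are sorted by their first step. The recursion also holds at the border because
`pathTotal`, unlike `pathSum`, is `0` outside the lattice. -/
theorem pathTotal_rec (x : lat1 n k → ℂ) {l m : ℕ} (hp : (l, m) ∈ lat1 n k) (hm : m < n) :
    pathTotal n k x (l, m) = at' x (l, m) / at' x (l, m + 1) * pathTotal n k x (l, m + 1) +
      pathTotal n k x (l - 1, m + 1) := by
  have hl := (mem_lat1.1 hp).1
  have hdisj : Disjoint (paths n k (l, m + 1)) (paths n k (l - 1, m + 1)) := by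
    rw [Set.disjoint_left]
    rintro s ⟨h1, -⟩ ⟨h2, -⟩
    rw [h1] at h2
    simp at h2
    omega
  rw [pathTotal, paths_eq_cons hp hm,
    finsum_mem_image (List.cons_injective.injOn),
    finsum_mem_union hdisj (finite_paths _) (finite_paths _), pathTotal, pathTotal,
    mul_finsum_mem]
  congr 1
  · refine finsum_mem_congr rfl fun s hs => ?_
    rw [pathWeight_cons x _ hs, if_pos rfl]
  · refine finsum_mem_congr rfl fun s hs => ?_
    rw [pathWeight_cons x _ hs, if_neg (by dsimp only; omega), one_mul]

/-- From base point `1` the lowest set for base point `0` is a block of length `k`, and of the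
variables in its monomial only `x^{(1)}_n` lies in the lattice. -/
theorem lowest_vec_one (hk : 1 ≤ k) (hkn : k ≤ n) {x : lat1 n k → ℂ} (hx : x ∈ torus (lat1 n k)) :
    lowest 0 (vec n k 1 x) = at' x (1, n) := by
  have hL := isWord_lat1 (n := n) (k := k)
  have e : pc 1 (vec n k 1 x) (clusterSet n k 0 k (n - k)) = lowest 0 (vec n k 1 x) :=
    pc_one_eq _ (clusterSet_subset hkn (by omega) (by omega)) fun z => by
      simp only [mem_clusterSet]
      omega
  rw [← e, hL.pc_vec_clusterSet hkn hx le_rfl (by omega), Nat.sub_self,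
    show n - k + k - 1 + 1 = n by omega, Finset.prod_eq_single 1]
  · intro i hi hi1
    rw [Finset.mem_Ioc] at hi
    refine at'_of_notMem x ?_
    rw [mem_lat1]
    omega
  · intro h
    exact absurd (Finset.mem_Ioc.2 ⟨one_pos, hk⟩) h

/-- The path sums in terms of the coordinates of `v_1(x)`. -/
theorem pathTotal_eq (hkn : k ≤ n) {x : lat1 n k → ℂ} (hx : x ∈ torus (lat1 n k)) {l m : ℕ}
    (hp : (l, m) ∈ lat1 n k) :
    at' x (1, n) * pathTotal n k x (l, m) * ∏ i ∈ Finset.Ioc l k, at' x (i, m) =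
      pc 0 (vec n k 1 x) (clusterSet n k 0 (k + 1 - l) (l + m - k)) := by
  have hL := isWord_lat1 (n := n) (k := k)
  have h := mem_lat1.1 hp
  have hV := hL.isPlucker_vec hkn hx 0
  have hlow := lowest_vec_one (by omega) hkn hx
  obtain ⟨d, hd⟩ : ∃ d, m + d = n := ⟨n - m, by omega⟩
  have hprod : ∀ l' m', l' + m' = n + 1 → ∏ i ∈ Finset.Ioc l' k, at' x (i, m') = 1 := by
    intro l' m' h'
    refine Finset.prod_eq_one fun i hi => at'_of_notMem x fun hi' => ?_
    have := mem_lat1.1 hi'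
    rw [Finset.mem_Ioc] at hi
    omega
  induction d generalizing l m with
  | zero =>
    obtain rfl : m = n := hd
    obtain rfl : l = 1 := by omega
    rw [pathTotal_end (by omega) hkn, hprod _ _ (by omega), show 1 + m - k = m + 1 - k by omega,
      lowest_eq_of_top hkn _ _ (by omega), hlow, mul_one, mul_one]
  | succ d ih =>
    rw [pathTotal_rec x hp (by omega)]
    -- On the border `l + m = n + 1` only the diagonal step remains, and the coordinate is the
    -- lowest one all along.
    rcases h.2.2.2.eq_or_lt with hlm | hlm
    · have hp' : (l - 1, m + 1) ∈ lat1 n k := mem_lat1.2 (by omega)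
      have ih' := ih hp' (mem_lat1.1 hp') (by omega)
      rw [pathTotal_of_notMem x (p := (l, m + 1)) (by rw [mem_lat1]; omega), mul_zero, zero_add,
        hprod _ _ (by omega), hlm, lowest_eq_of_top hkn _ _ (by omega)]
      rwa [hprod _ _ (by omega), show l - 1 + (m + 1) - k = n + 1 - k by omega,
        lowest_eq_of_top hkn _ _ (by omega)] at ih'
    · have hp1 : (l, m + 1) ∈ lat1 n k := mem_lat1.2 (by omega)
      have ih1 := ih hp1 (mem_lat1.1 hp1) (by omega)
      have hG : ∀ j a, j ≤ k → 1 ≤ j → a ≤ n + 1 - k → ∀ l' m', l' = k + 1 - j → m' = a + j →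
          pc 1 (vec n k 1 x) (clusterSet n k 0 j a) =
            at' x (l', m') * ∏ i ∈ Finset.Ioc l' k, at' x (i, m') := by
        rintro j a hj hj1 ha l' m' rfl rfl
        rw [hL.pc_vec_clusterSet hkn hx hj ha, show a + j - 1 + 1 = a + j by omega,
          ← Finset.prod_insert (f := fun i => at' x (i, a + j)) (by simp)]
        congr 1
        ext z
        simp only [Finset.mem_Ioc, Finset.mem_insert]
        omega
      have hprod0 : ∏ i ∈ Finset.Ioc l k, at' x (i, m + 1) ≠ 0 :=
        Finset.prod_ne_zero_iff.2 fun i _ => at'_ne_zero hx _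
      have hx1 := at'_ne_zero hx (l, m + 1)
      have hG1 := hG (k + 1 - l) (l + m - k - 1) (by omega) (by omega) (by omega) l m (by omega)
        (by omega)
      have hG2 := hG (k + 1 - l) (l + m - k) (by omega) (by omega) (by omega) l (m + 1) (by omega)
        (by omega)
      rw [show l + (m + 1) - k = l + m - k + 1 by omega] at ih1
      -- For `l = 1` only the horizontal step remains. The block has full length `k`, there is no
      -- tail, and changing the base point just shifts the block by one.
      rcases h.1.eq_or_lt with hl | hl
      · rw [pathTotal_of_notMem x (p := (l - 1, m + 1)) (by rw [mem_lat1]; omega), add_zero]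
        have e1 : pc 1 (vec n k 1 x) (clusterSet n k 0 (k + 1 - l) (l + m - k - 1)) =
            pc 0 (vec n k 1 x) (clusterSet n k 0 (k + 1 - l) (l + m - k)) :=
          pc_one_eq _ (clusterSet_subset hkn (by omega) (by omega)) fun z => by
            simp only [mem_clusterSet]
            omega
        have e2 : pc 1 (vec n k 1 x) (clusterSet n k 0 (k + 1 - l) (l + m - k)) =
            pc 0 (vec n k 1 x) (clusterSet n k 0 (k + 1 - l) (l + m - k + 1)) :=
          pc_one_eq _ (clusterSet_subset hkn (by omega) (by omega)) fun z => by
            simp only [mem_clusterSet]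
            omega
        rw [e1] at hG1
        rw [← e2, hG2] at ih1
        rw [hG1]
        have h3 : at' x (1, n) * pathTotal n k x (l, m + 1) = at' x (l, m + 1) :=
          mul_right_cancel₀ hprod0 ih1
        calc _ = at' x (l, m) * (at' x (1, n) * pathTotal n k x (l, m + 1) / at' x (l, m + 1)) *
              ∏ i ∈ Finset.Ioc l k, at' x (i, m) := by ring
          _ = _ := by rw [h3, div_self hx1, mul_one]
      · have hp2 : (l - 1, m + 1) ∈ lat1 n k := mem_lat1.2 (by omega)
        have ih2 := ih hp2 (mem_lat1.1 hp2) (by omega)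
        have hI : Finset.Ioc (l - 1) k = insert l (Finset.Ioc l k) := by
          ext z
          simp only [Finset.mem_Ioc, Finset.mem_insert]
          omega
        rw [hI, Finset.prod_insert (by simp), show l - 1 + (m + 1) - k = l + m - k by omega,
          show k + 1 - (l - 1) = k + 1 - l + 1 by omega] at ih2
        have hG3 : pc 1 (vec n k 1 x) (clusterSet n k 0 (k + 1 - l - 1) (l + m - k)) =
            ∏ i ∈ Finset.Ioc l k, at' x (i, m) := by
          rw [hL.pc_vec_clusterSet hkn hx (by omega) (by omega), show k - (k + 1 - l - 1) = l by omega]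
          refine Finset.prod_congr rfl fun i hi => ?_
          rw [Finset.mem_Ioc] at hi
          rw [show l + m - k + (k + 1 - l - 1) - 1 + 1 = m by omega]
        -- In the interior the exchange relation is the path recursion, multiplied by the monomial
        -- of the base point `1` coordinate.
        have hex := hV.cluster_exchange hkn (j := k + 1 - l) (a := l + m - k) (by omega) (by omega)
          (by omega) (by omega)
        rw [← ih1, ← ih2, hG1, hG2, hG3] at hex
        have hne := mul_ne_zero hx1 hprod0
        refine mul_right_cancel₀ hne ?_
        rw [hex]
        field_simp

/-- The conventions for `pathSum` at `l + m = k` and `l = k + 1` are the values for which the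
formula for path sums persists there. -/
theorem pathSum_eq (hk : 1 ≤ k) (hkn : k ≤ n) {x : lat1 n k → ℂ} (hx : x ∈ torus (lat1 n k))
    {l m : ℕ} (hl : 1 ≤ l) (hlk : l ≤ k + 1) (hkl : k ≤ l + m) (hlm : l + m ≤ n + 1) :
    at' x (1, n) * pathSum n k x (l, m) * ∏ i ∈ Finset.Ioc l k, at' x (i, m) =
      pc 0 (vec n k 1 x) (clusterSet n k 0 (k + 1 - l) (l + m - k)) := by
  have hL := isWord_lat1 (n := n) (k := k)
  have h1n := at'_ne_zero hx (1, n)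
  unfold pathSum
  dsimp only
  split_ifs with h1 h2
  · rw [mul_one_div_cancel h1n, one_mul]
    have e : pc 1 (vec n k 1 x) (clusterSet n k 0 (k - l) 0) =
        pc 0 (vec n k 1 x) (clusterSet n k 0 (k + 1 - l) (l + m - k)) :=
      pc_one_eq _ (clusterSet_subset hkn (by omega) (by omega)) fun z => by
        simp only [mem_clusterSet]
        omega
    rw [← e, hL.pc_vec_clusterSet hkn hx (by omega) (by omega), show k - (k - l) = l by omega]
    refine Finset.prod_congr rfl fun i hi => ?_
    rw [Finset.mem_Ioc] at hi
    rw [show 0 + (k - l) - 1 + 1 = m by omega]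
  · exact pathTotal_eq hkn hx h2
  · obtain rfl : l = k + 1 := by
      rw [mem_lat1] at h2
      omega
    rw [Nat.sub_self, lowest_eq_zero_left, lowest_vec_one hk hkn hx, Finset.Ioc_eq_empty (by omega),
      Finset.prod_empty, mul_one, mul_one]

/-- The map `Σ` in terms of the coordinates of `v_1(x)`. -/
theorem mapSigma_eq (hk : 1 ≤ k) (hkn : k ≤ n) {x : lat1 n k → ℂ} (hx : x ∈ torus (lat1 n k)) :
    mapSigma n k x = clusterVars 0 (lat2 n k) (vec n k 1 x) := by
  funext ⟨⟨l, m⟩, hp⟩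
  have h := (isWord_lat2.mem_iff l m).1 hp
  have h1 := pathSum_eq hk hkn hx (l := l) (m := m) (by omega) (by omega) (by omega) (by omega)
  have h2 := pathSum_eq hk hkn hx (l := l + 1) (m := m) (by omega) (by omega) (by omega) (by omega)
  rw [mapSigma, clusterVars]
  dsimp only
  rw [Nat.sub_zero, ← h1, show k - l = k + 1 - (l + 1) by omega,
    show l + m - k + 1 = l + 1 + m - k by omega, ← h2]
  have h1n := at'_ne_zero hx (1, n)
  have hx1 := at'_ne_zero hx (l + 1, m)
  have hprod0 : ∏ i ∈ Finset.Ioc (l + 1) k, at' x (i, m) ≠ 0 :=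
    Finset.prod_ne_zero_iff.2 fun i _ => at'_ne_zero hx _
  have hI : ∏ i ∈ Finset.Ioc l k, at' x (i, m) =
      at' x (l + 1, m) * ∏ i ∈ Finset.Ioc (l + 1) k, at' x (i, m) := by
    rcases h.2.1.eq_or_lt with rfl | hlk
    · rw [Finset.Ioc_self, Finset.Ioc_eq_empty (by omega), Finset.prod_empty,
        at'_of_notMem x (by rw [mem_lat1]; omega), mul_one]
    · have : Finset.Ioc l k = insert (l + 1) (Finset.Ioc (l + 1) k) := by
        ext z
        simp only [Finset.mem_Ioc, Finset.mem_insert]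
        omega
      rw [this, Finset.prod_insert (by simp)]
  rw [hI]
  -- If the denominator vanishes, both quotients are `0` by the convention for division, so the
  -- identity holds on the whole torus.
  by_cases h0 : pathSum n k x (l + 1, m) = 0
  · simp [h0]
  · field_simp

end Paths

/-! ### The crystal axioms on vectors -/

section VectorCrystal

variable {n k : ℕ}

theorem expE_eq (i : Fin (n + 1)) (a : ℂ) (v : FundRep n k) :
    expE i a v = v + a • chevE i v := rfl

theorem cf_zero (s : Finset (Fin (n + 1))) : cf (0 : FundRep n k) s = 0 := by
  unfold cf
  split_ifs <;> rfl

theorem chevE_chevE_self (i : Fin (n + 1)) (v : FundRep n k) : chevE i (chevE i v) = 0 := by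
  refine cf_ext fun s => ?_
  rw [cf_chevE, cf_chevE, cf_zero]
  split_ifs with h1 h2
  · simp at h2
  · rfl
  · rfl

theorem chevE_comm {i j : Fin (n + 1)} (hij : i ≠ j) (h1 : j ≠ i + 1) (h2 : i ≠ j + 1)
    (v : FundRep n k) : chevE i (chevE j v) = chevE j (chevE i v) := by
  have h3 : i + 1 ≠ j + 1 := fun h => hij (add_right_cancel h)
  have hset : ∀ s : Finset (Fin (n + 1)), insert (j + 1) ((insert (i + 1) (s.erase i)).erase j) =
      insert (i + 1) ((insert (j + 1) (s.erase j)).erase i) := by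
    intro s
    ext z
    simp only [Finset.mem_insert, Finset.mem_erase]
    grind
  refine cf_ext fun s => ?_
  simp only [cf_chevE, Finset.mem_insert, Finset.mem_erase, hset, h1, h2, h3, h3.symm, h1.symm,
    h2.symm, hij, hij.symm, ne_eq, not_false_eq_true, true_and, false_or]
  split_ifs <;> tauto

/-- The entries of a tableau are distinct: after the first `e_i` and an adjacent `e_j`, either `i`
is still occupied or `i + 1` is still absent, and the second `e_i` gives zero. -/
theorem chevE_chevE_chevE (hn : 2 ≤ n) {i j : Fin (n + 1)} (h : j = i + 1 ∨ i = j + 1)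
    (v : FundRep n k) : chevE i (chevE j (chevE i v)) = 0 := by
  refine cf_ext fun s => ?_
  rw [cf_chevE, cf_chevE, cf_chevE, cf_zero]
  rcases h with rfl | rfl
  · have h1 := add_two_ne hn i
    have h2 := add_one_ne (by omega) i
    simp [h1.symm, h2.symm]
  · have h1 := add_two_ne hn j
    have h2 := add_one_ne (by omega) (j + 1)
    simp [h1, h2]

theorem chevE_expE (i j : Fin (n + 1)) (a : ℂ) (v : FundRep n k) :
    chevE i (expE j a v) = chevE i v + a • chevE i (chevE j v) := by
  rw [expE, chevE_add, chevE_smul]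

theorem expE_expE_self (i : Fin (n + 1)) (a b : ℂ) (v : FundRep n k) :
    expE i a (expE i b v) = expE i (a + b) v := by
  rw [expE_eq i a, chevE_expE, chevE_chevE_self, smul_zero, add_zero, expE, expE, add_smul]
  abel

theorem expE_comm {i j : Fin (n + 1)} (hij : i ≠ j) (h1 : j ≠ i + 1) (h2 : i ≠ j + 1) (a b : ℂ)
    (v : FundRep n k) : expE i a (expE j b v) = expE j b (expE i a v) := by
  rw [expE_eq i a, chevE_expE, expE_eq j b (expE i a v), chevE_expE, chevE_comm hij h1 h2, expE,
    expE, smul_add, smul_add, smul_comm]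
  abel

theorem aC_add (i : Fin (n + 1)) (v w : FundRep n k) : aC i (v + w) = aC i v + aC i w :=
  cf_add _ _ _

theorem aC_smul (i : Fin (n + 1)) (c : ℂ) (v : FundRep n k) : aC i (c • v) = c * aC i v :=
  cf_smul _ _ _

theorem dC_smul (i : Fin (n + 1)) (c : ℂ) (v : FundRep n k) : dC i (c • v) = c * dC i v :=
  cf_smul _ _ _

theorem aC_expE (i j : Fin (n + 1)) (a : ℂ) (v : FundRep n k) :
    aC i (expE j a v) = aC i v + a * aC i (chevE j v) := by
  rw [expE, aC_add, aC_smul]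

theorem aC_chevE_self (hn : 1 ≤ n) (i : Fin (n + 1)) (v : FundRep n k) : aC i (chevE i v) = 0 := by
  rw [aC, cf_chevE, if_neg]
  have := add_one_ne hn i
  simp

theorem aC_chevE_of_comm (hk : 1 ≤ k) (hkn : k ≤ n) {i j : Fin (n + 1)} (hij : i ≠ j)
    (h1 : j ≠ i + 1) (h2 : i ≠ j + 1) (v : FundRep n k) : aC i (chevE j v) = 0 := by
  rw [aC, cf_chevE, if_neg]
  rintro ⟨h3, h4⟩
  have h5 := mem_cycInt_and_add_one hk hkn (i := j) (j := i)
  simp only [Finset.mem_insert, Finset.mem_erase] at h3 h4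
  have h6 : j + 1 ≠ i + 1 := fun h => hij (add_right_cancel h).symm
  tauto

theorem aC_chevE_chevE (hn : 2 ≤ n) {i j : Fin (n + 1)} (h : j = i + 1 ∨ i = j + 1)
    (v : FundRep n k) : aC i (chevE j (chevE i v)) = 0 := by
  rw [aC, cf_chevE, cf_chevE]
  rcases h with rfl | rfl
  · have h1 := add_two_ne hn i
    have h2 := add_one_ne (by omega) i
    simp [h1.symm, h2.symm]
  · have h1 := add_two_ne hn j
    have h2 := add_one_ne (by omega) (j + 1)
    simp [h1, h2]

section ActC

variable (hk : 1 ≤ k) (hkn : k ≤ n)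
include hk hkn

theorem dC_actC_self {i : Fin (n + 1)} {v : FundRep n k} (ha : aC i v ≠ 0) (c : ℂ) :
    dC i (actC i c v) = c * dC i v := by
  rw [actC, dC_expE_self hk hkn]
  field_simp
  ring

theorem dC_actC_of_ne {i j : Fin (n + 1)} (hij : i ≠ j) (c : ℂ) (v : FundRep n k) :
    dC j (actC i c v) = dC j v :=
  dC_expE_of_ne hk hkn hij _ _

theorem aC_actC_self (i : Fin (n + 1)) (c : ℂ) (v : FundRep n k) :
    aC i (actC i c v) = aC i v := by
  rw [actC, aC_expE, aC_chevE_self (by omega), mul_zero, add_zero]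

theorem gammaC_actC {i : Fin (n + 1)} {v : FundRep n k} (ha : aC i v ≠ 0) (j : Fin (n + 1))
    (c : ℂ) : gammaC j (actC i c v) = c ^ cartan n i j * gammaC j v := by
  unfold gammaC
  rw [← Finset.mul_prod_erase _ _ (Finset.mem_univ i), ← Finset.mul_prod_erase _
    (fun l => dC l v ^ cartan n l j) (Finset.mem_univ i), dC_actC_self hk hkn ha, mul_zpow,
    mul_assoc]
  congr 2
  refine Finset.prod_congr rfl fun l hl => ?_
  rw [dC_actC_of_ne hk hkn (Finset.ne_of_mem_erase hl).symm]

theorem epsC_actC {i : Fin (n + 1)} {v : FundRep n k} (ha : aC i v ≠ 0) (c : ℂ) :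
    epsC i (actC i c v) = c⁻¹ * epsC i v := by
  rw [epsC, epsC, aC_actC_self hk hkn, dC_actC_self hk hkn ha, mul_comm c, ← div_div, div_eq_mul_inv,
    mul_comm]

theorem epsC_actC_of_comm {i j : Fin (n + 1)} (hij : i ≠ j) (h1 : j ≠ i + 1) (h2 : i ≠ j + 1)
    (c : ℂ) (v : FundRep n k) : epsC i (actC j c v) = epsC i v := by
  rw [epsC, epsC, dC_actC_of_ne hk hkn hij.symm, actC, aC_expE,
    aC_chevE_of_comm hk hkn hij h1 h2, mul_zero, add_zero]

theorem actC_actC {i : Fin (n + 1)} {v : FundRep n k} (ha : aC i v ≠ 0) (c c' : ℂ) :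
    actC i c (actC i c' v) = actC i (c * c') v := by
  rw [actC, aC_actC_self hk hkn, dC_actC_self hk hkn ha, actC, expE_expE_self, actC]
  congr 1
  field_simp
  ring

theorem actC_comm {i j : Fin (n + 1)} (hij : i ≠ j) (h1 : j ≠ i + 1) (h2 : i ≠ j + 1)
    (c c' : ℂ) (v : FundRep n k) : actC i c (actC j c' v) = actC j c' (actC i c v) := by
  have key : ∀ {i j : Fin (n + 1)}, i ≠ j → j ≠ i + 1 → i ≠ j + 1 → ∀ c : ℂ,
      aC i (actC j c v) = aC i v := by
    intro i j hij h1 h2 c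
    rw [actC, aC_expE, aC_chevE_of_comm hk hkn hij h1 h2, mul_zero, add_zero]
  rw [actC, dC_actC_of_ne hk hkn hij.symm, key hij h1 h2,
    show actC j c' (actC i c v) = expE j ((c' - 1) * dC j (actC i c v) / aC j (actC i c v))
      (actC i c v) from rfl,
    dC_actC_of_ne hk hkn hij, key hij.symm h2 h1, actC, actC, expE_comm hij h1 h2]

end ActC

theorem exists_wn_eq (w : ℕ) (hw : w < n + 1) (i : Fin (n + 1)) : ∃ r, wn n r w = i :=
  ⟨i.val + (n + 1 - w), by
    rw [wn, show i.val + (n + 1 - w) + w = i.val + (n + 1) by omega]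
    exact Fin.ext (by simp [Fin.ofNat, Nat.mod_eq_of_lt i.2])⟩

theorem pc_chevE {r w : ℕ} (hw : w < n) (v : FundRep n k) {s : Finset ℕ}
    (hs : s ⊆ Finset.range (n + 1)) : pc r (chevE (wn n r w) v) s =
      if w ∈ s ∧ w + 1 ∉ s then pc r v (insert (w + 1) (s.erase w)) else 0 := by
  have h1 := wn_mem_image (n := n) (r := r) (m := w) (by omega) hs
  have h2 := wn_mem_image (n := n) (r := r) (m := w + 1) (by omega) hs
  rw [pc, cf_chevE, wn_add_one]
  simp only [h1, h2]
  rw [← wn_image_erase (by omega) hs, ← Finset.image_insert, pc]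

theorem dC_eq_pc (hkn : k ≤ n) {r w : ℕ} (hw : w < n + 1) (v : FundRep n k) :
    dC (wn n r w) v = pc r v (clusterSet n k 0 (min k (w + 1)) (w + 1 - k)) := by
  rw [dC, cycInt_wn hkn hw, pc]

theorem aC_eq_pc (hkn : k ≤ n) {r w : ℕ} (hw : w < n) (v : FundRep n k) : aC (wn n r w) v =
    pc r v (insert (w + 1) ((clusterSet n k 0 (min k (w + 1)) (w + 1 - k)).erase w)) := by
  rw [aC, cycInt_wn hkn (by omega), wn_add_one, ← wn_image_erase (by omega)
    (clusterSet_subset hkn (by omega) (by omega)), ← Finset.image_insert, pc]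

/-- The relation between the functions attached to two adjacent vertices. -/
theorem IsPlucker.aC_mul_aC (hn : 2 ≤ n) (hk : 1 ≤ k) (hkn : k ≤ n) {v : FundRep n k}
    (hv : ∀ r, IsPlucker r v) (i : Fin (n + 1)) : aC i v * aC (i + 1) v =
      aC i (chevE (i + 1) v) * dC (i + 1) v + aC (i + 1) (chevE i v) * dC i v := by
  -- The base point is chosen so that neither of the letters `i`, `i + 1` wraps around: `i` gets
  -- position `k - 1`, or `k - 2` when `k = n`.
  have key : ∀ r w, w + 1 < n → ((w + 1 = k ∧ k < n) ∨ (w + 2 = k ∧ k = n)) → wn n r w = i →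
      aC i v * aC (i + 1) v =
        aC i (chevE (i + 1) v) * dC (i + 1) v + aC (i + 1) (chevE i v) * dC i v := by
    rintro r w hw hwk rfl
    have hsub : ∀ w' ≤ w + 1, insert (w' + 1)
        ((clusterSet n k 0 (min k (w' + 1)) (w' + 1 - k)).erase w') ⊆ Finset.range (n + 1) := by
      intro w' hw' z
      simp only [Finset.mem_insert, Finset.mem_erase, mem_clusterSet, Finset.mem_range]
      omega
    rw [wn_add_one, aC_eq_pc hkn (by omega), aC_eq_pc hkn (by omega), aC_eq_pc hkn (by omega),
      aC_eq_pc hkn (by omega), dC_eq_pc hkn (by omega), dC_eq_pc hkn (by omega),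
      pc_chevE (by omega) _ (hsub _ (by omega)), pc_chevE (by omega) _ (hsub _ (by omega))]
    rcases hwk with ⟨hwk, hkn'⟩ | ⟨hwk, hkn'⟩
    · rcases Nat.eq_zero_or_pos w with rfl | hw0
      · obtain rfl : k = 1 := by omega
        rw [if_pos (by simp [mem_clusterSet]), if_neg (by simp [mem_clusterSet]),
          zero_mul, add_zero, mul_comm]
        congr 2
        · ext z
          simp only [Finset.mem_insert, Finset.mem_erase, mem_clusterSet]
          omega
        · ext z
          simp only [Finset.mem_insert, Finset.mem_erase, mem_clusterSet]
          omega
      · rw [if_pos (by simp [mem_clusterSet]; omega), if_pos (by simp [mem_clusterSet]; omega)]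
        have h := hv r (Finset.Ico 1 w) (fun z => by
          simp only [Finset.mem_Ico, Finset.mem_range]
          omega) 0 w (w + 1) (w + 2) hw0 (by omega) (by omega) (by omega) (by simp) (by simp)
          (by simp) (by simp)
        have hswap : ∀ a b c d e f : ℂ, a * b = c * d + e * f → a * b = e * f + d * c :=
          fun a b c d e f h => by rw [h]; ring
        refine (congrArg₂ (· * ·) (congrArg (pc r v) ?_) (congrArg (pc r v) ?_)).trans
          ((hswap _ _ _ _ _ _ h).trans (congrArg₂ (· + ·)
            (congrArg₂ (· * ·) (congrArg (pc r v) ?_) (congrArg (pc r v) ?_))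
            (congrArg₂ (· * ·) (congrArg (pc r v) ?_) (congrArg (pc r v) ?_)))) <;> ext z <;>
          simp only [Finset.mem_insert, Finset.mem_erase, mem_clusterSet, Finset.mem_Ico] <;> omega
    · rw [if_neg (by simp [mem_clusterSet]; omega), if_pos (by simp [mem_clusterSet]; omega),
        zero_mul, zero_add]
      congr 2
      · ext z
        simp only [Finset.mem_insert, Finset.mem_erase, mem_clusterSet]
        omega
      · ext z
        simp only [Finset.mem_insert, Finset.mem_erase, mem_clusterSet]
        omega
  rcases hkn.eq_or_lt with h | h
  · obtain ⟨r, hr⟩ := exists_wn_eq (k - 2) (by omega) i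
    exact key r (k - 2) (by omega) (by omega) hr
  · obtain ⟨r, hr⟩ := exists_wn_eq (k - 1) (by omega) i
    exact key r (k - 1) (by omega) (by omega) hr

theorem expE_braid (hn : 2 ≤ n) {i j : Fin (n + 1)} (h : j = i + 1 ∨ i = j + 1) (a b c : ℂ)
    (v : FundRep n k) : expE i a (expE j b (expE i c v)) =
      v + (a + c) • chevE i v + b • chevE j v + (a * b) • chevE i (chevE j v) +
        (b * c) • chevE j (chevE i v) := by
  rw [expE_eq i a, expE_eq j b, expE_eq i c]
  simp only [chevE_add, chevE_smul, chevE_chevE_chevE hn h, chevE_chevE_self, smul_zero, add_zero,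
    smul_add, smul_smul, add_smul]
  abel

/-- The outer and the inner parameter of `e_i` in the triple product add up to a single fraction;
here the Plücker relation `hAA` enters. -/
theorem braid_scalars {A A' D D' P Q S T c₁ c₂ : ℂ} (hA : A ≠ 0) (hS : S ≠ 0)
    (hT : T ≠ 0) (hSe : S = P * D + c₁ * (Q * D')) (hTe : T = Q * D' + c₂ * (P * D))
    (hAA : A * A' = Q * D' + P * D) :
    (c₁ - 1) * D * T / (A * S) + (c₂ - 1) * D / A = (c₁ * c₂ - 1) * D * A' / S := by
  field_simp
  subst hSe hTe
  linear_combination -(D * (c₁ * c₂ - 1)) * hAA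

/-- The right side is arranged to be symmetric under exchanging `(i, c₁)` with `(j, c₂)`, which
turns one side of the braid relation into the other. -/
theorem actC_triple (hn : 2 ≤ n) (hk : 1 ≤ k) (hkn : k ≤ n) {v : FundRep n k}
    {i j : Fin (n + 1)} (hij : j = i + 1 ∨ i = j + 1) {c₁ c₂ : ℂ} (hc₂ : c₂ ≠ 0)
    (hi0 : aC i v ≠ 0) (hj0 : aC j v ≠ 0) (hi1 : aC i (actC j c₁ v) ≠ 0)
    (hj1 : aC j (actC i c₂ v) ≠ 0)
    (hrel : aC i v * aC j v = aC i (chevE j v) * dC j v + aC j (chevE i v) * dC i v) :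
    actC i c₁ (actC j (c₁ * c₂) (actC i c₂ v)) =
      v + ((c₁ * c₂ - 1) * dC i v * aC j v /
          (aC j (chevE i v) * dC i v + c₁ * (aC i (chevE j v) * dC j v))) • chevE i v +
        ((c₁ * c₂ - 1) * dC j v * aC i v /
          (aC i (chevE j v) * dC j v + c₂ * (aC j (chevE i v) * dC i v))) • chevE j v +
        ((c₁ - 1) * (c₁ * c₂ - 1) * dC i v * dC j v /
          (aC j (chevE i v) * dC i v + c₁ * (aC i (chevE j v) * dC j v))) •
            chevE i (chevE j v) +
        ((c₂ - 1) * (c₁ * c₂ - 1) * dC i v * dC j v /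
          (aC i (chevE j v) * dC j v + c₂ * (aC j (chevE i v) * dC i v))) •
            chevE j (chevE i v) := by
  have hne : i ≠ j := by
    rcases hij with h | h
    · exact h ▸ (add_one_ne (by omega) i).symm
    · exact h ▸ add_one_ne (by omega) j
  -- The relation `hrel` factors both denominators into coordinates assumed to be nonzero.
  have hS : aC j (chevE i v) * dC i v + c₁ * (aC i (chevE j v) * dC j v) =
      aC j v * aC i (actC j c₁ v) := by
    rw [actC, aC_expE]
    field_simp
    linear_combination -hrel
  have hT : aC i (chevE j v) * dC j v + c₂ * (aC j (chevE i v) * dC i v) =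
      aC i v * aC j (actC i c₂ v) := by
    rw [actC, aC_expE]
    field_simp
    linear_combination -hrel
  have hS0 := mul_ne_zero hj0 hi1
  have hT0 := mul_ne_zero hi0 hj1
  rw [← hS] at hS0
  rw [← hT] at hT0
  have e1 : actC j (c₁ * c₂) (actC i c₂ v) = expE j ((c₁ * c₂ - 1) * dC j v * aC i v /
      (aC i (chevE j v) * dC j v + c₂ * (aC j (chevE i v) * dC i v))) (actC i c₂ v) := by
    rw [actC, dC_actC_of_ne hk hkn hne, hT]
    congr 1
    field_simp
  have e2 : dC i (actC j (c₁ * c₂) (actC i c₂ v)) = c₂ * dC i v := by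
    rw [dC_actC_of_ne hk hkn hne.symm, dC_actC_self hk hkn hi0]
  have e3 : aC i (actC j (c₁ * c₂) (actC i c₂ v)) = aC i v * c₂ *
      (aC j (chevE i v) * dC i v + c₁ * (aC i (chevE j v) * dC j v)) /
        (aC i (chevE j v) * dC j v + c₂ * (aC j (chevE i v) * dC i v)) := by
    rw [e1, aC_expE, aC_actC_self hk hkn, actC, chevE_expE, aC_add, aC_smul,
      aC_chevE_chevE hn hij, mul_zero, add_zero]
    generalize hTT : aC i (chevE j v) * dC j v + c₂ * (aC j (chevE i v) * dC i v) = T at hT0 ⊢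
    field_simp
    rw [← hTT]
    ring
  rw [actC, e2, e3, e1, actC, expE_braid hn hij]
  have h := braid_scalars (c₁ := c₁) (c₂ := c₂) hi0 hS0 hT0 rfl rfl hrel
  generalize aC j (chevE i v) * dC i v + c₁ * (aC i (chevE j v) * dC j v) = S at *
  generalize aC i (chevE j v) * dC j v + c₂ * (aC j (chevE i v) * dC i v) = T at *
  congr 1
  · congr 1
    · congr 3
      rw [← h]
      field_simp
    · congr 1
      field_simp
  · congr 1
    field_simp

theorem actC_braid (hn : 2 ≤ n) (hk : 1 ≤ k) (hkn : k ≤ n) {v : FundRep n k}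
    (hv : ∀ r, IsPlucker r v) {i j : Fin (n + 1)} (hij : j = i + 1 ∨ i = j + 1) {c₁ c₂ : ℂ}
    (hc₁ : c₁ ≠ 0) (hc₂ : c₂ ≠ 0) (hi0 : aC i v ≠ 0) (hj0 : aC j v ≠ 0)
    (hi1 : aC i (actC j c₁ v) ≠ 0) (hj1 : aC j (actC i c₂ v) ≠ 0) :
    actC i c₁ (actC j (c₁ * c₂) (actC i c₂ v)) = actC j c₂ (actC i (c₁ * c₂) (actC j c₁ v)) := by
  have hrel : aC i v * aC j v = aC i (chevE j v) * dC j v + aC j (chevE i v) * dC i v := by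
    rcases hij with rfl | rfl
    · exact IsPlucker.aC_mul_aC hn hk hkn hv i
    · rw [mul_comm, IsPlucker.aC_mul_aC hn hk hkn hv j, add_comm]
  rw [actC_triple hn hk hkn hij hc₂ hi0 hj0 hi1 hj1 hrel, mul_comm c₁ c₂,
    actC_triple hn hk hkn hij.symm hc₁ hj0 hi0 hj1 hi1 (by rw [mul_comm, hrel, add_comm])]
  rw [mul_right_comm _ (dC j v) (dC i v), mul_right_comm _ (dC j v) (dC i v)]
  abel

theorem actC_smul (i : Fin (n + 1)) (c : ℂ) {a : ℂ} (ha : a ≠ 0) (v : FundRep n k) :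
    actC i c (a • v) = a • actC i c v := by
  rw [actC, dC_smul, aC_smul, actC, expE, expE, chevE_smul, smul_add, smul_comm a]
  congr 2
  rw [mul_left_comm, mul_div_mul_left _ _ ha]

theorem epsC_smul (i : Fin (n + 1)) {a : ℂ} (ha : a ≠ 0) (v : FundRep n k) :
    epsC i (a • v) = epsC i v := by
  rw [epsC, dC_smul, aC_smul, mul_div_mul_left _ _ ha, epsC]

/-- Degeneracy of the affine Cartan matrix: it makes `gammaC` homogeneous of degree zero, so that
the scalar between `v1 x` and `v2 (mapSigma x)` is invisible to it. -/
theorem sum_cartan (hn : 2 ≤ n) (i : Fin (n + 1)) : ∑ j, cartan n j i = 0 := by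
  have h1 := add_one_ne (by omega) i
  have h2 := add_one_ne (by omega) (i - 1)
  have h3 := add_two_ne hn (i - 1)
  rw [sub_add_cancel] at h2 h3
  have h : ∀ j, cartan n j i = (if j = i then 2 else 0) + (if j = i + 1 then -1 else 0) +
      if j = i - 1 then -1 else 0 := by
    intro j
    have h4 : j = i - 1 ↔ i = j + 1 := by
      rw [eq_sub_iff_add_eq, eq_comm]
    unfold cartan
    by_cases e1 : j = i
    · subst e1
      simp [h1.symm, h2]
    · by_cases e2 : j = i + 1
      · subst e2
        simp [h1, h3]
      · simp [e1, e2, h4]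
  simp [h, Finset.sum_add_distrib]

theorem gammaC_smul (hn : 2 ≤ n) (i : Fin (n + 1)) {a : ℂ} (ha : a ≠ 0) (v : FundRep n k) :
    gammaC i (a • v) = gammaC i v := by
  unfold gammaC
  simp only [dC_smul, mul_zpow]
  have h : ∏ j, a ^ cartan n j i = a ^ ∑ j, cartan n j i := by
    induction (Finset.univ : Finset (Fin (n + 1))) using Finset.induction_on with
    | empty => simp
    | insert j s hj ih => rw [Finset.prod_insert hj, Finset.sum_insert hj, zpow_add₀ ha, ih]
  rw [Finset.prod_mul_distrib, h, sum_cartan hn, zpow_zero, one_mul]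

end VectorCrystal

/-! ### The affine crystal in torus coordinates, at positive points -/

section TorusMaps

variable (n k : ℕ)

/-- The map `Σ` in terms of cluster coordinates. -/
noncomputable def sig (x : lat1 n k → ℂ) : lat2 n k → ℂ := clusterVars 0 (lat2 n k) (vec n k 1 x)

/-- The inverse of `sig`. -/
noncomputable def sigInv (y : lat2 n k → ℂ) : lat1 n k → ℂ :=
  clusterVars 1 (lat1 n k) (vec n k 0 y)

/-- The actions `e_i^c` in the coordinates of `𝒱_1`. -/
noncomputable def hatE (i : Fin (n + 1)) (c : ℂ) (x : lat1 n k → ℂ) : lat1 n k → ℂ :=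
  if i = 0 then sigInv n k (wordE n 0 c (sig n k x)) else wordE n i c x

noncomputable def hatGamma (i : Fin (n + 1)) (x : lat1 n k → ℂ) : ℂ :=
  if i = 0 then wordGamma n 0 (sig n k x) else wordGamma n i x

noncomputable def hatEps (i : Fin (n + 1)) (x : lat1 n k → ℂ) : ℂ :=
  if i = 0 then wordEps n 0 (sig n k x) else wordEps n i x

/-- Equality up to a nonzero scalar. -/
def ProjEq {V : Type*} [AddCommGroup V] [Module ℂ V] (v w : V) : Prop := ∃ a : ℂ, a ≠ 0 ∧ v = a • w

variable {n k}

theorem ProjEq.trans {V : Type*} [AddCommGroup V] [Module ℂ V] {u v w : V} (h : ProjEq u v)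
    (h' : ProjEq v w) : ProjEq u w := by
  obtain ⟨a, ha, rfl⟩ := h
  obtain ⟨b, hb, rfl⟩ := h'
  exact ⟨a * b, mul_ne_zero ha hb, (mul_smul a b w).symm⟩

theorem ProjEq.symm {V : Type*} [AddCommGroup V] [Module ℂ V] {v w : V} (h : ProjEq v w) :
    ProjEq w v := by
  obtain ⟨a, ha, rfl⟩ := h
  exact ⟨a⁻¹, inv_ne_zero ha, by rw [smul_smul, inv_mul_cancel₀ ha, one_smul]⟩

theorem ProjEq.actC {v w : FundRep n k} (h : ProjEq v w) (i : Fin (n + 1)) (c : ℂ) :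
    ProjEq (actC i c v) (actC i c w) := by
  obtain ⟨a, ha, rfl⟩ := h
  exact ⟨a, ha, actC_smul i c ha w⟩

theorem ProjEq.aC_ne_zero {v w : FundRep n k} (h : ProjEq v w) {i : Fin (n + 1)}
    (hv : aC i v ≠ 0) : aC i w ≠ 0 := by
  obtain ⟨a, ha, rfl⟩ := h
  rw [aC_smul] at hv
  exact right_ne_zero_of_mul hv

theorem exists_wn_one {i : Fin (n + 1)} (hi : i ≠ 0) : ∃ w < n, i = wn n 1 w := by
  obtain ⟨w, hw, rfl⟩ := wn_surj n 1 i
  refine ⟨w, ?_, rfl⟩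
  by_contra h
  obtain rfl : w = n := by omega
  refine hi (Fin.ext ?_)
  simp [wn, Fin.ofNat, add_comm 1 w]

theorem zero_eq_wn : (0 : Fin (n + 1)) = wn n 0 0 := rfl

section

variable (hn : 2 ≤ n) (hk : 1 ≤ k) (hkn : k ≤ n)
include hk hkn

theorem exists_letter_lat1 {i : Fin (n + 1)} (hi : i ≠ 0) :
    ∃ m : lat1 n k, letter n m.1 = i := by
  obtain ⟨w, hw, rfl⟩ := exists_wn_one hi
  exact isWord_lat1.exists_letter hk hkn hw

theorem exists_letter_lat2 : ∃ m : lat2 n k, letter n m.1 = 0 :=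
  isWord_lat2.exists_letter hk hkn (w := 0) (by omega)

omit hk

theorem isSFMap_sig : IsSFMap (sig n k) := isWord_lat1.isSF_clusterVars_vec hkn isWord_lat2

theorem isSFMap_sigInv : IsSFMap (sigInv n k) := isWord_lat2.isSF_clusterVars_vec hkn isWord_lat1

/-- At a positive point all coordinates of the vector are positive, also for base point `0`, so the
second word produces it up to the lowest coordinate. -/
theorem vec_sig {x : lat1 n k → ℂ} (hx : x ∈ posPoints (lat1 n k)) :
    ProjEq (vec n k 0 (sig n k x)) (vec n k 1 x) := by
  have hp : ∀ j ≤ k, ∀ a ≤ n + 1 - k, 0 < pc 0 (vec n k 1 x) (clusterSet n k 0 j a) :=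
    fun j hj a ha => isWord_lat1.pc_vec_pos hkn hx 0 (clusterSet_subset hkn hj ha)
      (card_clusterSet hkn hj ha)
  exact ⟨_, inv_ne_zero (hp 0 (by omega) 0 (by omega)).ne', isWord_lat2.vec_clusterVars hkn
    (isWord_lat1.isPlucker_vec hkn (posPoints_subset_torus hx) 0) hp⟩

theorem vec_sigInv {y : lat2 n k → ℂ} (hy : y ∈ posPoints (lat2 n k)) :
    ProjEq (vec n k 1 (sigInv n k y)) (vec n k 0 y) := by
  have hp : ∀ j ≤ k, ∀ a ≤ n + 1 - k, 0 < pc 1 (vec n k 0 y) (clusterSet n k 0 j a) :=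
    fun j hj a ha => isWord_lat2.pc_vec_pos hkn hy 1 (clusterSet_subset hkn hj ha)
      (card_clusterSet hkn hj ha)
  exact ⟨_, inv_ne_zero (hp 0 (by omega) 0 (by omega)).ne', isWord_lat1.vec_clusterVars hkn
    (isWord_lat2.isPlucker_vec hkn (posPoints_subset_torus hy) 1) hp⟩

/-- The variables are quotients of coordinates, hence insensitive to scaling. Equalities between
maps of tori are proved through this lemma, by comparing vectors up to a scalar. -/
theorem IsWord.eq_of_projEq {r : ℕ} {L : Finset (ℕ × ℕ)} (hL : IsWord n k r L) {x y : L → ℂ}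
    (hx : x ∈ posPoints L) (hy : y ∈ posPoints L) (h : ProjEq (vec n k r x) (vec n k r y)) :
    x = y := by
  obtain ⟨a, ha, h⟩ := h
  rw [← hL.clusterVars_vec hkn (posPoints_subset_torus hx), h, clusterVars_smul _ _ ha,
    hL.clusterVars_vec hkn (posPoints_subset_torus hy)]

theorem sigInv_sig {x : lat1 n k → ℂ} (hx : x ∈ posPoints (lat1 n k)) :
    sigInv n k (sig n k x) = x :=
  have h := (isSFMap_sig hkn).pos hx
  isWord_lat1.eq_of_projEq hkn ((isSFMap_sigInv hkn).pos h) hx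
    ((vec_sigInv hkn h).trans (vec_sig hkn hx))

theorem sig_sigInv {y : lat2 n k → ℂ} (hy : y ∈ posPoints (lat2 n k)) :
    sig n k (sigInv n k y) = y :=
  have h := (isSFMap_sigInv hkn).pos hy
  isWord_lat2.eq_of_projEq hkn ((isSFMap_sig hkn).pos h) hy
    ((vec_sig hkn h).trans (vec_sigInv hkn hy))

theorem aC_vec_ne_zero (hk : 1 ≤ k) {x : lat1 n k → ℂ} (hx : x ∈ posPoints (lat1 n k))
    (i : Fin (n + 1)) : aC i (vec n k 1 x) ≠ 0 := by
  refine (isWord_lat1.cf_vec_pos hkn hx ?_).ne'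
  rw [card_insert_erase (self_mem_cycInt hk i) (add_one_notMem_cycInt hkn i)]
  obtain ⟨r, rfl⟩ := exists_wn_eq 0 (by omega) i
  rw [cycInt_wn hkn (by omega), card_wn_image (clusterSet_subset hkn (by omega) (by omega)),
    card_clusterSet hkn (by omega) (by omega)]

include hk

theorem isSFMap_hatE {Q : Type} (i : Fin (n + 1)) {c : (Q → ℂ) → ℂ} (hc : IsSF c)
    {x : (Q → ℂ) → lat1 n k → ℂ} (hx : IsSFMap x) : IsSFMap fun t => hatE n k i (c t) (x t) := by
  unfold hatE
  split_ifs with hi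
  · exact (isSFMap_sigInv hkn).comp
      (isSFMap_wordE (exists_letter_lat2 hk hkn) ((isSFMap_sig hkn).comp hx) hc)
  · exact isSFMap_wordE (exists_letter_lat1 hk hkn hi) hx hc

omit hk in
theorem isSF_hatGamma {Q : Type} (i : Fin (n + 1)) {x : (Q → ℂ) → lat1 n k → ℂ}
    (hx : IsSFMap x) : IsSF fun t => hatGamma n k i (x t) := by
  unfold hatGamma
  split_ifs with hi
  · exact isSF_wordGamma 0 ((isSFMap_sig hkn).comp hx)
  · exact isSF_wordGamma i hx

theorem isSF_hatEps {Q : Type} (i : Fin (n + 1)) {x : (Q → ℂ) → lat1 n k → ℂ}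
    (hx : IsSFMap x) : IsSF fun t => hatEps n k i (x t) := by
  unfold hatEps
  split_ifs with hi
  · exact isSF_wordEps (exists_letter_lat2 hk hkn) ((isSFMap_sig hkn).comp hx)
  · exact isSF_wordEps (exists_letter_lat1 hk hkn hi) hx

variable {x : lat1 n k → ℂ} (hx : x ∈ posPoints (lat1 n k)) {c : ℂ} (hc : 0 < c)
include hx

omit hk in
theorem sig_pos : sig n k x ∈ posPoints (lat2 n k) := (isSFMap_sig hkn).pos hx

include hn

theorem hatGamma_eq (i : Fin (n + 1)) : hatGamma n k i x = gammaC i (vec n k 1 x) := by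
  unfold hatGamma
  split_ifs with hi
  · rw [isWord_lat2.wordGamma_eq hk hkn (posPoints_subset_torus (sig_pos hkn hx)), hi]
    obtain ⟨a, ha, h⟩ := vec_sig hkn hx
    rw [h, gammaC_smul hn _ ha]
  · exact isWord_lat1.wordGamma_eq hk hkn (posPoints_subset_torus hx) i

theorem hatEps_eq (i : Fin (n + 1)) : hatEps n k i x = epsC i (vec n k 1 x) := by
  unfold hatEps
  split_ifs with hi
  · rw [zero_eq_wn, (isWordList_word2 hk hkn).wordEps_eq_epsC hk hkn hn (by omega)
      (sig_pos hkn hx), hi, zero_eq_wn]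
    obtain ⟨a, ha, h⟩ := vec_sig hkn hx
    rw [h, epsC_smul _ ha]
  · obtain ⟨w, hw, rfl⟩ := exists_wn_one hi
    exact (isWordList_word1 hkn).wordEps_eq_epsC hk hkn hn hw hx

include hc

omit hn in
theorem hatE_pos (i : Fin (n + 1)) : hatE n k i c x ∈ posPoints (lat1 n k) := by
  unfold hatE
  split_ifs with hi
  · exact (isSFMap_sigInv hkn).pos (wordE_pos (exists_letter_lat2 hk hkn) (sig_pos hkn hx) hc)
  · exact wordE_pos (exists_letter_lat1 hk hkn hi) hx hc

/-- For `i = 0` the action is computed in the second word, for which `0` does not wrap around. Since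
`actC` commutes with scaling, the two changes of word leave only a scalar, and all `n + 1` operators
obey one formula. -/
theorem vec_hatE (i : Fin (n + 1)) :
    ProjEq (vec n k 1 (hatE n k i c x)) (actC i c (vec n k 1 x)) := by
  unfold hatE
  split_ifs with hi
  · refine (vec_sigInv hkn
      (wordE_pos (exists_letter_lat2 hk hkn) (sig_pos hkn hx) hc)).trans ?_
    rw [zero_eq_wn, (isWordList_word2 hk hkn).vec_wordE hk hkn hn (by omega) (sig_pos hkn hx) hc,
      ← zero_eq_wn, hi]
    exact (vec_sig hkn hx).actC 0 c
  · obtain ⟨w, hw, rfl⟩ := exists_wn_one hi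
    exact ⟨1, one_ne_zero, by
      rw [one_smul, (isWordList_word1 hkn).vec_wordE hk hkn hn hw hx hc]⟩

theorem aC_actC_vec_ne_zero (i j : Fin (n + 1)) : aC i (actC j c (vec n k 1 x)) ≠ 0 :=
  (vec_hatE hn hk hkn hx hc j).aC_ne_zero (aC_vec_ne_zero hkn hk (hatE_pos hk hkn hx hc j) i)

theorem hatGamma_hatE (i j : Fin (n + 1)) :
    hatGamma n k j (hatE n k i c x) = c ^ cartan n i j * hatGamma n k j x := by
  rw [hatGamma_eq hn hk hkn (hatE_pos hk hkn hx hc i), hatGamma_eq hn hk hkn hx]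
  obtain ⟨a, ha, h⟩ := vec_hatE hn hk hkn hx hc i
  rw [h, gammaC_smul hn _ ha, gammaC_actC hk hkn (aC_vec_ne_zero hkn hk hx i)]

theorem hatEps_hatE (i : Fin (n + 1)) :
    hatEps n k i (hatE n k i c x) = c⁻¹ * hatEps n k i x := by
  rw [hatEps_eq hn hk hkn (hatE_pos hk hkn hx hc i), hatEps_eq hn hk hkn hx]
  obtain ⟨a, ha, h⟩ := vec_hatE hn hk hkn hx hc i
  rw [h, epsC_smul _ ha, epsC_actC hk hkn (aC_vec_ne_zero hkn hk hx i)]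

theorem hatEps_hatE_of_comm {i j : Fin (n + 1)} (hij : i ≠ j) (h1 : j ≠ i + 1) (h2 : i ≠ j + 1) :
    hatEps n k i (hatE n k j c x) = hatEps n k i x := by
  rw [hatEps_eq hn hk hkn (hatE_pos hk hkn hx hc j), hatEps_eq hn hk hkn hx]
  obtain ⟨a, ha, h⟩ := vec_hatE hn hk hkn hx hc j
  rw [h, epsC_smul _ ha, epsC_actC_of_comm hk hkn hij h1 h2]

variable {c' : ℂ} (hc' : 0 < c')
include hc'

theorem vec_hatE_hatE (i j : Fin (n + 1)) :
    ProjEq (vec n k 1 (hatE n k i c (hatE n k j c' x))) (actC i c (actC j c' (vec n k 1 x))) :=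
  (vec_hatE hn hk hkn (hatE_pos hk hkn hx hc' j) hc i).trans
    ((vec_hatE hn hk hkn hx hc' j).actC i c)

theorem hatE_hatE (i : Fin (n + 1)) :
    hatE n k i c (hatE n k i c' x) = hatE n k i (c * c') x := by
  refine isWord_lat1.eq_of_projEq hkn (hatE_pos hk hkn (hatE_pos hk hkn hx hc' i) hc i)
    (hatE_pos hk hkn hx (mul_pos hc hc') i) ((vec_hatE_hatE hn hk hkn hx hc hc' i i).trans ?_)
  rw [actC_actC hk hkn (aC_vec_ne_zero hkn hk hx i)]
  exact (vec_hatE hn hk hkn hx (mul_pos hc hc') i).symm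

theorem hatE_comm {i j : Fin (n + 1)} (hij : i ≠ j) (h1 : j ≠ i + 1) (h2 : i ≠ j + 1) :
    hatE n k i c (hatE n k j c' x) = hatE n k j c' (hatE n k i c x) := by
  refine isWord_lat1.eq_of_projEq hkn (hatE_pos hk hkn (hatE_pos hk hkn hx hc' j) hc i)
    (hatE_pos hk hkn (hatE_pos hk hkn hx hc i) hc' j)
    ((vec_hatE_hatE hn hk hkn hx hc hc' i j).trans ?_)
  rw [actC_comm hk hkn hij h1 h2]
  exact (vec_hatE_hatE hn hk hkn hx hc' hc j i).symm

theorem hatE_braid {i j : Fin (n + 1)} (hij : j = i + 1 ∨ i = j + 1) :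
    hatE n k i c (hatE n k j (c * c') (hatE n k i c' x)) =
      hatE n k j c' (hatE n k i (c * c') (hatE n k j c x)) := by
  have hcc := mul_pos hc hc'
  have h1 := hatE_pos hk hkn hx hc' i
  have h2 := hatE_pos hk hkn hx hc j
  refine isWord_lat1.eq_of_projEq hkn (hatE_pos hk hkn (hatE_pos hk hkn h1 hcc j) hc i)
    (hatE_pos hk hkn (hatE_pos hk hkn h2 hcc i) hc' j)
    ((vec_hatE_hatE hn hk hkn h1 hc hcc i j).trans ?_)
  refine ((((vec_hatE hn hk hkn hx hc' i).actC j (c * c')).actC i c).trans ?_).trans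
    ((vec_hatE_hatE hn hk hkn h2 hc' hcc j i).trans
      (((vec_hatE hn hk hkn hx hc j).actC i (c * c')).actC j c')).symm
  rw [actC_braid hn hk hkn (fun r => isWord_lat1.isPlucker_vec hkn (posPoints_subset_torus hx) r)
    hij hc.ne' hc'.ne' (aC_vec_ne_zero hkn hk hx i) (aC_vec_ne_zero hkn hk hx j)
    (aC_actC_vec_ne_zero hn hk hkn hx hc i j) (aC_actC_vec_ne_zero hn hk hkn hx hc' j i)]
  exact ⟨1, one_ne_zero, (one_smul _ _).symm⟩

omit hc hc'

theorem hatE_one (i : Fin (n + 1)) : hatE n k i 1 x = x := by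
  refine isWord_lat1.eq_of_projEq hkn (hatE_pos hk hkn hx one_pos i) hx
    ((vec_hatE hn hk hkn hx one_pos i).trans ⟨1, one_ne_zero, ?_⟩)
  rw [actC, sub_self, zero_mul, zero_div, expE, zero_smul, add_zero, one_smul]

include hc in
/-- The maps `hatE i c` are onto on positive points. -/
theorem exists_hatE_eq (i : Fin (n + 1)) :
    ∃ y ∈ posPoints (lat1 n k), hatE n k i c y = x := by
  have hc0 : 0 < c⁻¹ := inv_pos.2 hc
  exact ⟨_, hatE_pos hk hkn hx hc0 i, by
    rw [hatE_hatE hn hk hkn hx hc hc0, mul_inv_cancel₀ hc.ne', hatE_one hn hk hkn hx]⟩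

end

end TorusMaps

/-! ### Common denominators -/

section CommonDenominator

variable {P P' : Type} [Fintype P']

/-- The linear coordinates of a subtraction-free map have a common denominator. -/
theorem IsSFMap.common_denominator {g : (P → ℂ) → (P' → ℂ)} (hg : IsSFMap g) :
    ∃ r : (P → ℂ) → ℂ, PosPoly r ∧ ∀ φ : Module.Dual ℂ (P' → ℂ), ∃ p ∈ polyFun (P → ℂ),
      ∀ t ∈ torus P, r t ≠ 0 → φ (g t) = p t / r t := by
  classical
  choose p q hp hq h using hg
  refine ⟨fun t => ∏ i, q i t, PosPoly.prod _ fun i _ => hq i, fun φ =>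
    ⟨∑ i, fun t => φ (Pi.single i 1) * (p i t * ∏ j ∈ Finset.univ.erase i, q j t),
      Subalgebra.sum_mem _ fun i _ => ?_, fun t ht h0 => ?_⟩⟩
  · exact (polyFun _).mul_mem (const_mem_polyFun _) ((polyFun _).mul_mem (hp i).mem_polyFun
      (PosPoly.prod _ fun j _ => hq j).mem_polyFun)
  · rw [dual_pi_apply, Finset.sum_apply, Finset.sum_div]
    refine Finset.sum_congr rfl fun i _ => ?_
    have h1 : ∀ j, q j t ≠ 0 := fun j h1 => h0 (Finset.prod_eq_zero (Finset.mem_univ j) h1)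
    have h2 := h i t ht (h1 i)
    beta_reduce at h2
    beta_reduce
    rw [h2, ← Finset.mul_prod_erase _ (fun i => q i t) (Finset.mem_univ i)]
    have h3 : ∏ j ∈ Finset.univ.erase i, q j t ≠ 0 :=
      Finset.prod_ne_zero_iff.2 fun j _ => h1 j
    have := h1 i
    field_simp

end CommonDenominator

/-! ### Transfer from positive points to rational maps on the varieties -/

section Transfer

variable {n k : ℕ} (hn : 2 ≤ n) (hk : 1 ≤ k) (hkn : k ≤ n)

theorem IsWord.isSFMap_vec {r : ℕ} {L : Finset (ℕ × ℕ)} (hL : IsWord n k r L) (hkn : k ≤ n) :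
    IsSFMap (vec n k r (L := L)) := fun s => by
  obtain ⟨t, ht, htk, h⟩ := exists_pc_eq r s
  simp only [h]
  exact hL.isSF_pc_vec hkn r ht htk

theorem isChart_v1 (hkn : k ≤ n) : IsChart (V1 n k) (v1 n k) := by
  rw [V1, v1_eq_vec hkn]
  exact isWord_lat1.isChart hkn

theorem isChart_v2 (hk : 1 ≤ k) (hkn : k ≤ n) : IsChart (V2 n k) (v2 n k) := by
  rw [V2, v2_eq_vec hk hkn]
  exact isWord_lat2.isChart hkn

theorem isSFMap_v1 (hkn : k ≤ n) : IsSFMap (v1 n k) := by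
  rw [v1_eq_vec hkn]
  exact isWord_lat1.isSFMap_vec hkn

theorem isSFMap_v2 (hk : 1 ≤ k) (hkn : k ≤ n) : IsSFMap (v2 n k) := by
  rw [v2_eq_vec hk hkn]
  exact isWord_lat2.isSFMap_vec hkn

theorem coord1_v1 (hkn : k ≤ n) {x : lat1 n k → ℂ} (hx : x ∈ torus (lat1 n k)) :
    coord1 n k (v1 n k x) = x := by
  have h : ∃ y ∈ torus (lat1 n k), v1 n k y = v1 n k x := ⟨x, hx, rfl⟩
  exact (isChart_v1 hkn).injOn (Function.invFunOn_mem h) hx (Function.invFunOn_eq h)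

theorem coord2_v2 (hk : 1 ≤ k) (hkn : k ≤ n) {y : lat2 n k → ℂ} (hy : y ∈ torus (lat2 n k)) :
    coord2 n k (v2 n k y) = y := by
  have h : ∃ x ∈ torus (lat2 n k), v2 n k x = v2 n k y := ⟨y, hy, rfl⟩
  exact (isChart_v2 hk hkn).injOn (Function.invFunOn_mem h) hy (Function.invFunOn_eq h)

section

include hk hkn

theorem sigmaBar_v1 {x : lat1 n k → ℂ} (hx : x ∈ torus (lat1 n k)) :
    sigmaBar n k (v1 n k x) = v2 n k (sig n k x) := by
  rw [sigmaBar, coord1_v1 hkn hx, mapSigma_eq hk hkn hx, sig]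

/-- In the charts `sigmaBar` becomes `sig`, and `sigInv` provides the inverse. Both are
subtraction-free and mutually inverse at positive points, hence generically. -/
theorem exists_isBirationalPair :
    ∃ τ : FundRep n k → FundRep n k, IsBirationalPair (V1 n k) (V2 n k) (sigmaBar n k) τ := by
  have hσ : Generically (torus (lat1 n k)) fun x =>
      sigmaBar n k (v1 n k x) = v2 n k (sig n k x) ∧ sig n k x ∈ torus (lat2 n k) :=
    (isSFMap_sig hkn).generically_mem_torus.mono fun x hx h => ⟨sigmaBar_v1 hk hkn hx, h⟩
  have hτ : Generically (torus (lat2 n k)) fun y =>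
      v1 n k (sigInv n k (coord2 n k (v2 n k y))) = v1 n k (sigInv n k y) ∧
        sigInv n k y ∈ torus (lat1 n k) :=
    (isSFMap_sigInv hkn).generically_mem_torus.mono fun y hy h =>
      ⟨by rw [coord2_v2 hk hkn hy], h⟩
  refine ⟨fun v => v1 n k (sigInv n k (coord2 n k v)),
    (isChart_v1 hkn).isRatMap ⟨isRatFun_dual_of_isSF ((isSFMap_v2 hk hkn).comp (isSFMap_sig hkn))
      (hσ.mono fun x _ h => h.1), hσ.mono fun x _ h => ?_⟩,
    (isChart_v2 hk hkn).isRatMap ⟨isRatFun_dual_of_isSF ((isSFMap_v1 hkn).comp (isSFMap_sigInv hkn))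
      (hτ.mono fun x _ h => h.1), hτ.mono fun x _ h => ?_⟩,
    (isChart_v1 hkn).generically_iff.2 ?_, (isChart_v2 hk hkn).generically_iff.2 ?_⟩
  · beta_reduce
    rw [h.1]
    exact (isChart_v2 hk hkn).mem h.2
  · beta_reduce
    rw [h.1]
    exact (isChart_v1 hkn).mem h.2
  · refine (hσ.and isIrreducibleSet_torus (((isSFMap_sigInv hkn).comp (isSFMap_sig hkn)).generically_eq
      IsSFMap.id fun x hx => sigInv_sig hkn hx)).mono fun x hx h => ?_
    beta_reduce
    rw [h.1.1, coord2_v2 hk hkn h.1.2, h.2]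
  · refine (hτ.and isIrreducibleSet_torus (((isSFMap_sig hkn).comp (isSFMap_sigInv hkn)).generically_eq
      IsSFMap.id fun y hy => sig_sigInv hkn hy)).mono fun y hy h => ?_
    beta_reduce
    rw [h.1.1, sigmaBar_v1 hk hkn h.1.2, h.2]

variable {τ : FundRep n k → FundRep n k}
  (hτ : IsBirationalPair (V1 n k) (V2 n k) (sigmaBar n k) τ)

-- A rational inverse is generically unique. The substitution of `sigInv y` is legitimate because
-- `sigInv` maps positive points onto positive points.
include hτ in
theorem generically_inverse : Generically (torus (lat2 n k)) fun y =>
    τ (v2 n k y) = v1 n k (sigInv n k y) := by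
  have h1 : Generically (torus (lat1 n k)) fun x => τ (v2 n k (sig n k x)) = v1 n k x :=
    ((isChart_v1 hkn).generically_iff.1 hτ.2.2.1).mono fun x hx h => by
      rwa [sigmaBar_v1 hk hkn hx] at h
  have h2 := h1.comp_isSFMap (isSFMap_sigInv hkn) fun x hx =>
    ⟨sig n k x, sig_pos hkn hx, sigInv_sig hkn hx⟩
  refine (h2.and isIrreducibleSet_torus (((isSFMap_sig hkn).comp (isSFMap_sigInv hkn)).generically_eq
      IsSFMap.id fun y hy => sig_sigInv hkn hy)).mono fun y hy h => ?_
  rw [← h.1, h.2]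

theorem generically_gamma (τ : FundRep n k → FundRep n k) (i : Fin (n + 1)) :
    Generically (torus (lat1 n k)) fun x =>
      (affineCrystal n k τ).gamma i (v1 n k x) = hatGamma n k i x :=
  (isSFMap_sig hkn).generically_mem_torus.mono fun x hx h => by
    simp only [affineCrystal, crystal1, crystal2, hatGamma, coord1_v1 hkn hx,
      sigmaBar_v1 hk hkn hx, coord2_v2 hk hkn h]

theorem generically_eps (τ : FundRep n k → FundRep n k) (i : Fin (n + 1)) :
    Generically (torus (lat1 n k)) fun x =>
      (affineCrystal n k τ).eps i (v1 n k x) = hatEps n k i x :=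
  (isSFMap_sig hkn).generically_mem_torus.mono fun x hx h => by
    simp only [affineCrystal, crystal1, crystal2, hatEps, coord1_v1 hkn hx,
      sigmaBar_v1 hk hkn hx, coord2_v2 hk hkn h]

end

section Option

variable {P : Type}

theorem isSFMap_tail : IsSFMap fun (z : Option P → ℂ) (p : P) => z (some p) :=
  fun p => IsSF.var (some p)

theorem elim_mem_posPoints {c : ℂ} (hc : 0 < c) {t : P → ℂ} (ht : t ∈ posPoints P) :
    (fun o : Option P => o.elim c t) ∈ posPoints (Option P) := fun o => by
  cases o
  exacts [hc, ht _]

end Option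

include hn hk hkn

variable {τ : FundRep n k → FundRep n k}
  (hτ : IsBirationalPair (V1 n k) (V2 n k) (sigmaBar n k) τ)
include hτ

theorem generically_e (i : Fin (n + 1)) :
    Generically (torus (Option (lat1 n k))) fun z =>
      (affineCrystal n k τ).e i (z none) (v1 n k fun p => z (some p)) =
        v1 n k (hatE n k i (z none) fun p => z (some p)) := by
  have htail := isSFMap_tail (P := lat1 n k)
  by_cases hi : i = 0
  · have hS := (isSFMap_sig hkn).comp htail
    -- The inverse `τ` is known only generically, so the image of the action must meet the good
    -- locus; every positive `y` is attained with parameter `1`.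
    have h1 := (generically_inverse hk hkn hτ).comp_isSFMap
      (g := fun z : Option (lat1 n k) → ℂ => wordE n 0 (z none) (sig n k fun p => z (some p)))
      (isSFMap_wordE (exists_letter_lat2 hk hkn) hS (IsSF.var none)) fun y hy => by
        have hy' := (isSFMap_sigInv hkn).pos hy
        refine ⟨_, elim_mem_posPoints one_pos hy', ?_⟩
        have h2 := (vec_hatE hn hk hkn hy' one_pos 0)
        refine isWord_lat2.eq_of_projEq hkn (wordE_pos (exists_letter_lat2 hk hkn)
          (sig_pos hkn hy') one_pos) hy ?_
        change ProjEq (vec n k 0 (wordE n 0 1 (sig n k (sigInv n k y)))) _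
        rw [sig_sigInv hkn hy]
        refine ⟨1, one_ne_zero, ?_⟩
        rw [zero_eq_wn, (isWordList_word2 hk hkn).vec_wordE hk hkn hn (by omega) hy one_pos, actC,
          sub_self, zero_mul, zero_div, expE, zero_smul, add_zero, one_smul]
    refine (h1.and isIrreducibleSet_torus hS.generically_mem_torus).mono fun z hz h => ?_
    have hz' : (fun p => z (some p)) ∈ torus (lat1 n k) := fun p => hz (some p)
    simp only [affineCrystal, hatE, if_pos hi, crystal2]
    rw [sigmaBar_v1 hk hkn hz', coord2_v2 hk hkn h.2, h.1]
  · refine Generically.of_forall ⟨1, posPoints_subset_torus one_mem_posPoints⟩ fun z hz => ?_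
    have hz' : (fun p => z (some p)) ∈ torus (lat1 n k) := fun p => hz (some p)
    simp only [affineCrystal, hatE, if_neg hi, crystal1]
    rw [coord1_v1 hkn hz']

/-- Iterating the actions: the crystal operators in the coordinates of the torus. -/
theorem Generically.e_step {Q : Type} [Fintype Q] (i : Fin (n + 1)) {c : (Q → ℂ) → ℂ} (hc : IsSF c)
    {g : (Q → ℂ) → lat1 n k → ℂ} (hg : IsSFMap g) {F : (Q → ℂ) → FundRep n k}
    (hF : Generically (torus Q) fun z => F z = v1 n k (g z))
    (hsurj : ∀ a : ℂ, 0 < a → ∀ y ∈ posPoints (lat1 n k), ∃ z ∈ posPoints Q, c z = a ∧ g z = y) :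
    Generically (torus Q) fun z =>
      (affineCrystal n k τ).e i (c z) (F z) = v1 n k (hatE n k i (c z) (g z)) := by
  have h1 := (generically_e hn hk hkn hτ i).comp_isSFMap
    (g := fun (z : Q → ℂ) (o : Option (lat1 n k)) => o.elim (c z) (g z))
    (fun o => by
      cases o
      exacts [hc, hg _]) fun y hy => by
        obtain ⟨z, hz, h1, h2⟩ := hsurj (y none) (hy none) (fun p => y (some p))
          fun p => hy (some p)
        refine ⟨z, hz, funext fun o => ?_⟩
        cases o
        exacts [h1, congrFun h2 _]
  exact (h1.and isIrreducibleSet_torus hF).mono fun z _ h => by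
    rw [h.2]
    exact h.1

end Transfer

theorem cartan_eq_zero {n : ℕ} {i j : Fin (n + 1)} (h : cartan n i j = 0) :
    i ≠ j ∧ j ≠ i + 1 ∧ i ≠ j + 1 := by
  unfold cartan at h
  split_ifs at h <;> simp_all

theorem cartan_eq_neg_one {n : ℕ} {i j : Fin (n + 1)} (h : cartan n i j = -1) :
    j = i + 1 ∨ i = j + 1 := by
  unfold cartan at h
  split_ifs at h
  tauto

theorem neg_one_le_cartan {n : ℕ} (i j : Fin (n + 1)) : -1 ≤ cartan n i j := by
  unfold cartan
  split_ifs <;> omega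

/-! ### The axioms of a geometric crystal and the positive structure -/

section Identities

variable {n k : ℕ} (hn : 2 ≤ n) (hk : 1 ≤ k) (hkn : k ≤ n)
include hn hk hkn

variable {τ : FundRep n k → FundRep n k}
  (hτ : IsBirationalPair (V1 n k) (V2 n k) (sigmaBar n k) τ)
include hτ

section TwoParameters

variable {Q : Type} [Fintype Q] {c c' : (Q → ℂ) → ℂ} (hc : IsSF c) (hc' : IsSF c')
  {t : (Q → ℂ) → lat1 n k → ℂ} (ht : IsSFMap t)
  (hsurj : ∀ a b : ℂ, 0 < a → 0 < b → ∀ y ∈ posPoints (lat1 n k),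
    ∃ z ∈ posPoints Q, c z = a ∧ c' z = b ∧ t z = y)
include hc hc' ht hsurj

theorem generically_e_of_mul (i : Fin (n + 1)) : Generically (torus Q) fun z =>
    (affineCrystal n k τ).e i (c z * c' z) (v1 n k (t z)) =
      v1 n k (hatE n k i (c z * c' z) (t z)) := by
  refine Generically.e_step hn hk hkn hτ i (c := fun z => c z * c' z) (hc.mul hc') ht
    (Generically.of_forall ⟨1, posPoints_subset_torus one_mem_posPoints⟩ fun _ _ => rfl)
    fun a ha y hy => ?_
  obtain ⟨z, hz, h1, h2, h3⟩ := hsurj a 1 ha one_pos y hy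
  exact ⟨z, hz, by rw [h1, h2, mul_one], h3⟩

theorem generically_e_e (i j : Fin (n + 1)) : Generically (torus Q) fun z =>
    (affineCrystal n k τ).e i (c z) ((affineCrystal n k τ).e j (c' z) (v1 n k (t z))) =
      v1 n k (hatE n k i (c z) (hatE n k j (c' z) (t z))) := by
  refine Generically.e_step hn hk hkn hτ i hc (isSFMap_hatE hk hkn j hc' ht)
    (Generically.e_step hn hk hkn hτ j hc' ht
      (Generically.of_forall ⟨1, posPoints_subset_torus one_mem_posPoints⟩ fun _ _ => rfl) ?_) ?_
  · intro a ha y hy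
    obtain ⟨z, hz, -, h2, h3⟩ := hsurj 1 a one_pos ha y hy
    exact ⟨z, hz, h2, h3⟩
  · intro a ha y hy
    obtain ⟨z, hz, h1, h2, h3⟩ := hsurj a 1 ha one_pos y hy
    exact ⟨z, hz, h1, by rw [h2, h3, hatE_one hn hk hkn hy]⟩

theorem generically_e_e_e (i j : Fin (n + 1)) : Generically (torus Q) fun z =>
    (affineCrystal n k τ).e i (c z) ((affineCrystal n k τ).e j (c z * c' z)
      ((affineCrystal n k τ).e i (c' z) (v1 n k (t z)))) =
      v1 n k (hatE n k i (c z) (hatE n k j (c z * c' z) (hatE n k i (c' z) (t z)))) := by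
  have h0 := isSFMap_hatE hk hkn i hc' ht
  refine Generically.e_step hn hk hkn hτ i hc (isSFMap_hatE hk hkn j (hc.mul hc') h0)
    (Generically.e_step hn hk hkn hτ j (c := fun z => c z * c' z) (hc.mul hc') h0
      (Generically.e_step hn hk hkn hτ i hc' ht
      (Generically.of_forall ⟨1, posPoints_subset_torus one_mem_posPoints⟩ fun _ _ => rfl) ?_) ?_) ?_
  · intro a ha y hy
    obtain ⟨z, hz, -, h2, h3⟩ := hsurj 1 a one_pos ha y hy
    exact ⟨z, hz, h2, h3⟩
  · intro a ha y hy
    obtain ⟨z, hz, h1, h2, h3⟩ := hsurj a 1 ha one_pos y hy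
    exact ⟨z, hz, by rw [h1, h2, mul_one], by rw [h2, h3, hatE_one hn hk hkn hy]⟩
  · intro a ha y hy
    -- The outer parameter `a` also enters the middle action, so the target is first pulled back
    -- through `hatE j a`; the inner parameter is set to `1`.
    obtain ⟨y', hy', rfl⟩ := exists_hatE_eq hn hk hkn hy ha j
    obtain ⟨z, hz, h1, h2, h3⟩ := hsurj a 1 ha one_pos y' hy'
    exact ⟨z, hz, h1, by rw [h1, h2, h3, hatE_one hn hk hkn hy', mul_one]⟩

end TwoParameters

theorem isGeometricCrystal_affineCrystal :
    IsGeometricCrystal (cartan n) (V1 n k) (affineCrystal n k τ) := by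
  have hX := isChart_v1 (n := n) hkn
  have hG := hX.gmProd
  have hGG := hG.gmProd
  have htail := isSFMap_tail (P := lat1 n k)
  have hnone : IsSF fun z : Option (lat1 n k) → ℂ => z none := IsSF.var none
  have hE := generically_e hn hk hkn hτ
  have hEsf : ∀ i, IsSFMap fun z : Option (lat1 n k) → ℂ =>
      hatE n k i (z none) fun p => z (some p) := fun i => isSFMap_hatE hk hkn i hnone htail
  have hEmem : ∀ i, Generically (torus (Option (lat1 n k))) fun z =>
      (affineCrystal n k τ).e i (z none) (v1 n k fun p => z (some p)) ∈ V1 n k := fun i =>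
    ((hE i).and isIrreducibleSet_torus (hEsf i).generically_mem_torus).mono fun z _ h => by
      rw [h.1]
      exact hX.mem h.2
  have hEsurj : ∀ i, ∀ y ∈ posPoints (lat1 n k), ∃ z ∈ posPoints (Option (lat1 n k)),
      (hatE n k i (z none) fun p => z (some p)) = y := fun i y hy =>
    ⟨_, elim_mem_posPoints one_pos hy, hatE_one hn hk hkn hy i⟩
  have htsurj : ∀ y ∈ posPoints (lat1 n k), ∃ z ∈ posPoints (Option (lat1 n k)),
      (fun p => z (some p)) = y := fun y hy => ⟨_, elim_mem_posPoints one_pos hy, rfl⟩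
  have htt := isSFMap_tail.comp (P'' := lat1 n k) (isSFMap_tail (P := Option (lat1 n k)))
  have hc1 : IsSF fun w : Option (Option (lat1 n k)) → ℂ => w none := IsSF.var _
  have hc2 : IsSF fun w : Option (Option (lat1 n k)) → ℂ => w (some none) := IsSF.var _
  have hs : ∀ a b : ℂ, 0 < a → 0 < b → ∀ y ∈ posPoints (lat1 n k),
      ∃ w ∈ posPoints (Option (Option (lat1 n k))),
        w none = a ∧ w (some none) = b ∧ (fun p => w (some (some p))) = y := fun a b ha hb y hy =>
    ⟨_, elim_mem_posPoints ha (elim_mem_posPoints hb hy), rfl, rfl, rfl⟩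
  have hs' : ∀ a b : ℂ, 0 < a → 0 < b → ∀ y ∈ posPoints (lat1 n k),
      ∃ w ∈ posPoints (Option (Option (lat1 n k))),
        w (some none) = a ∧ w none = b ∧ (fun p => w (some (some p))) = y := fun a b ha hb y hy =>
    ⟨_, elim_mem_posPoints hb (elim_mem_posPoints ha hy), rfl, rfl, rfl⟩
  have hpos2 : ∀ w ∈ posPoints (Option (Option (lat1 n k))),
      (fun p => w (some (some p))) ∈ posPoints (lat1 n k) := fun w hw p => hw _
  have hpos1 : ∀ z ∈ posPoints (Option (lat1 n k)),
      (fun p => z (some p)) ∈ posPoints (lat1 n k) := fun z hz p => hz _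
  constructor
  · exact hX.isIrreducibleSet
  · exact fun i => hX.isRatFun (isRatFun_of_isSF (isSF_hatGamma hkn i IsSFMap.id)
      (generically_gamma hk hkn τ i))
  · exact fun i => hX.isRatFun (isRatFun_of_isSF (isSF_hatEps hk hkn i IsSFMap.id)
      (generically_eps hk hkn τ i))
  · exact fun i => hG.isRatMap ⟨isRatFun_dual_of_isSF ((isSFMap_v1 hkn).comp (hEsf i)) (hE i),
      hEmem i⟩
  · intro i
    refine hGG.generically_iff.2 ?_
    refine ((generically_e_e hn hk hkn hτ hc1 hc2 htt hs i i).and isIrreducibleSet_torus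
      ((generically_e_of_mul hn hk hkn hτ hc1 hc2 htt hs i).and isIrreducibleSet_torus
        ((isSFMap_hatE hk hkn i hc1 (isSFMap_hatE hk hkn i hc2 htt)).generically_eq
          (isSFMap_hatE hk hkn i (hc1.mul hc2) htt)
          fun w hw => hatE_hatE hn hk hkn (hpos2 w hw) (hw _) (hw _) i))).mono fun w _ h => ?_
    exact h.1.trans ((congrArg (v1 n k) h.2.2).trans h.2.1.symm)
  · intro i
    refine hX.generically_iff.2 ?_
    -- `IsDefinedAt` quantifies over all linear coordinates at a fixed point, so one denominator
    -- must serve them all. It has positive coefficients and hence does not vanish identically on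
    -- the slice with parameter `1`.
    obtain ⟨r, hr, h⟩ := ((isSFMap_v1 hkn).comp (hEsf i)).common_denominator
    have hone : IsSFMap fun (t : lat1 n k → ℂ) (o : Option (lat1 n k)) => o.elim 1 t := fun o => by
      cases o
      exacts [IsSF.one, IsSF.var _]
    have h1 : Generically (torus (lat1 n k)) fun t =>
        r (fun o : Option (lat1 n k) => o.elim 1 t) ≠ 0 := by
      obtain ⟨r', hr', h'⟩ := (hr.isSF.comp hone).eventually_ne
      exact hr'.generically h'
    have h2 := (isSFMap_hatE hk hkn i (IsSF.one (P := lat1 n k)) IsSFMap.id).generically_eq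
      IsSFMap.id fun t ht => hatE_one hn hk hkn ht i
    refine (h1.and isIrreducibleSet_torus h2).mono fun t ht ht' => ?_
    have hmem : (fun o : Option (lat1 n k) => o.elim 1 t) ∈ torus (Option (lat1 n k)) := fun o => by
      cases o
      exacts [one_ne_zero, ht _]
    refine hG.isDefinedAt hmem (hX.mem ht) fun φ => ?_
    obtain ⟨p, hp, hφ⟩ := h φ
    refine ⟨p, hp, r, hr.mem_polyFun, ht'.1, ?_, ?_⟩
    · exact ((hE i).and isIrreducibleSet_torus (hr.generically fun z _ hz => hz)).mono
        fun z hz h' => ⟨h'.2, by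
          rw [h'.1]
          exact hφ z hz h'.2⟩
    · rw [← hφ _ hmem ht'.1]
      exact congrArg (fun x => φ (v1 n k x)) ht'.2.symm
  · intro i j
    refine hG.generically_iff.2 ?_
    refine ((hE i).and isIrreducibleSet_torus
      (((generically_gamma hk hkn τ j).comp_isSFMap (hEsf i) (hEsurj i)).and isIrreducibleSet_torus
        (((generically_gamma hk hkn τ j).comp_isSFMap htail htsurj).and isIrreducibleSet_torus
          ((isSF_hatGamma hkn j (hEsf i)).generically_eq
            ((hnone.zpow (cartan n i j)).mul (isSF_hatGamma hkn j htail))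
            fun z hz => hatGamma_hatE hn hk hkn (hpos1 z hz) (hz _) i j)))).mono fun z _ h => ?_
    rw [h.1, h.2.1, h.2.2.1]
    exact h.2.2.2
  · intro i j hij _
    obtain ⟨h1, h2, h3⟩ := cartan_eq_zero hij
    refine hGG.generically_iff.2 ?_
    refine ((generically_e_e hn hk hkn hτ hc1 hc2 htt hs i j).and isIrreducibleSet_torus
      ((generically_e_e hn hk hkn hτ hc2 hc1 htt hs' j i).and isIrreducibleSet_torus
        ((isSFMap_hatE hk hkn i hc1 (isSFMap_hatE hk hkn j hc2 htt)).generically_eq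
          (isSFMap_hatE hk hkn j hc2 (isSFMap_hatE hk hkn i hc1 htt))
          fun w hw => hatE_comm hn hk hkn (hpos2 w hw) (hw _) (hw _) h1 h2 h3))).mono
      fun w _ h => ?_
    exact h.1.trans ((congrArg (v1 n k) h.2.2).trans h.2.1.symm)
  · intro i j hij _
    have hadj := cartan_eq_neg_one hij
    refine hGG.generically_iff.2 ?_
    refine ((generically_e_e_e hn hk hkn hτ hc1 hc2 htt hs i j).and isIrreducibleSet_torus
      ((generically_e_e_e hn hk hkn hτ hc2 hc1 htt hs' j i).and isIrreducibleSet_torus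
        ((isSFMap_hatE hk hkn i hc1 (isSFMap_hatE hk hkn j (hc1.mul hc2)
            (isSFMap_hatE hk hkn i hc2 htt))).generically_eq
          (isSFMap_hatE hk hkn j hc2 (isSFMap_hatE hk hkn i (hc1.mul hc2)
            (isSFMap_hatE hk hkn j hc1 htt)))
          fun w hw => hatE_braid hn hk hkn (hpos2 w hw) (hw _) (hw _) hadj))).mono
      fun w _ h => ?_
    have h' := h.2.1
    rw [mul_comm (w (some none))] at h'
    exact h.1.trans ((congrArg (v1 n k) h.2.2).trans h'.symm)
  -- The longer braid relations are vacuous: no entry of the Cartan matrix is below `-1`.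
  · intro i j hij
    have := neg_one_le_cartan i j
    omega
  · intro i j hij
    have := neg_one_le_cartan i j
    omega
  · intro i
    refine hG.generically_iff.2 ?_
    refine ((hE i).and isIrreducibleSet_torus
      (((generically_eps hk hkn τ i).comp_isSFMap (hEsf i) (hEsurj i)).and isIrreducibleSet_torus
        (((generically_eps hk hkn τ i).comp_isSFMap htail htsurj).and isIrreducibleSet_torus
          ((isSF_hatEps hk hkn i (hEsf i)).generically_eq
            (hnone.inv.mul (isSF_hatEps hk hkn i htail))
            fun z hz => hatEps_hatE hn hk hkn (hpos1 z hz) (hz _) i)))).mono fun z _ h => ?_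
    rw [h.1, h.2.1, h.2.2.1]
    exact h.2.2.2
  · intro i j hij _
    obtain ⟨h1, h2, h3⟩ := cartan_eq_zero hij
    refine hG.generically_iff.2 ?_
    refine ((hE j).and isIrreducibleSet_torus
      (((generically_eps hk hkn τ i).comp_isSFMap (hEsf j) (hEsurj j)).and isIrreducibleSet_torus
        (((generically_eps hk hkn τ i).comp_isSFMap htail htsurj).and isIrreducibleSet_torus
          ((isSF_hatEps hk hkn i (hEsf j)).generically_eq (isSF_hatEps hk hkn i htail)
            fun z hz => hatEps_hatE_of_comm hn hk hkn (hpos1 z hz) (hz _) h1 h2 h3)))).mono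
      fun z _ h => ?_
    rw [h.1, h.2.1, h.2.2.1]
    exact h.2.2.2

/-- Generically all the composites equal the subtraction-free maps `hatGamma`, `hatEps` and `hatE`.
-/
theorem isPositiveStructure_v1 :
    IsPositiveStructure (V1 n k) (affineCrystal n k τ) (v1 n k) := by
  have hX := isChart_v1 (n := n) hkn
  have hcoord : ∀ {Q : Type} [Fintype Q] {g : (Q → ℂ) → lat1 n k → ℂ} {F : (Q → ℂ) → FundRep n k},
      IsSFMap g → (Generically (torus Q) fun z => F z = v1 n k (g z)) →
      Generically (torus Q) fun z => coord1 n k (F z) = g z := by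
    intro Q _ g F hg hF
    refine (hF.and isIrreducibleSet_torus hg.generically_mem_torus).mono fun z _ h => ?_
    rw [h.1, coord1_v1 hkn h.2]
  have hne : (torus (lat1 n k)).Nonempty := ⟨1, posPoints_subset_torus one_mem_posPoints⟩
  have hinv : Generically (torus (lat1 n k)) fun t => coord1 n k (v1 n k t) = t :=
    Generically.of_forall hne fun t ht => coord1_v1 hkn ht
  refine ⟨coord1 n k, ⟨⟨?_, ?_⟩, ?_, hinv, ?_⟩, fun i => ?_, fun i => ?_, fun i => ⟨⟨?_, ?_⟩, ?_⟩⟩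
  · exact isRatFun_dual_of_isSF (isSFMap_v1 hkn) (Generically.of_forall hne fun _ _ => rfl)
  · exact Generically.of_forall hne fun t ht => hX.mem ht
  · refine hX.isRatMap ⟨isRatFun_dual_of_isSF IsSFMap.id hinv,
      Generically.of_forall hne fun t ht => ?_⟩
    beta_reduce
    rwa [coord1_v1 hkn ht]
  · exact hX.generically_iff.2 (hinv.mono fun t _ h => by rw [h])
  · exact (isSF_hatGamma hkn i IsSFMap.id).isPosFun.congr (generically_gamma hk hkn τ i)
  · exact (isSF_hatEps hk hkn i IsSFMap.id).isPosFun.congr (generically_eps hk hkn τ i)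
  all_goals
    have hg := isSFMap_hatE hk hkn i (IsSF.var (P := Option (lat1 n k)) none)
      (isSFMap_tail (P := lat1 n k))
    have hF := hcoord hg (generically_e hn hk hkn hτ i)
  · exact isRatFun_dual_of_isSF hg hF
  · exact (hF.and isIrreducibleSet_torus hg.generically_mem_torus).mono fun z _ h => by
      beta_reduce
      rw [h.1]
      exact h.2
  · exact fun m => (hg.torusChar m).isPosFun.congr (hF.mono fun z _ h => congrArg (torusChar m) h)

end Identities

end GeomCrystal

theorem theorem6p1 (n k : ℕ) (hn : 2 ≤ n) (hk1 : 1 ≤ k) (hkn : k ≤ n) :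
    (∃ τ : FundRep n k → FundRep n k,
      IsBirationalPair (V1 n k) (V2 n k) (sigmaBar n k) τ) ∧
    ∀ τ : FundRep n k → FundRep n k,
      IsBirationalPair (V1 n k) (V2 n k) (sigmaBar n k) τ →
        IsGeometricCrystal (cartan n) (V1 n k) (affineCrystal n k τ) ∧
        IsPositiveStructure (V1 n k) (affineCrystal n k τ) (v1 n k) :=
  ⟨exists_isBirationalPair hk1 hkn, fun _ hτ =>
    ⟨isGeometricCrystal_affineCrystal hn hk1 hkn hτ, isPositiveStructure_v1 hn hk1 hkn hτ⟩⟩
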